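/- **Theorem (quadratic isoperimetric inequality).** Conventions. Let $X$ be a simplicial complex. A *cycle* (or *loop*) in $X$ is a subcomplex isomorphic to a triangulation of the circle; its *length* is its number of edges. It is *full* if every simplex of $X$ all of whose vertices lie on the cycle belongs to the cycle. $X$ is *flag* if every finite nonempty set of pairwise adjacent vertices spans a simplex. The $1$-ball around a vertex $x$ is the full subcomplex spanned by the vertices at distance at most $1$ from $x$ in the $1$-skeleton. $X$ is *$7$-located* if it is flag and every full homotopically trivial cycle of length at most $7$ is contained in the $1$-ball around some vertex. A *filling diagram* for a cycle $\gamma$ in $X$ is a pair $(D,f)$ where $D$ is a triangulated $2$-disc and $f\colon D\to X$ is a simplicial map that maps $\partial D$ isomorphically onto $\gamma$. The *area* of a triangulated disc is its number of $2$-simplices, and $(D,f)$ is *minimal* if $D$ has the least area among all filling diagrams for $\gamma$. Let $X$ be a simply connected $7$-located simplicial complex, let $\gamma$ be a loop in $X$, and let $(D,f)$ be a minimal filling diagram for $\gamma$. Let $\alpha=(v_0,v_1,\dots,v_{n-1},v_0)$ be a cycle of length $n$ in $D$, and let $D_0$ be the subdisc of $D$ bounded by $\alpha$, i.e. the subcomplex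 of $D$ that is a triangulated $2$-disc with boundary $\alpha$. Then $$\operatorname{Area}(D_0) < \mathrm{const}\cdot n^2$$ for every natural number $\mathrm{const}>2$. -/

import Mathlib

universe u w

namespace PreAbstractSimplicialComplex

variable {V : Type u} {W : Type w}

/-- `v` is a vertex of `K`. (The type `V` may contain points that are not vertices of `K`.) -/
def IsVertex (K : PreAbstractSimplicialComplex V) (v : V) : Prop :=
  {v} ∈ K.faces

/-- The set of `k`-dimensional simplices of `K`. -/
def simplices (K : PreAbstractSimplicialComplex V) (k : ℕ) : Set (Finset V) :=
  {s | s ∈ K.faces ∧ s.card = k + 1}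

/-- The area: the number of `2`-simplices (used for finite complexes only). -/
noncomputable def area (K : PreAbstractSimplicialComplex V) : ℕ :=
  (K.simplices 2).ncard

open scoped Classical in
/-- The `1`-skeleton, as a simple graph. -/
def oneSkeleton (K : PreAbstractSimplicialComplex V) : SimpleGraph V where
  Adj a b := a ≠ b ∧ {a, b} ∈ K.faces
  symm := ⟨fun a b h => ⟨h.1.symm, by rw [Finset.pair_comm]; exact h.2⟩⟩
  loopless := ⟨fun _ h => h.1 rfl⟩

/-- `K` is nonempty and connected. -/
def IsConnected (K : PreAbstractSimplicialComplex V) : Prop :=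
  (∃ v, K.IsVertex v) ∧
    ∀ a b, K.IsVertex a → K.IsVertex b → K.oneSkeleton.Reachable a b

/-- `L` is a full subcomplex of `K`. -/
def IsFullSubcomplex (L K : PreAbstractSimplicialComplex V) : Prop :=
  L ≤ K ∧ ∀ s ∈ K.faces, (∀ v ∈ s, L.IsVertex v) → s ∈ L.faces

/-- `K` is flag: finite nonempty sets of pairwise adjacent vertices span simplices. -/
def IsFlag (K : PreAbstractSimplicialComplex V) : Prop :=
  ∀ s : Finset V, s.Nonempty → (∀ v ∈ s, K.IsVertex v) →
    (∀ a ∈ s, ∀ b ∈ s, a ≠ b → K.oneSkeleton.Adj a b) → s ∈ K.faces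

/-- The subcomplex spanned by the vertices at distance at most `r` from `x`. -/
def ball (K : PreAbstractSimplicialComplex V) (x : V) (r : ℕ) : PreAbstractSimplicialComplex V where
  faces := {s | s ∈ K.faces ∧ ∀ v ∈ s, K.oneSkeleton.edist x v ≤ r}
  isRelLowerSet_faces := fun _ hs =>
    ⟨(K.isRelLowerSet_faces hs.1).1, fun _ hts ht =>
      ⟨(K.isRelLowerSet_faces hs.1).2 hts ht, fun v hv => hs.2 v (hts hv)⟩⟩

open scoped Classical in
/-- The link of `K` at `σ`: simplices disjoint from `σ` that together with `σ` span a simplex. -/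
def link (K : PreAbstractSimplicialComplex V) (σ : Finset V) : PreAbstractSimplicialComplex V where
  faces := {s | s.Nonempty ∧ Disjoint s σ ∧ s ∪ σ ∈ K.faces}
  isRelLowerSet_faces := fun _ hs =>
    ⟨hs.1, fun _ hts ht => ⟨ht, Finset.disjoint_of_subset_left hts hs.2.1,
      (K.isRelLowerSet_faces hs.2.2).2 (Finset.union_subset_union_left hts)
        (ht.mono Finset.subset_union_left)⟩⟩

open scoped Classical in
/-- The subcomplex formed by the edges of a walk and their endpoints. Cycles (loops) of `K`, i.e.
subcomplexes isomorphic to a triangulation of the circle, are the complexes `walkComplex γ` for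
the closed walks `γ` of the `1`-skeleton with `γ.IsCycle`. -/
def walkComplex {G : SimpleGraph V} {a b : V} (γ : G.Walk a b) :
    PreAbstractSimplicialComplex V where
  faces := {s | s.Nonempty ∧ ∃ x y, s(x, y) ∈ γ.edges ∧ s ⊆ {x, y}}
  isRelLowerSet_faces := fun _ hs =>
    ⟨hs.1, fun _ hts ht => ⟨ht, by
      obtain ⟨_, x, y, hxy, hsub⟩ := hs
      exact ⟨x, y, hxy, Finset.Subset.trans hts hsub⟩⟩⟩

open scoped Classical in
/-- Edge-path homotopy relative to the endpoints: the congruence on edge paths generated by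
removal of backtracking and by replacing two sides of a `2`-simplex by the third one. -/
inductive EdgeHomotopic (K : PreAbstractSimplicialComplex V) :
    ∀ {a b : V}, K.oneSkeleton.Walk a b → K.oneSkeleton.Walk a b → Prop
  | refl {a b : V} (p : K.oneSkeleton.Walk a b) : EdgeHomotopic K p p
  | symm {a b : V} {p q : K.oneSkeleton.Walk a b} :
      EdgeHomotopic K p q → EdgeHomotopic K q p
  | trans {a b : V} {p q r : K.oneSkeleton.Walk a b} :
      EdgeHomotopic K p q → EdgeHomotopic K q r → EdgeHomotopic K p r
  | append {a b c : V} {p p' : K.oneSkeleton.Walk a b} {q q' : K.oneSkeleton.Walk b c} :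
      EdgeHomotopic K p p' → EdgeHomotopic K q q' →
        EdgeHomotopic K (p.append q) (p'.append q')
  | backtrack {a b : V} (h : K.oneSkeleton.Adj a b) (h' : K.oneSkeleton.Adj b a) :
      EdgeHomotopic K (.cons h (.cons h' .nil)) .nil
  | triangle {a b c : V} (hab : K.oneSkeleton.Adj a b) (hbc : K.oneSkeleton.Adj b c)
      (hac : K.oneSkeleton.Adj a c) (habc : {a, b, c} ∈ K.faces) :
      EdgeHomotopic K (.cons hab (.cons hbc .nil)) (.cons hac .nil)

/-- A closed edge path is homotopically trivial. -/
def IsHomotopicallyTrivial (K : PreAbstractSimplicialComplex V) {a : V}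
    (γ : K.oneSkeleton.Walk a a) : Prop :=
  K.EdgeHomotopic γ .nil

/-- `K` is simply connected: connected with trivial edge-path group. -/
def IsSimplyConnected (K : PreAbstractSimplicialComplex V) : Prop :=
  K.IsConnected ∧ ∀ (a : V) (γ : K.oneSkeleton.Walk a a), K.IsHomotopicallyTrivial γ

/-- `K` is `m`-located: it is flag and every full homotopically trivial cycle of length at most
`m` is contained in a `1`-ball around a vertex. -/
def IsLocated (K : PreAbstractSimplicialComplex V) (m : ℕ) : Prop :=
  K.IsFlag ∧ ∀ (a : V) (γ : K.oneSkeleton.Walk a a), γ.IsCycle →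
    IsFullSubcomplex (walkComplex γ) K → K.IsHomotopicallyTrivial γ → γ.length ≤ m →
      ∃ x, K.IsVertex x ∧ walkComplex γ ≤ K.ball x 1

/-- `e` is a boundary edge: an edge that lies in exactly one `2`-simplex. -/
def IsBoundaryEdge (K : PreAbstractSimplicialComplex V) (e : Finset V) : Prop :=
  e ∈ K.simplices 1 ∧ {t | t ∈ K.simplices 2 ∧ e ⊆ t}.ncard = 1

/-- The boundary of a (triangulated) surface: its boundary edges and their vertices. -/
def boundary (K : PreAbstractSimplicialComplex V) : PreAbstractSimplicialComplex V where
  faces := {s | s.Nonempty ∧ ∃ e, K.IsBoundaryEdge e ∧ s ⊆ e}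
  isRelLowerSet_faces := fun _ hs =>
    ⟨hs.1, fun _ hts ht => ⟨ht, by
      obtain ⟨_, e, he, hsub⟩ := hs
      exact ⟨e, he, Finset.Subset.trans hts hsub⟩⟩⟩

/-- `D` is a triangulated `2`-disc, i.e. a finite connected triangulated surface with nonempty
boundary and Euler characteristic `1`. That `D` is a surface with boundary is expressed by
`D` being pure of dimension `2` with each edge in at most two `2`-simplices and each vertex link
connected (so that every vertex link is a simplicial path or a simplicial cycle). By the
classification of compact surfaces these are exactly the triangulations of the disc. -/
structure IsTriangulatedDisc (D : PreAbstractSimplicialComplex W) : Prop where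
  finite : D.faces.Finite
  connected : D.IsConnected
  pure : ∀ s ∈ D.faces, ∃ t ∈ D.simplices 2, s ⊆ t
  edge : ∀ e ∈ D.simplices 1, {t | t ∈ D.simplices 2 ∧ e ⊆ t}.ncard ≤ 2
  link_connected : ∀ v, D.IsVertex v → (D.link {v}).IsConnected
  exists_boundary : ∃ e, D.IsBoundaryEdge e
  euler : ((D.simplices 0).ncard : ℤ) - (D.simplices 1).ncard + (D.simplices 2).ncard = 1

open scoped Classical in
/-- `f` is a simplicial map from `D` to `K` (only its values on vertices of `D` matter). -/
def IsSimplicialMap (D : PreAbstractSimplicialComplex W) (K : PreAbstractSimplicialComplex V)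
    (f : W → V) : Prop :=
  D.map f ≤ K

open scoped Classical in
/-- `(D, f)` is a filling diagram in `K` for the cycle `γ`: `D` is a triangulated disc and `f` is a
simplicial map that maps the boundary of `D` isomorphically onto `γ`. -/
structure IsFillingDiagram (K : PreAbstractSimplicialComplex V) {a : V}
    (γ : K.oneSkeleton.Walk a a) (D : PreAbstractSimplicialComplex W) (f : W → V) : Prop where
  disc : D.IsTriangulatedDisc
  simplicial : IsSimplicialMap D K f
  injOn_boundary : Set.InjOn f {v | D.boundary.IsVertex v}
  map_boundary : D.boundary.map f = walkComplex γ

/-- `(D, f)` is a minimal filling diagram: one of least area among all filling diagrams for `γ`.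
(As discs are finite, the universe of the vertex types is immaterial.) -/
def IsMinimalFillingDiagram (K : PreAbstractSimplicialComplex V) {a : V}
    (γ : K.oneSkeleton.Walk a a) (D : PreAbstractSimplicialComplex W) (f : W → V) : Prop :=
  K.IsFillingDiagram γ D f ∧
    ∀ (W' : Type w) (D' : PreAbstractSimplicialComplex W') (f' : W' → V),
      K.IsFillingDiagram γ D' f' → D.area ≤ D'.area

end PreAbstractSimplicialComplex

/-!
The proof works with finite families `T` of triangles and mod `2` boundaries `bd`. A triangulated
disc is described homologically (`IsDisc`): edges lie in at most two triangles, all of `T` and all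
links are connected, there is a boundary edge, and every cycle of edges bounds. This description
agrees with the one by the Euler characteristic (`isDisc_of_isTriangulatedDisc`,
`IsDisc.isTriangulatedDisc`), and it makes cutting and pasting easy: the disc inside a circuit may be
replaced by any other disc with the same boundary and otherwise new vertices (`IsDisc.replace`).

*Local conditions.* In a simply connected `7`-located complex, a circuit of length at most `7` without
chords lies in a `1`-ball (`isNearLocated`), so it spans a cone. By induction along chords, circuits
of length `3, 4, 5, 6, 7` span discs of area at most `1, 4, 5, 8, 9` (`exists_fill`, `fillBound`).
In a minimal disc, a part with a boundary of length at most `7` is therefore no larger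
(`IsMin.card_le_fillBound`). Applied to the stars of one, two or three vertices, this bounds the
degrees of inner vertices from below, except in borderline cases where the bound is attained. There
the star can be exchanged for a filling of the same area with more vertices of degree `4`. So a
subdisc is chosen which, among the subdiscs of minimal discs with given boundary and area, has the
largest number of inner vertices of degree `4` (`exists_isExtremal`). It is tame (`IsTame`): inner
degrees are at least `4`, the inner neighbours of a vertex of degree at most `5` have degree at least
`7`, and a vertex of degree `7` has at most one inner neighbour of degree `4`.

*Counting.* The vertices of a tame disc are sorted by their distance from the boundary; the set of
those at distance at least `k + 1` is `layers T k`. Vertices of degree `4` and `5` have positive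
curvature `6 - deg`, and they can be discharged by their neighbours of degree at least `7`
(`IsTame.discharge`), except for what neighbours outside the layer would contribute. Together with the
Gauss-Bonnet formula for a layer (`IsDisc.sum_six_sub_deg`) and a local estimate at its outermost
vertices (`IsLayer.vertex_estimate`), this compares consecutive layers (`IsLayer.step`). Exceptional
vertices form components of their own, and their number is bounded by the Euler characteristic of the
layer (`IsLayer.card_components_le`). The result is a potential that bounds the number of vertices at
each distance, grows by bounded factors in the first three steps, and decreases by at least `24` in
every later one (`IsTame.potential_succ_le`). It starts with at most four times the boundary length,
so the number of inner vertices is at most quadratic, and the constants give an area less than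
`3 * n ^ 2` (`IsTame.card_lt`).

New vertices are needed for the fillings, while the vertex type of a given diagram may be finite. The
diagram is therefore transported to `W ⊕ ULift ℕ`, in the same universe, where it is still minimal
(`isMin_image`).
-/

namespace DiscFilling

open Finset
open scoped Classical symmDiff

noncomputable section

section
/-! ### Mod 2 boundaries, discs and circuits -/

variable {W : Type*}

/-- The mod `2` boundary operator on families of finite sets: `bd k S` consists of the sets of
size `k` contained in an odd number of members of `S`. For a family `S` of triangles `bd 2 S` is
the set of its boundary edges, and for a family `z` of edges `bd 1 z` is the set of (singletons of)
vertices of odd degree. -/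
def bd (k : ℕ) (S : Finset (Finset W)) : Finset (Finset W) :=
  (S.biUnion (powersetCard k)).filter fun s => Odd #(S.filter (s ⊆ ·))

theorem mem_bd {k : ℕ} {S : Finset (Finset W)} {s : Finset W} :
    s ∈ bd k S ↔ s.card = k ∧ Odd #(S.filter (s ⊆ ·)) := by
  simp only [bd, mem_filter, mem_biUnion, mem_powersetCard]
  constructor
  · rintro ⟨⟨t, _, _, h⟩, h'⟩; exact ⟨h, h'⟩
  · rintro ⟨h, h'⟩
    obtain ⟨t, ht⟩ := card_pos.1 h'.pos
    rw [mem_filter] at ht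
    exact ⟨⟨t, ht.1, ht.2, h⟩, h'⟩

theorem odd_card_symmDiff {α : Type*} [DecidableEq α] (s t : Finset α) :
    Odd #(s ∆ t) ↔ ¬ (Odd #s ↔ Odd #t) := by
  have h1 : #(s ∆ t) = #(s \ t) + #(t \ s) := by
    rw [symmDiff_def]
    exact card_union_of_disjoint (disjoint_sdiff_sdiff)
  have h2 := card_sdiff_add_card_inter s t
  have h3 := card_sdiff_add_card_inter t s
  rw [inter_comm] at h3
  rw [h1, ← h2, ← h3]
  simp only [Nat.odd_iff]
  omega

theorem bd_symmDiff (k : ℕ) (S S' : Finset (Finset W)) :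
    bd k (S ∆ S') = bd k S ∆ bd k S' := by
  ext s
  have : (S ∆ S').filter (s ⊆ ·) = S.filter (s ⊆ ·) ∆ S'.filter (s ⊆ ·) := by
    ext t; simp only [mem_filter, mem_symmDiff]; tauto
  rw [mem_symmDiff, mem_bd, mem_bd, mem_bd, this, odd_card_symmDiff]
  tauto

@[simp] theorem bd_empty (k : ℕ) : bd k (∅ : Finset (Finset W)) = ∅ := by simp [bd]

theorem bd_singleton (k : ℕ) (t : Finset W) : bd k {t} = powersetCard k t := by
  ext s
  rw [mem_bd, mem_powersetCard, filter_singleton]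
  split_ifs with h <;> simp [h]

theorem insert_eq_symmDiff {α : Type*} [DecidableEq α] {a : α} {s : Finset α} (h : a ∉ s) :
    insert a s = {a} ∆ s := by
  ext x; simp only [mem_insert, mem_symmDiff, mem_singleton]
  by_cases hx : x = a
  · subst hx; simp [h]
  · simp [hx]

/-- `∂∂ = 0`: a set of size `k` in a set of size `k + 2` lies in exactly two sets of size `k + 1`
between them. -/
theorem bd_bd {k : ℕ} {S : Finset (Finset W)} (h : ∀ t ∈ S, t.card = k + 2) :
    bd k (bd (k + 1) S) = ∅ := by
  induction S using Finset.induction_on with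
  | empty => simp
  | insert t S ht ih =>
    rw [insert_eq_symmDiff ht, bd_symmDiff, bd_symmDiff, ih fun t ht => h t (mem_insert_of_mem ht)]
    rw [bd_singleton]
    have : bd k (powersetCard (k + 1) t) = ∅ := by
      rw [eq_empty_iff_forall_notMem]
      intro s hs
      rw [mem_bd] at hs
      obtain ⟨hs, ho⟩ := hs
      have hst : s ⊆ t := by
        obtain ⟨e, he⟩ := card_pos.1 ho.pos
        simp only [mem_filter, mem_powersetCard] at he
        exact he.2.trans he.1.1
      have : (powersetCard (k + 1) t).filter (s ⊆ ·) = (t \ s).image (fun x => insert x s) := by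
        ext e
        simp only [mem_filter, mem_powersetCard, mem_image, mem_sdiff]
        constructor
        · rintro ⟨⟨h1, h2⟩, h3⟩
          have : #(e \ s) = 1 := by rw [card_sdiff_of_subset h3]; omega
          obtain ⟨x, hx⟩ := card_eq_one.1 this
          have hx' : x ∈ e \ s := by rw [hx]; simp
          rw [mem_sdiff] at hx'
          refine ⟨x, ⟨h1 hx'.1, hx'.2⟩, ?_⟩
          rw [← union_sdiff_of_subset h3, hx]
          ext; simp
        · rintro ⟨x, ⟨hx, hx'⟩, rfl⟩
          exact ⟨⟨insert_subset hx hst, by rw [card_insert_of_notMem hx', hs]⟩, subset_insert _ _⟩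
      rw [this, card_image_of_injOn, card_sdiff_of_subset hst, h t (mem_insert_self _ _), hs] at ho
      · simp at ho
        exact absurd ho (by decide)
      · intro x hx y hy hxy
        simp only [coe_sdiff, Set.mem_sdiff, mem_coe] at hx hy
        have : x ∈ insert y s := by
          have : x ∈ insert x s := mem_insert_self _ _
          rw [show insert x s = insert y s from hxy] at this
          exact this
        rw [mem_insert] at this
        exact this.resolve_right hx.2
    rw [this]; simp

/-- The edges of a family of triangles. -/
def edges (T : Finset (Finset W)) : Finset (Finset W) := T.biUnion (powersetCard 2)

/-- The vertices of a family of finite sets. -/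
def verts (T : Finset (Finset W)) : Finset W := T.biUnion id

theorem mem_edges {T : Finset (Finset W)} {e : Finset W} :
    e ∈ edges T ↔ e.card = 2 ∧ ∃ t ∈ T, e ⊆ t := by
  simp only [edges, mem_biUnion, mem_powersetCard]
  constructor
  · rintro ⟨t, h, h1, h2⟩; exact ⟨h2, t, h, h1⟩
  · rintro ⟨h2, t, h, h1⟩; exact ⟨t, h, h1, h2⟩

theorem mem_verts {T : Finset (Finset W)} {v : W} : v ∈ verts T ↔ ∃ t ∈ T, v ∈ t := by
  simp [verts]

theorem edges_mono {S T : Finset (Finset W)} (h : S ⊆ T) : edges S ⊆ edges T :=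
  biUnion_subset_biUnion_of_subset_left _ h

theorem verts_mono {S T : Finset (Finset W)} (h : S ⊆ T) : verts S ⊆ verts T :=
  biUnion_subset_biUnion_of_subset_left _ h

theorem bd_subset_edges (S : Finset (Finset W)) : bd 2 S ⊆ edges S := filter_subset _ _

theorem exists_of_mem_bd {k : ℕ} {S : Finset (Finset W)} {s : Finset W} (h : s ∈ bd k S) :
    ∃ t ∈ S, s ⊆ t := by
  obtain ⟨t, ht⟩ := card_pos.1 (mem_bd.1 h).2.pos
  exact ⟨t, (mem_filter.1 ht).1, (mem_filter.1 ht).2⟩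

/-- A family of triangles is a triangulated disc. Every edge lies in at most two triangles; any two
triangles (taking `q = ∅`), and any two triangles at a vertex `x` (taking `q = {x}`), are joined by
a chain of triangles crossing edges that contain `q`; there is a boundary edge; and every mod `2`
cycle of edges is a boundary. -/
structure IsDisc (T : Finset (Finset W)) : Prop where
  card_eq : ∀ t ∈ T, t.card = 3
  edge_le : ∀ e : Finset W, e.card = 2 → #(T.filter (e ⊆ ·)) ≤ 2
  conn : ∀ q : Finset W, q.card ≤ 1 → ∀ S ⊆ T, (∃ t ∈ S, q ⊆ t) →
    (∀ t ∈ S, ∀ t' ∈ T, ∀ e : Finset W, e.card = 2 → q ⊆ e → e ⊆ t → e ⊆ t' → t' ∈ S) →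
      ∀ t ∈ T, q ⊆ t → t ∈ S
  bd_nonempty : (bd 2 T).Nonempty
  acyclic : ∀ z ⊆ edges T, bd 1 z = ∅ → ∃ S ⊆ T, bd 2 S = z

/-- Crossing an edge that is not a boundary edge of `S` does not leave `S`. -/
theorem mem_of_notMem_bd {T : Finset (Finset W)}
    (hT : ∀ e : Finset W, #e = 2 → #(T.filter (e ⊆ ·)) ≤ 2) {S : Finset (Finset W)}
    (hS : S ⊆ T) {e t t' : Finset W} (he : e.card = 2) (heS : e ∉ bd 2 S) (ht : t ∈ S)
    (ht' : t' ∈ T) (het : e ⊆ t) (het' : e ⊆ t') : t' ∈ S := by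
  have h1 : ¬ Odd #(S.filter (e ⊆ ·)) := fun h => heS (mem_bd.2 ⟨he, h⟩)
  have h2 : 0 < #(S.filter (e ⊆ ·)) := card_pos.2 ⟨t, mem_filter.2 ⟨ht, het⟩⟩
  have h3 := hT e he
  have h4 : S.filter (e ⊆ ·) ⊆ T.filter (e ⊆ ·) := filter_subset_filter _ hS
  have h5 : S.filter (e ⊆ ·) = T.filter (e ⊆ ·) := by
    apply eq_of_subset_of_card_le h4
    rw [Nat.odd_iff] at h1
    omega
  have : t' ∈ S.filter (e ⊆ ·) := by rw [h5]; exact mem_filter.2 ⟨ht', het'⟩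
  exact (mem_filter.1 this).1

theorem IsDisc.mem_of_notMem_bd {T : Finset (Finset W)} (hT : IsDisc T) {S : Finset (Finset W)}
    (hS : S ⊆ T) {e t t' : Finset W} (he : e.card = 2) (heS : e ∉ bd 2 S) (ht : t ∈ S)
    (ht' : t' ∈ T) (het : e ⊆ t) (het' : e ⊆ t') : t' ∈ S :=
  DiscFilling.mem_of_notMem_bd hT.edge_le hS he heS ht ht' het het'

/-- There is no nonempty closed surface inside a strongly connected family with boundary: a part `S`
without boundary is closed under crossing edges, so it is everything. -/
theorem eq_empty_of_bd_eq_empty {T : Finset (Finset W)}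
    (hT : ∀ e : Finset W, #e = 2 → #(T.filter (e ⊆ ·)) ≤ 2)
    (hconn : ∀ S ⊆ T, S.Nonempty →
      (∀ t ∈ S, ∀ t' ∈ T, ∀ e : Finset W, e.card = 2 → e ⊆ t → e ⊆ t' → t' ∈ S) → S = T)
    (hb : (bd 2 T).Nonempty) {S : Finset (Finset W)} (hS : S ⊆ T) (h : bd 2 S = ∅) : S = ∅ := by
  by_contra hne
  have hST := hconn S hS (nonempty_iff_ne_empty.2 hne) fun t ht t' ht' e he het het' =>
    mem_of_notMem_bd hT hS he (by simp [h]) ht ht' het het'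
  rw [← hST, h] at hb
  exact not_nonempty_empty hb

theorem IsDisc.eq_of_closed {T : Finset (Finset W)} (hT : IsDisc T) (S : Finset (Finset W))
    (hS : S ⊆ T) (hne : S.Nonempty)
    (h : ∀ t ∈ S, ∀ t' ∈ T, ∀ e : Finset W, e.card = 2 → e ⊆ t → e ⊆ t' → t' ∈ S) : S = T :=
  Subset.antisymm hS fun t ht => hT.conn ∅ (by simp) S hS (by
    obtain ⟨t, ht⟩ := hne; exact ⟨t, ht, empty_subset _⟩)
    (fun t ht t' ht' e h1 _ h3 h4 => h t ht t' ht' e h1 h3 h4) t ht (empty_subset _)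

theorem IsDisc.eq_empty {T : Finset (Finset W)} (hT : IsDisc T) {S : Finset (Finset W)}
    (hS : S ⊆ T) (h : bd 2 S = ∅) : S = ∅ :=
  eq_empty_of_bd_eq_empty hT.edge_le hT.eq_of_closed hT.bd_nonempty hS h

/-- A part of a disc is determined by its boundary. -/
theorem IsDisc.bd_injOn {T : Finset (Finset W)} (hT : IsDisc T) {S S' : Finset (Finset W)}
    (hS : S ⊆ T) (hS' : S' ⊆ T) (h : bd 2 S = bd 2 S') : S = S' := by
  have : S ∆ S' = ∅ := by
    apply hT.eq_empty (S := S ∆ S')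
    · intro t ht
      rw [mem_symmDiff] at ht
      rcases ht with h | h
      exacts [hS h.1, hS' h.1]
    · rw [bd_symmDiff, h, symmDiff_self]; rfl
  exact symmDiff_eq_bot.1 this

/-- A circuit: a minimal nonempty edge set with all degrees even. -/
structure IsCircuit (β : Finset (Finset W)) : Prop where
  nonempty : β.Nonempty
  card_eq : ∀ e ∈ β, e.card = 2
  bd_eq : bd 1 β = ∅
  minimal : ∀ z ⊆ β, bd 1 z = ∅ → z = ∅ ∨ z = β

/-- A nonempty edge set with all degrees even contains a circuit. -/
theorem exists_circuit_subset {z : Finset (Finset W)} (hz : z.Nonempty)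
    (hc : ∀ e ∈ z, e.card = 2) (hb : bd 1 z = ∅) : ∃ β ⊆ z, IsCircuit β := by
  induction z using Finset.strongInduction with
  | H z ih =>
    by_cases h : ∃ y ⊂ z, y.Nonempty ∧ bd 1 y = ∅
    · obtain ⟨y, hy, hn, hy0⟩ := h
      obtain ⟨β, hβ, hβ'⟩ := ih y hy hn (fun e he => hc e (hy.1 he)) hy0
      exact ⟨β, hβ.trans hy.1, hβ'⟩
    · push Not at h
      refine ⟨z, Subset.rfl, hz, hc, hb, fun y hy hy0 => ?_⟩
      rcases hy.eq_or_ssubset with h1 | h1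
      · exact Or.inr h1
      · left
        by_contra hne
        exact (h y h1 (nonempty_iff_ne_empty.2 hne)).ne_empty hy0

theorem even_card_of_bd_zero {z : Finset (Finset W)} (h : bd 0 z = ∅) : Even #z := by
  by_contra ho
  rw [Nat.not_even_iff_odd] at ho
  have : (∅ : Finset W) ∈ bd 0 z := mem_bd.2 ⟨rfl, by simpa using ho⟩
  rw [h] at this
  simp at this

/-- Handshake lemma. -/
theorem even_card_bd_one {z : Finset (Finset W)} (h : ∀ e ∈ z, e.card = 2) : Even #(bd 1 z) :=
  even_card_of_bd_zero (bd_bd (k := 0) (by simpa using h))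

theorem bd_one_edge {e : Finset W} {x y : W} (he : e = {x, y}) (hxy : x ≠ y) :
    bd 1 {e} = {{x}} ∆ {{y}} := by
  subst he
  ext s
  rw [bd_singleton, mem_powersetCard, mem_symmDiff, mem_singleton, mem_singleton]
  constructor
  · rintro ⟨h1, h2⟩
    obtain ⟨a, rfl⟩ := card_eq_one.1 h2
    simp only [singleton_subset_iff, mem_insert, mem_singleton] at h1
    rcases h1 with rfl | rfl
    · simp [hxy]
    · simp [hxy.symm]
  · rintro (⟨rfl, _⟩ | ⟨rfl, _⟩) <;> simp

theorem symmDiff_cancel {α : Type*} [DecidableEq α] (a b c : Finset α) :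
    (a ∆ b) ∆ (b ∆ c) = a ∆ c := by
  ext x; simp only [mem_symmDiff]; tauto

theorem symmDiff_swap {α : Type*} [DecidableEq α] (a b c : Finset α) :
    (a ∆ b) ∆ c = (a ∆ c) ∆ b := by
  ext x; simp only [mem_symmDiff]
  by_cases h1 : x ∈ a <;> by_cases h2 : x ∈ b <;> by_cases h3 : x ∈ c <;> simp [h1, h2, h3]

theorem symmDiff_cancel_right {α : Type*} [DecidableEq α] (a b c : Finset α) :
    (a ∆ b) ∆ (c ∆ b) = a ∆ c := by
  ext x; simp only [mem_symmDiff]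
  by_cases h1 : x ∈ a <;> by_cases h2 : x ∈ b <;> by_cases h3 : x ∈ c <;> simp [h1, h2, h3]

theorem symmDiff_subset_of {α : Type*} [DecidableEq α] {s t u : Finset α} (hs : s ⊆ u) (ht : t ⊆ u) :
    s ∆ t ⊆ u := by
  intro x hx
  rw [mem_symmDiff] at hx
  rcases hx with h | h
  exacts [hs h.1, ht h.1]

/-- Any two vertices of a circuit are joined inside it. -/
theorem IsCircuit.exists_path {β : Finset (Finset W)} (hβ : IsCircuit β) {x y : W}
    (hx : x ∈ verts β) (hy : y ∈ verts β) : ∃ p ⊆ β, bd 1 p = {{x}} ∆ {{y}} := by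
  -- the edges with an end joined to `x` have all degrees even, so by minimality they are all of `β`
  let R : W → Prop := fun r => ∃ p ⊆ β, bd 1 p = {{x}} ∆ {{r}}
  have hxR : R x := ⟨∅, empty_subset _, by simp⟩
  have step : ∀ e ∈ β, ∀ a ∈ e, ∀ b ∈ e, R a → R b := by
    rintro e he a ha b hb ⟨p, hp, hpb⟩
    by_cases hab : a = b
    · subst hab; exact ⟨p, hp, hpb⟩
    have hab' : e = {a, b} := by
      symm
      apply eq_of_subset_of_card_le
      · intro c hc
        simp only [mem_insert, mem_singleton] at hc
        rcases hc with rfl | rfl <;> assumption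
      · rw [hβ.card_eq e he, card_pair hab]
    refine ⟨p ∆ {e}, symmDiff_subset_of hp (by simpa using he), ?_⟩
    rw [bd_symmDiff, hpb, bd_one_edge hab' hab]
    exact symmDiff_cancel _ _ _
  have hz : β.filter (fun e => ∃ a ∈ e, R a) = β := by
    refine (hβ.minimal _ (filter_subset _ _) ?_).resolve_left ?_
    · rw [eq_empty_iff_forall_notMem]
      intro s hs
      obtain ⟨hs1, hs2⟩ := mem_bd.1 hs
      obtain ⟨a, rfl⟩ := card_eq_one.1 hs1
      have : ({a} : Finset W) ∉ bd 1 β := by rw [hβ.bd_eq]; simp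
      apply this
      refine mem_bd.2 ⟨hs1, ?_⟩
      convert hs2 using 2
      obtain ⟨e, he⟩ := card_pos.1 hs2.pos
      simp only [mem_filter, singleton_subset_iff] at he
      obtain ⟨⟨heβ, c, hc, hcR⟩, hae⟩ := he
      have haR : R a := step e heβ c hc a hae hcR
      ext e'
      simp only [mem_filter, singleton_subset_iff]
      constructor
      · rintro ⟨h1, h2⟩; exact ⟨⟨h1, a, h2, haR⟩, h2⟩
      · rintro ⟨⟨h1, _⟩, h2⟩; exact ⟨h1, h2⟩
    · obtain ⟨e, he, hxe⟩ := mem_verts.1 hx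
      apply Nonempty.ne_empty
      exact ⟨e, mem_filter.2 ⟨he, x, hxe, hxR⟩⟩
  obtain ⟨e, he, hye⟩ := mem_verts.1 hy
  rw [← hz] at he
  obtain ⟨he, a, ha, haR⟩ := mem_filter.1 he
  exact step e he a ha y hye haR

/-- An edge set whose odd vertices lie on a circuit has the same odd vertices as some part of that
circuit. -/
theorem IsCircuit.exists_bd_eq {β : Finset (Finset W)} (hβ : IsCircuit β) {z : Finset (Finset W)}
    (hz : ∀ e ∈ z, e.card = 2) (h : ∀ v, {v} ∈ bd 1 z → v ∈ verts β) :
    ∃ p ⊆ β, bd 1 p = bd 1 z := by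
  obtain ⟨e, he⟩ := hβ.nonempty
  obtain ⟨r, hr⟩ := card_pos.1 (by rw [hβ.card_eq e he]; norm_num : 0 < #e)
  have hr' : r ∈ verts β := mem_verts.2 ⟨e, he, hr⟩
  -- up to the reference vertex `r`, any set of vertices is the set of odd vertices of a part of `β`,
  -- as the symmetric difference of paths to `r`; the handshake lemma then excludes the second case
  have key : ∀ O : Finset (Finset W), (∀ s ∈ O, ∃ v ∈ verts β, s = {v}) →
      ∃ p ⊆ β, bd 1 p = O ∨ bd 1 p = O ∆ {{r}} := by
    intro O
    induction O using Finset.induction_on with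
    | empty => intro _; exact ⟨∅, empty_subset _, by simp⟩
    | insert s O hs ih =>
      intro hO
      obtain ⟨p, hp, hpO⟩ := ih fun s hs => hO s (mem_insert_of_mem hs)
      obtain ⟨v, hv, rfl⟩ := hO s (mem_insert_self _ _)
      obtain ⟨y, hy, hyb⟩ := hβ.exists_path hv hr'
      refine ⟨y ∆ p, symmDiff_subset_of hy hp, ?_⟩
      rw [bd_symmDiff, hyb, insert_eq_symmDiff hs]
      rcases hpO with h | h
      · right; rw [h]; exact symmDiff_swap _ _ _
      · left; rw [h]; exact symmDiff_cancel_right _ _ _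
  obtain ⟨p, hp, hpz⟩ := key (bd 1 z) (by
    intro s hs
    obtain ⟨v, rfl⟩ := card_eq_one.1 (mem_bd.1 hs).1
    exact ⟨v, h v hs, rfl⟩)
  refine ⟨p, hp, hpz.resolve_right fun h' => ?_⟩
  have h1 := even_card_bd_one hz
  have h2 := even_card_bd_one fun e he => hβ.card_eq e (hp he)
  rw [h', ← Nat.not_odd_iff_even, odd_card_symmDiff] at h2
  rw [← Nat.not_odd_iff_even] at h1
  simp [h1] at h2

end

section
/-! ### Replacing a part of a disc -/

variable {W : Type*}

theorem bd_one_bd_two {S : Finset (Finset W)} (h : ∀ t ∈ S, t.card = 3) : bd 1 (bd 2 S) = ∅ :=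
  bd_bd (k := 1) h

theorem card_le_one_cases {q : Finset W} (hq : #q ≤ 1) : q = ∅ ∨ ∃ v, q = {v} := by
  rcases Nat.le_one_iff_eq_zero_or_eq_one.1 hq with h | h
  · exact Or.inl (card_eq_zero.1 h)
  · exact Or.inr (card_eq_one.1 h)

/-- A triangle common to the new part `P` and the old disc has all its edges on the circuit
`bd 2 S`, hence this circuit is its boundary and it is the only triangle of `S`. -/
theorem IsDisc.mem_of_mem_replace {T S P : Finset (Finset W)} (hT : IsDisc T) (hP : IsDisc P)
    (hS : S ⊆ T) (hβ : IsCircuit (bd 2 S))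
    (he : ∀ e ∈ edges P, e ∈ edges T → e ∈ bd 2 S) {t : Finset W} (htP : t ∈ P) (htT : t ∈ T) :
    t ∈ S := by
  have h3 := hP.card_eq t htP
  have h1 : powersetCard 2 t ⊆ bd 2 S := by
    intro e he'
    rw [mem_powersetCard] at he'
    exact he e (mem_edges.2 ⟨he'.2, t, htP, he'.1⟩) (mem_edges.2 ⟨he'.2, t, htT, he'.1⟩)
  have h2 : bd 2 {t} = bd 2 S := by
    rw [bd_singleton]
    refine (hβ.minimal _ h1 ?_).resolve_left ?_
    · rw [← bd_singleton]; exact bd_one_bd_two (by simpa using h3)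
    · rw [← card_eq_zero, card_powersetCard, h3]; decide
  have := hT.bd_injOn (singleton_subset_iff.2 htT) hS h2
  rw [← this]; simp

/-- The connectivity condition for the replaced disc. If `q` lies on an edge of the circuit, chains
of triangles around `q` in the old disc are rerouted through `P`; otherwise the triangles containing
`q` lie all in `P` or all in `T \ S`, and chains there are unchanged. -/
theorem IsDisc.conn_replace {T S P : Finset (Finset W)} (hT : IsDisc T) (hP : IsDisc P)
    (hS : S ⊆ T) (hβ : IsCircuit (bd 2 S)) (hb : bd 2 P = bd 2 S)
    (hv : ∀ v ∈ verts P, v ∈ verts T → v ∈ verts (bd 2 S))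
    (q : Finset W) (hq : q.card ≤ 1) (A : Finset (Finset W)) (hA : A ⊆ T \ S ∪ P)
    (hne : ∃ t ∈ A, q ⊆ t)
    (hcl : ∀ t ∈ A, ∀ t' ∈ T \ S ∪ P, ∀ e : Finset W, e.card = 2 → q ⊆ e → e ⊆ t → e ⊆ t' →
      t' ∈ A) : ∀ t ∈ T \ S ∪ P, q ⊆ t → t ∈ A := by
  -- crossing a non-boundary edge of `S` stays outside `S`
  have hout : ∀ {e t t'}, e.card = 2 → e ∉ bd 2 S → t ∈ T \ S → t' ∈ T → e ⊆ t → e ⊆ t' →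
      t' ∈ T \ S := by
    intro e t t' h1 h2 h3 h4 h5 h6
    rw [mem_sdiff] at h3 ⊢
    exact ⟨h4, fun h => h3.2 (hT.mem_of_notMem_bd hS h1 h2 h h3.1 h6 h5)⟩
  by_cases hqβ : ∃ e ∈ bd 2 S, q ⊆ e
  · obtain ⟨e₀, he₀, hqe₀⟩ := hqβ
    obtain ⟨s₀, hs₀, hes₀⟩ := exists_of_mem_bd he₀
    -- `A` reaches `P`: a chain from a member of `A` to `s₀ ∈ S` has to cross the circuit
    have claim1 : ∀ t ∈ P, q ⊆ t → t ∈ A := by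
      by_cases hAP : ∃ t ∈ A, t ∈ P ∧ q ⊆ t
      · obtain ⟨t, htA, htP, hqt⟩ := hAP
        intro t' ht' hqt'
        have := hP.conn q hq (A ∩ P) inter_subset_right ⟨t, mem_inter.2 ⟨htA, htP⟩, hqt⟩
          (fun t ht t' ht' e h1 h2 h3 h4 => mem_inter.2 ⟨hcl t (mem_inter.1 ht).1 t'
            (mem_union_right _ ht') e h1 h2 h3 h4, ht'⟩) t' ht' hqt'
        exact (mem_inter.1 this).1
      · exfalso
        obtain ⟨t, htA, hqt⟩ := hne
        have htR : t ∈ T \ S := (mem_union.1 (hA htA)).resolve_right fun h => hAP ⟨t, htA, h, hqt⟩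
        have := hT.conn q hq (A ∩ (T \ S)) (inter_subset_right.trans sdiff_subset)
          ⟨t, mem_inter.2 ⟨htA, htR⟩, hqt⟩ (by
            intro t ht t' ht' e h1 h2 h3 h4
            obtain ⟨htA, htR⟩ := mem_inter.1 ht
            by_cases heβ : e ∈ bd 2 S
            · rw [← hb] at heβ
              obtain ⟨p, hp, hep⟩ := exists_of_mem_bd heβ
              exact absurd ⟨p, hcl t htA p (mem_union_right _ hp) e h1 h2 h3 hep, hp,
                h2.trans hep⟩ hAP
            · have := hout h1 heβ htR ht' h3 h4
              exact mem_inter.2 ⟨hcl t htA t' (mem_union_left _ this) e h1 h2 h3 h4, this⟩)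
          s₀ (hS hs₀) (hqe₀.trans hes₀)
        exact (mem_sdiff.1 (mem_inter.1 this).2).2 hs₀
    -- with `P` replaced by `S` in `A`, closedness is inherited, so the old disc can be used
    intro t ht hqt
    rcases mem_union.1 ht with htR | htP
    · have := hT.conn q hq (A ∩ (T \ S) ∪ S) (union_subset (inter_subset_right.trans sdiff_subset) hS)
        ⟨s₀, mem_union_right _ hs₀, hqe₀.trans hes₀⟩ (by
          intro t ht t' ht' e h1 h2 h3 h4
          by_cases ht'S : t' ∈ S
          · exact mem_union_right _ ht'S
          have ht'R : t' ∈ T \ S := mem_sdiff.2 ⟨ht', ht'S⟩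
          refine mem_union_left _ (mem_inter.2 ⟨?_, ht'R⟩)
          rcases mem_union.1 ht with ht | ht
          · exact hcl t (mem_inter.1 ht).1 t' (mem_union_left _ ht'R) e h1 h2 h3 h4
          · have heβ : e ∈ bd 2 S := by
              by_contra heβ
              exact ht'S (hT.mem_of_notMem_bd hS h1 heβ ht ht' h3 h4)
            rw [← hb] at heβ
            obtain ⟨p, hp, hep⟩ := exists_of_mem_bd heβ
            exact hcl p (claim1 p hp (h2.trans hep)) t' (mem_union_left _ ht'R) e h1 h2 hep h4)
        t (mem_sdiff.1 htR).1 hqt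
      rcases mem_union.1 this with h | h
      · exact (mem_inter.1 h).1
      · exact absurd h (mem_sdiff.1 htR).2
    · exact claim1 t htP hqt
  · push Not at hqβ
    -- `q` is a vertex off the circuit, so it is not a common vertex of `P` and `T`
    have hPT : ∀ t ∈ P, ∀ t' ∈ T, q ⊆ t → q ⊆ t' → False := by
      intro t ht t' ht' h1 h2
      rcases card_le_one_cases hq with rfl | ⟨v, rfl⟩
      · obtain ⟨e, he⟩ := hβ.nonempty
        exact hqβ e he (empty_subset _)
      · rw [singleton_subset_iff] at h1 h2
        obtain ⟨e, he, hve⟩ := mem_verts.1 (hv v (mem_verts.2 ⟨t, ht, h1⟩) (mem_verts.2 ⟨t', ht', h2⟩))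
        exact hqβ e he (singleton_subset_iff.2 hve)
    obtain ⟨t₀, ht₀A, hqt₀⟩ := hne
    intro t ht hqt
    rcases mem_union.1 (hA ht₀A) with ht₀ | ht₀
    · have hSq : ∀ s ∈ S, ¬ q ⊆ s := by
        intro s hs hqs
        exact (mem_sdiff.1 ht₀).2 (hT.conn q hq S hS ⟨s, hs, hqs⟩
          (fun t ht t' ht' e h1 h2 h3 h4 =>
            hT.mem_of_notMem_bd hS h1 (fun h => hqβ e h h2) ht ht' h3 h4) t₀
          (mem_sdiff.1 ht₀).1 hqt₀)
      rcases mem_union.1 ht with ht | ht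
      · exact (mem_inter.1 (hT.conn q hq (A ∩ (T \ S)) (inter_subset_right.trans sdiff_subset)
          ⟨t₀, mem_inter.2 ⟨ht₀A, ht₀⟩, hqt₀⟩ (by
            intro t ht t' ht' e h1 h2 h3 h4
            have : t' ∈ T \ S := mem_sdiff.2 ⟨ht', fun h => hSq t' h (h2.trans h4)⟩
            exact mem_inter.2 ⟨hcl t (mem_inter.1 ht).1 t' (mem_union_left _ this) e h1 h2 h3 h4,
              this⟩) t (mem_sdiff.1 ht).1 hqt)).1
      · exact (hPT t ht t₀ (mem_sdiff.1 ht₀).1 hqt hqt₀).elim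
    · rcases mem_union.1 ht with ht | ht
      · exact (hPT t₀ ht₀ t (mem_sdiff.1 ht).1 hqt₀ hqt).elim
      · exact (mem_inter.1 (hP.conn q hq (A ∩ P) inter_subset_right
          ⟨t₀, mem_inter.2 ⟨ht₀A, ht₀⟩, hqt₀⟩
          (fun t ht t' ht' e h1 h2 h3 h4 => mem_inter.2 ⟨hcl t (mem_inter.1 ht).1 t'
            (mem_union_right _ ht') e h1 h2 h3 h4, ht'⟩) t ht hqt)).1

/-- Cycles bound in the replaced disc. A cycle is split into its part in `P` and the rest, and both
are closed up by the same part `p` of the circuit. The first bounds in `P`, the second bounds some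
`S2` in the old disc. By minimality of the circuit, `S2` contains nothing or everything of `S`, and
in the latter case `S` is exchanged for `P`. -/
theorem IsDisc.acyclic_replace {T S P : Finset (Finset W)} (hT : IsDisc T) (hP : IsDisc P)
    (hS : S ⊆ T) (hβ : IsCircuit (bd 2 S)) (hb : bd 2 P = bd 2 S)
    (hv : ∀ v ∈ verts P, v ∈ verts T → v ∈ verts (bd 2 S))
    (z : Finset (Finset W)) (hz : z ⊆ edges (T \ S ∪ P)) (hz0 : bd 1 z = ∅) :
    ∃ A ⊆ T \ S ∪ P, bd 2 A = z := by
  set zP := z.filter (· ∈ edges P) with hzP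
  set zR := z.filter (· ∉ edges P) with hzR
  have hzPR : zP ∆ zR = z := by
    ext e; simp only [hzP, hzR, mem_symmDiff, mem_filter]; tauto
  have hRT : zR ⊆ edges (T \ S) := by
    intro e he
    obtain ⟨h1, h2⟩ := mem_filter.1 he
    obtain ⟨hc, t, ht, het⟩ := mem_edges.1 (hz h1)
    rcases mem_union.1 ht with h | h
    · exact mem_edges.2 ⟨hc, t, h, het⟩
    · exact absurd (mem_edges.2 ⟨hc, t, h, het⟩) h2
  have hPP : zP ⊆ edges P := fun e he => (mem_filter.1 he).2
  have hbb : bd 1 zP = bd 1 zR := by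
    rw [← hzPR, bd_symmDiff] at hz0
    exact symmDiff_eq_bot.1 hz0
  obtain ⟨p, hp, hpb⟩ := hβ.exists_bd_eq (z := zP) (fun e he => (mem_edges.1 (hPP he)).1) (by
    intro v h
    have h' := h
    rw [hbb] at h'
    obtain ⟨e, he, hve⟩ := exists_of_mem_bd h
    obtain ⟨e', he', hve'⟩ := exists_of_mem_bd h'
    obtain ⟨_, t, ht, het⟩ := mem_edges.1 (hPP he)
    obtain ⟨_, t', ht', het'⟩ := mem_edges.1 (hRT he')
    rw [singleton_subset_iff] at hve hve'
    exact hv v (mem_verts.2 ⟨t, ht, het hve⟩)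
      (mem_verts.2 ⟨t', (mem_sdiff.1 ht').1, het' hve'⟩))
  obtain ⟨S1, hS1, hS1b⟩ := hP.acyclic (zP ∆ p)
    (symmDiff_subset_of hPP (hp.trans (hb ▸ bd_subset_edges P)))
    (by rw [bd_symmDiff, hpb]; exact symmDiff_self _)
  obtain ⟨S2, hS2, hS2b⟩ := hT.acyclic (zR ∆ p)
    (symmDiff_subset_of (hRT.trans (edges_mono sdiff_subset))
      (hp.trans ((bd_subset_edges S).trans (edges_mono hS))))
    (by rw [bd_symmDiff, hpb, hbb]; exact symmDiff_self _)
  -- an edge inside `S` but off the circuit is not an edge of `bd 2 S2 = zR ∆ p`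
  have hsub : bd 2 (S2 ∩ S) ⊆ bd 2 S := by
    intro e he
    by_contra heβ
    obtain ⟨hc, ho⟩ := mem_bd.1 he
    obtain ⟨t, ht, het⟩ := exists_of_mem_bd he
    have hall : ∀ t' ∈ T, e ⊆ t' → t' ∈ S := fun t' ht' het' =>
      hT.mem_of_notMem_bd hS hc heβ (mem_inter.1 ht).2 ht' het het'
    have : e ∈ bd 2 S2 := by
      refine mem_bd.2 ⟨hc, ?_⟩
      convert ho using 2
      ext t'
      simp only [mem_filter, mem_inter]
      constructor
      · rintro ⟨h1, h2⟩; exact ⟨⟨h1, hall t' (hS2 h1) h2⟩, h2⟩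
      · rintro ⟨⟨h1, _⟩, h2⟩; exact ⟨h1, h2⟩
    rw [hS2b, mem_symmDiff] at this
    rcases this with ⟨h, _⟩ | ⟨h, _⟩
    · obtain ⟨_, t', ht', het'⟩ := mem_edges.1 (hRT h)
      exact (mem_sdiff.1 ht').2 (hall t' (mem_sdiff.1 ht').1 het')
    · exact heβ (hp h)
  rcases hβ.minimal _ hsub (bd_one_bd_two fun t ht => hT.card_eq t (hS (mem_inter.1 ht).2)) with h | h
  · have h0 := hT.eq_empty (inter_subset_right.trans hS) h
    refine ⟨S1 ∆ S2, symmDiff_subset_of (hS1.trans subset_union_right) ?_, ?_⟩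
    · intro t ht
      refine mem_union_left _ (mem_sdiff.2 ⟨hS2 ht, fun h => ?_⟩)
      have : t ∈ S2 ∩ S := mem_inter.2 ⟨ht, h⟩
      rw [h0] at this
      simp at this
    · rw [bd_symmDiff, hS1b, hS2b, symmDiff_cancel_right, hzPR]
  · have h0 := hT.bd_injOn (inter_subset_right.trans hS) hS h
    have hSS2 : S ⊆ S2 := by rw [← h0]; exact inter_subset_left
    have h1 : S2 \ S = S2 ∆ S := by
      ext t; simp only [mem_sdiff, mem_symmDiff]
      constructor
      · exact fun h => Or.inl h
      · rintro (h | h)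
        · exact h
        · exact absurd (hSS2 h.1) h.2
    refine ⟨S1 ∆ ((S2 \ S) ∆ P), symmDiff_subset_of (hS1.trans subset_union_right)
      (symmDiff_subset_of ((sdiff_subset_sdiff hS2 Subset.rfl).trans subset_union_left)
        subset_union_right), ?_⟩
    rw [h1, bd_symmDiff, bd_symmDiff, bd_symmDiff, hS1b, hS2b, hb, symmDiff_symmDiff_cancel_right,
      symmDiff_cancel_right, hzPR]

/-- Replacing the part `S` of a disc inside a circuit by another disc `P` with the same boundary,
meeting the old disc along that circuit only, gives a disc with the same boundary. -/
theorem IsDisc.replace {T S P : Finset (Finset W)} (hT : IsDisc T) (hP : IsDisc P)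
    (hS : S ⊆ T) (hβ : IsCircuit (bd 2 S)) (hb : bd 2 P = bd 2 S)
    (he : ∀ e ∈ edges P, e ∈ edges T → e ∈ bd 2 S)
    (hv : ∀ v ∈ verts P, v ∈ verts T → v ∈ verts (bd 2 S)) :
    IsDisc (T \ S ∪ P) ∧ bd 2 (T \ S ∪ P) = bd 2 T ∧ Disjoint (T \ S) P := by
  have hdisj : Disjoint (T \ S) P := by
    rw [disjoint_left]
    intro t ht htP
    exact (mem_sdiff.1 ht).2 (hT.mem_of_mem_replace hP hS hβ he htP (mem_sdiff.1 ht).1)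
  have hbd : bd 2 (T \ S ∪ P) = bd 2 T := by
    have h1 : T \ S ∪ P = (T ∆ S) ∆ P := by
      have h2 : T \ S = T ∆ S := by
        ext t; simp only [mem_sdiff, mem_symmDiff]
        constructor
        · exact fun h => Or.inl h
        · rintro (h | h)
          · exact h
          · exact absurd (hS h.1) h.2
      rw [← h2, hdisj.symmDiff_eq_sup]; rfl
    rw [h1, bd_symmDiff, bd_symmDiff, hb, symmDiff_symmDiff_cancel_right]
  refine ⟨⟨?_, ?_, ?_, ?_, ?_⟩, hbd, hdisj⟩
  · intro t ht
    rcases mem_union.1 ht with h | h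
    exacts [hT.card_eq t (mem_sdiff.1 h).1, hP.card_eq t h]
  · intro e hc
    rw [filter_union]
    refine (card_union_le _ _).trans ?_
    have h1 := hT.edge_le e hc
    have h2 := hP.edge_le e hc
    have h3 : #((T \ S).filter (e ⊆ ·)) + #(S.filter (e ⊆ ·)) = #(T.filter (e ⊆ ·)) := by
      rw [← card_union_of_disjoint (disjoint_filter_filter sdiff_disjoint), ← filter_union,
        sdiff_union_of_subset hS]
    by_cases heP : e ∈ edges P
    · by_cases heT : e ∈ edges T
      · have h4 := he e heP heT
        have h5 := (mem_bd.1 h4).2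
        rw [← hb] at h4
        have h6 := (mem_bd.1 h4).2
        rw [Nat.odd_iff] at h5 h6
        omega
      · have : #(T.filter (e ⊆ ·)) = 0 := by
          rw [card_eq_zero, filter_eq_empty_iff]
          exact fun t ht het => heT (mem_edges.2 ⟨hc, t, ht, het⟩)
        omega
    · have : #(P.filter (e ⊆ ·)) = 0 := by
        rw [card_eq_zero, filter_eq_empty_iff]
        exact fun t ht het => heP (mem_edges.2 ⟨hc, t, ht, het⟩)
      omega
  · exact hT.conn_replace hP hS hβ hb hv
  · rw [hbd]; exact hT.bd_nonempty
  · exact hT.acyclic_replace hP hS hβ hb hv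

end

section
/-! ### Circuits and cycles of graphs -/

variable {W : Type*}

/-- The set of edges of a walk, as two-element sets. -/
def walkEdges {G : SimpleGraph W} {a b : W} (p : G.Walk a b) : Finset (Finset W) :=
  p.edges.toFinset.image Sym2.toFinset

theorem sym2_toFinset_mk (x y : W) : (s(x, y)).toFinset = {x, y} := by
  ext; simp [Sym2.mem_toFinset]

theorem sym2_toFinset_injective : Function.Injective (Sym2.toFinset : Sym2 W → Finset W) := by
  intro s t h
  ext x
  rw [← Sym2.mem_toFinset, h, Sym2.mem_toFinset]

theorem pair_mem_walkEdges {G : SimpleGraph W} {a b : W} {p : G.Walk a b} {x y : W} :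
    {x, y} ∈ walkEdges p ↔ s(x, y) ∈ p.edges := by
  rw [walkEdges, ← sym2_toFinset_mk, mem_image]
  constructor
  · rintro ⟨s, hs, h⟩
    rw [← sym2_toFinset_injective h]; simpa using hs
  · intro h; exact ⟨_, by simpa using h, rfl⟩

theorem exists_of_mem_walkEdges {G : SimpleGraph W} {a b : W} {p : G.Walk a b} {e : Finset W}
    (h : e ∈ walkEdges p) : ∃ x y, e = {x, y} ∧ s(x, y) ∈ p.edges ∧ G.Adj x y := by
  obtain ⟨s, hs, rfl⟩ := mem_image.1 h
  rw [List.mem_toFinset] at hs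
  induction s using Sym2.ind with
  | _ x y => exact ⟨x, y, sym2_toFinset_mk x y, hs, p.adj_of_mem_edges hs⟩

theorem card_of_mem_walkEdges {G : SimpleGraph W} {a b : W} {p : G.Walk a b} {e : Finset W}
    (h : e ∈ walkEdges p) : #e = 2 := by
  obtain ⟨x, y, rfl, _, h⟩ := exists_of_mem_walkEdges h
  exact card_pair h.ne

theorem card_walkEdges {G : SimpleGraph W} {a b : W} {p : G.Walk a b} (hp : p.IsTrail) :
    #(walkEdges p) = p.length := by
  rw [walkEdges, card_image_of_injective _ sym2_toFinset_injective,
    List.toFinset_card_of_nodup hp.edges_nodup, SimpleGraph.Walk.length_edges]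

theorem bd_walkEdges {G : SimpleGraph W} {a : W} {p : G.Walk a a} (hp : p.IsTrail) :
    bd 1 (walkEdges p) = ∅ := by
  rw [eq_empty_iff_forall_notMem]
  intro s hs
  obtain ⟨h1, h2⟩ := mem_bd.1 hs
  obtain ⟨v, rfl⟩ := card_eq_one.1 h1
  have h3 := (hp.even_countP_edges_iff v).2 (fun h => absurd rfl h)
  rw [← Nat.not_even_iff_odd] at h2
  apply h2
  convert h3
  rw [walkEdges, filter_image, card_image_of_injective _ sym2_toFinset_injective,
    List.countP_eq_length_filter, ← List.toFinset_card_of_nodup (hp.edges_nodup.filter _),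
    List.toFinset_filter]
  congr 1
  ext e
  simp [Sym2.mem_toFinset]

/-- The graph formed by a set of edges. -/
def edgeGraph (β : Finset (Finset W)) : SimpleGraph W where
  Adj a b := a ≠ b ∧ {a, b} ∈ β
  symm := ⟨fun a b h => ⟨h.1.symm, by rw [pair_comm]; exact h.2⟩⟩
  loopless := ⟨fun _ h => h.1 rfl⟩

theorem pair_eq_of_mem {e : Finset W} {a b : W} (he : #e = 2) (ha : a ∈ e) (hb : b ∈ e)
    (hab : a ≠ b) : e = {a, b} := by
  symm
  apply eq_of_subset_of_card_le
  · intro c hc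
    simp only [mem_insert, mem_singleton] at hc
    rcases hc with rfl | rfl <;> assumption
  · rw [he, card_pair hab]

theorem exists_pair_of_mem {e : Finset W} {a : W} (he : #e = 2) (ha : a ∈ e) :
    ∃ b, a ≠ b ∧ e = {a, b} := by
  have : 0 < #(e.erase a) := by rw [card_erase_of_mem ha]; omega
  obtain ⟨b, hb⟩ := card_pos.1 this
  rw [mem_erase] at hb
  exact ⟨b, hb.1.symm, pair_eq_of_mem he ha hb.2 hb.1.symm⟩

/-- A circuit is the edge set of a cycle in the sense of `SimpleGraph.Walk.IsCycle`. -/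
theorem IsCircuit.exists_isCycle {β : Finset (Finset W)} (hβ : IsCircuit β) :
    ∃ (a : W) (p : (edgeGraph β).Walk a a), p.IsCycle ∧ walkEdges p = β := by
  obtain ⟨e, he⟩ := hβ.nonempty
  obtain ⟨a, b, hab, rfl⟩ := card_eq_two.1 (hβ.card_eq e he)
  have hadj : (edgeGraph β).Adj a b := ⟨hab, he⟩
  -- an edge of a circuit is no bridge: otherwise `a` would be the only vertex of odd degree in its
  -- component after removal of the edge, against the handshake lemma
  have hreach : ((edgeGraph β).deleteEdges {s(a, b)}).Reachable a b := by
    by_contra hnr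
    set H := (edgeGraph β).deleteEdges {s(a, b)}
    set z := (β.erase {a, b}).filter (fun e => ∃ x ∈ e, H.Reachable a x) with hz
    have hz2 : ∀ e ∈ z, #e = 2 := fun e he => hβ.card_eq e (mem_of_mem_erase (mem_filter.1 he).1)
    -- edges of the component of `a` after removal of `{a, b}`
    have hzr : ∀ e ∈ β.erase {a, b}, ∀ x ∈ e, ∀ y ∈ e, H.Reachable a x → H.Reachable a y := by
      intro e he x hx y hy hr
      by_cases hxy : x = y
      · subst hxy; exact hr
      have he' := mem_erase.1 he
      have hexy := pair_eq_of_mem (hβ.card_eq e he'.2) hx hy hxy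
      refine hr.trans (SimpleGraph.Adj.reachable ?_)
      rw [SimpleGraph.deleteEdges_adj]
      refine ⟨⟨hxy, hexy ▸ he'.2⟩, fun h => he'.1 ?_⟩
      rw [Set.mem_singleton_iff] at h
      rw [hexy, ← sym2_toFinset_mk, ← sym2_toFinset_mk, h]
    have hodd : bd 1 z = {{a}} := by
      ext s
      rw [mem_bd, mem_singleton]
      have hfil : ∀ v, H.Reachable a v →
          z.filter ({v} ⊆ ·) = (β.filter ({v} ⊆ ·)).erase {a, b} := by
        intro v hv
        ext e
        simp only [hz, mem_filter, singleton_subset_iff, mem_erase]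
        constructor
        · rintro ⟨⟨⟨h1, h2⟩, _⟩, h3⟩; exact ⟨h1, h2, h3⟩
        · rintro ⟨h1, h2, h3⟩; exact ⟨⟨⟨h1, h2⟩, v, h3, hv⟩, h3⟩
      have hev : ∀ v : W, Even #(β.filter ({v} ⊆ ·)) := by
        intro v
        by_contra ho
        have : ({v} : Finset W) ∈ bd 1 β := mem_bd.2 ⟨by simp, Nat.not_even_iff_odd.1 ho⟩
        rw [hβ.bd_eq] at this; simp at this
      constructor
      · rintro ⟨h1, h2⟩
        obtain ⟨v, rfl⟩ := card_eq_one.1 h1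
        obtain ⟨e, he'⟩ := card_pos.1 h2.pos
        obtain ⟨he1, he2⟩ := mem_filter.1 he'
        rw [singleton_subset_iff] at he2
        obtain ⟨he3, x, hx, hxr⟩ := mem_filter.1 he1
        have hvr := hzr e he3 x hx v he2 hxr
        rw [hfil v hvr] at h2
        by_contra hva
        have hvb : v ≠ b := by rintro rfl; exact hnr hvr
        rw [erase_eq_of_notMem] at h2
        · exact (Nat.not_odd_iff_even.2 (hev v)) h2
        · simp only [mem_filter, singleton_subset_iff, mem_insert, mem_singleton]
          rintro ⟨_, h | h⟩
          · exact hva (by rw [h])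
          · exact hvb h
      · rintro rfl
        refine ⟨by simp, ?_⟩
        have hmem : ({a, b} : Finset W) ∈ β.filter ({a} ⊆ ·) := mem_filter.2 ⟨he, by simp⟩
        rw [hfil a SimpleGraph.Reachable.rfl, card_erase_of_mem hmem]
        have h1 := hev a
        have h2 := card_pos.2 ⟨_, hmem⟩
        rw [Nat.even_iff] at h1
        rw [Nat.odd_iff]
        omega
    have := even_card_bd_one hz2
    rw [hodd] at this
    simp at this
  obtain ⟨c, p, hp, hpe⟩ :=
    SimpleGraph.adj_and_reachable_delete_edges_iff_exists_cycle.1 ⟨hadj, hreach⟩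
  refine ⟨c, p, hp, (hβ.minimal _ ?_ (bd_walkEdges hp.isTrail)).resolve_left ?_⟩
  · intro e he
    obtain ⟨x, y, rfl, _, h⟩ := exists_of_mem_walkEdges he
    exact h.2
  · exact ne_empty_of_mem (pair_mem_walkEdges.2 hpe)

/-- Every vertex of a circuit lies on exactly two of its edges. -/
theorem IsCircuit.card_filter {β : Finset (Finset W)} (hβ : IsCircuit β) {v : W}
    (hv : v ∈ verts β) : #(β.filter (v ∈ ·)) = 2 := by
  obtain ⟨a, p, hp, hpβ⟩ := hβ.exists_isCycle
  obtain ⟨e, he, hve⟩ := mem_verts.1 hv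
  obtain ⟨b, hvb, rfl⟩ := exists_pair_of_mem (hβ.card_eq e he) hve
  have hvs : v ∈ p.support := by
    rw [← hpβ, pair_mem_walkEdges] at he
    exact p.fst_mem_support_of_mem_edges he
  have h2 := hp.ncard_neighborSet_toSubgraph_eq_two hvs
  rw [← h2, ← Set.ncard_coe_finset]
  symm
  apply Set.ncard_congr (fun w _ => ({v, w} : Finset W))
  · intro w hw
    rw [SimpleGraph.Subgraph.mem_neighborSet, SimpleGraph.Walk.adj_toSubgraph_iff_mem_edges,
      ← pair_mem_walkEdges, hpβ] at hw
    simpa using hw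
  · intro x y hx hy h
    rw [← sym2_toFinset_mk, ← sym2_toFinset_mk] at h
    exact Sym2.congr_right.1 (sym2_toFinset_injective h)
  · intro e he
    simp only [coe_filter, Set.mem_ofPred_eq] at he
    obtain ⟨w, hvw, rfl⟩ := exists_pair_of_mem (hβ.card_eq e he.1) he.2
    refine ⟨w, ?_, rfl⟩
    rw [SimpleGraph.Subgraph.mem_neighborSet, SimpleGraph.Walk.adj_toSubgraph_iff_mem_edges,
      ← pair_mem_walkEdges, hpβ]
    exact he.1

theorem IsCircuit.three_le_card {β : Finset (Finset W)} (hβ : IsCircuit β) : 3 ≤ #β := by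
  obtain ⟨a, p, hp, hpβ⟩ := hβ.exists_isCycle
  rw [← hpβ, card_walkEdges hp.isTrail]
  exact hp.three_le_length

/-- A chord of a circuit splits it into two circuits. -/
theorem IsCircuit.split {β : Finset (Finset W)} (hβ : IsCircuit β) {x y : W} (hxy : x ≠ y)
    (hx : x ∈ verts β) (hy : y ∈ verts β) (he : {x, y} ∉ β) :
    ∃ p q, p ∪ q = β ∧ Disjoint p q ∧ IsCircuit (insert {x, y} p) ∧ IsCircuit (insert {x, y} q) ∧
      verts (insert {x, y} p) ∩ verts (insert {x, y} q) ⊆ {x, y} := by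
  -- a path between the ends of a chord forms a circuit together with the chord
  have key : ∀ p ⊆ β, bd 1 p = {{x}} ∆ {{y}} → p ≠ β → IsCircuit (insert {x, y} p) := by
    intro p hp hpb hpne
    have hep : {x, y} ∉ p := fun h => he (hp h)
    refine ⟨insert_nonempty _ _, ?_, ?_, ?_⟩
    · intro e h
      rcases mem_insert.1 h with rfl | h
      exacts [card_pair hxy, hβ.card_eq e (hp h)]
    · rw [insert_eq_symmDiff hep, bd_symmDiff, bd_one_edge rfl hxy, hpb]; exact symmDiff_self _
    · have h0 : ∀ z ⊆ p, bd 1 z = ∅ → z = ∅ := fun z hz hz0 =>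
        (hβ.minimal z (hz.trans hp) hz0).resolve_right
          (fun h => hpne (Subset.antisymm hp (h ▸ hz)))
      intro z hz hz0
      by_cases hez : {x, y} ∈ z
      · right
        have hz' : z ∆ insert {x, y} p ⊆ p := by
          intro e h
          rw [mem_symmDiff] at h
          rcases h with ⟨h1, h2⟩ | ⟨h1, h2⟩
          · exact absurd (hz h1) h2
          · rcases mem_insert.1 h1 with rfl | h
            exacts [absurd hez h2, h]
        have := h0 _ hz' (by
          rw [bd_symmDiff, hz0, insert_eq_symmDiff hep, bd_symmDiff, bd_one_edge rfl hxy, hpb]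
          rw [symmDiff_self]; exact symmDiff_self _)
        exact symmDiff_eq_bot.1 this
      · left
        refine h0 z (fun e h => ?_) hz0
        rcases mem_insert.1 (hz h) with rfl | h'
        exacts [absurd h hez, h']
  obtain ⟨p, hp, hpb⟩ := hβ.exists_path hx hy
  have hne : ({{x}} : Finset (Finset W)) ∆ {{y}} ≠ ∅ := by
    intro h
    have := symmDiff_eq_bot.1 h
    simp at this
    exact hxy this
  have hsd : β \ p = β ∆ p := by
    ext e; simp only [mem_sdiff, mem_symmDiff]
    constructor
    · exact fun h => Or.inl h
    · rintro (h | h)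
      · exact h
      · exact absurd (hp h.1) h.2
  have hqb : bd 1 (β \ p) = {{x}} ∆ {{y}} := by
    rw [hsd, bd_symmDiff, hβ.bd_eq, hpb]; exact bot_symmDiff _
  have hpne : p ≠ β := by rintro rfl; exact hne (hpb ▸ hβ.bd_eq)
  have hqne : β \ p ≠ β := by
    intro h
    exact hne (by rw [← hqb, h, hβ.bd_eq])
  have hcp := key p hp hpb hpne
  have hcq := key (β \ p) sdiff_subset hqb hqne
  refine ⟨p, β \ p, union_sdiff_of_subset hp, disjoint_sdiff, hcp, hcq, ?_⟩
  intro v hv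
  obtain ⟨hv1, hv2⟩ := mem_inter.1 hv
  by_contra hvxy
  have h1 := hcp.card_filter hv1
  have h2 := hcq.card_filter hv2
  rw [filter_insert, if_neg hvxy] at h1 h2
  have hvβ : v ∈ verts β := by
    obtain ⟨e, he⟩ := card_pos.1 (by omega : 0 < #(p.filter (v ∈ ·)))
    exact mem_verts.2 ⟨e, hp (mem_filter.1 he).1, (mem_filter.1 he).2⟩
  have h3 := hβ.card_filter hvβ
  have h4 : β.filter (v ∈ ·) = p.filter (v ∈ ·) ∪ (β \ p).filter (v ∈ ·) := by
    rw [← filter_union, union_sdiff_of_subset hp]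
  rw [h4, card_union_of_disjoint (disjoint_filter_filter disjoint_sdiff)] at h3
  omega

end

section
/-! ### Cones and gluing -/

variable {W : Type*}

theorem three_le_card_of_bd_eq {z : Finset (Finset W)} (hz : z.Nonempty)
    (hc : ∀ e ∈ z, e.card = 2) (hb : bd 1 z = ∅) : 3 ≤ #z := by
  obtain ⟨β, hβ, h⟩ := exists_circuit_subset hz hc hb
  exact h.three_le_card.trans (card_le_card hβ)

theorem isCircuit_triangle {t : Finset W} (ht : #t = 3) : IsCircuit (powersetCard 2 t) := by
  have hcard : #(powersetCard 2 t) = 3 := by rw [card_powersetCard, ht]; decide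
  have h2 : ∀ e ∈ powersetCard 2 t, #e = 2 := fun e he => (mem_powersetCard.1 he).2
  refine ⟨card_pos.1 (by omega), h2, ?_, ?_⟩
  · rw [← bd_singleton]; exact bd_one_bd_two (by simpa using ht)
  · intro z hz hz0
    by_cases h : z = ∅
    · exact Or.inl h
    · right
      exact eq_of_subset_of_card_le hz (hcard ▸
        three_le_card_of_bd_eq (nonempty_iff_ne_empty.2 h) (fun e he => h2 e (hz he)) hz0)

/-- A circuit of length `3` consists of the edges of a triangle. -/
theorem IsCircuit.exists_triangle {β : Finset (Finset W)} (hβ : IsCircuit β) (h3 : #β = 3) :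
    ∃ t : Finset W, #t = 3 ∧ β = powersetCard 2 t := by
  obtain ⟨e, he⟩ := hβ.nonempty
  obtain ⟨x, y, hxy, rfl⟩ := card_eq_two.1 (hβ.card_eq e he)
  have hdeg : ∀ {v e}, e ∈ β → v ∈ e → ∃ e' ∈ β, e' ≠ e ∧ v ∈ e' := by
    intro v e he hv
    have := hβ.card_filter (mem_verts.2 ⟨e, he, hv⟩)
    have h1 : 0 < #((β.filter (v ∈ ·)).erase e) := by
      rw [card_erase_of_mem (mem_filter.2 ⟨he, hv⟩)]; omega
    obtain ⟨e', he'⟩ := card_pos.1 h1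
    rw [mem_erase, mem_filter] at he'
    exact ⟨e', he'.2.1, he'.1, he'.2.2⟩
  obtain ⟨e1, he1, hne1, hy1⟩ := hdeg he (v := y) (by simp)
  obtain ⟨z, hyz, rfl⟩ := exists_pair_of_mem (hβ.card_eq e1 he1) hy1
  have hzx : z ≠ x := by rintro rfl; exact hne1 (pair_comm _ _)
  obtain ⟨e2, he2, hne2, hx2⟩ := hdeg he (v := x) (by simp)
  have hne21 : e2 ≠ {y, z} := by
    rintro rfl
    simp only [mem_insert, mem_singleton] at hx2
    rcases hx2 with h | h
    exacts [hxy h, hzx h.symm]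
  have hβ3 : β = {{x, y}, {y, z}, e2} := by
    symm
    apply eq_of_subset_of_card_le
    · intro e h
      simp only [mem_insert, mem_singleton] at h
      rcases h with rfl | rfl | rfl <;> assumption
    · rw [h3, card_insert_of_notMem, card_pair hne21.symm]
      simp [hne1.symm, hne2.symm]
  obtain ⟨e3, he3, hne3, hz3⟩ := hdeg he1 (v := z) (by simp)
  have h32 : e3 = e2 := by
    rw [hβ3] at he3
    simp only [mem_insert, mem_singleton] at he3
    rcases he3 with rfl | rfl | rfl
    · simp only [mem_insert, mem_singleton] at hz3
      rcases hz3 with h | h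
      exacts [absurd h hzx, absurd h.symm hyz]
    · exact absurd rfl hne3
    · rfl
  subst h32
  have h2 := pair_eq_of_mem (hβ.card_eq _ he2) hx2 hz3 hzx.symm
  have ht : #({x, y, z} : Finset W) = 3 := by
    rw [card_insert_of_notMem (by simp [hxy, hzx.symm]), card_pair hyz]
  refine ⟨{x, y, z}, ht, ?_⟩
  apply eq_of_subset_of_card_le
  · intro e h
    rw [mem_powersetCard]
    refine ⟨?_, hβ.card_eq e h⟩
    rw [hβ3, h2] at h
    simp only [mem_insert, mem_singleton] at h
    rcases h with rfl | rfl | rfl <;> intro a <;> simp <;> tauto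
  · rw [h3, card_powersetCard, ht]; decide

theorem isDisc_triangle {t : Finset W} (ht : #t = 3) : IsDisc {t} := by
  have hc := isCircuit_triangle ht
  refine ⟨by simpa using ht, ?_, ?_, ?_, ?_⟩
  · intro e _
    exact (card_le_card (filter_subset _ _)).trans (by simp)
  · intro q _ S hS ⟨t', ht', _⟩ _ t'' ht'' _
    have := mem_singleton.1 (hS ht')
    rw [mem_singleton.1 ht'', ← this]; exact ht'
  · rw [bd_singleton]; exact hc.nonempty
  · intro z hz hz0
    have : z ⊆ powersetCard 2 t := by simpa [edges] using hz
    rcases hc.minimal z this hz0 with h | h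
    · exact ⟨∅, by simp, by simp [h]⟩
    · exact ⟨{t}, Subset.rfl, by rw [bd_singleton, h]⟩

/-- The cone with apex `a` over a set of edges. -/
def cone (a : W) (β : Finset (Finset W)) : Finset (Finset W) := β.image (insert a)

theorem mem_cone {a : W} {β : Finset (Finset W)} {t : Finset W} :
    t ∈ cone a β ↔ ∃ e ∈ β, insert a e = t := mem_image

theorem notMem_of_notMem_verts {a : W} {β : Finset (Finset W)} (ha : a ∉ verts β) {e : Finset W}
    (he : e ∈ β) : a ∉ e := fun h => ha (mem_verts.2 ⟨e, he, h⟩)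

theorem cone_injOn {a : W} {β : Finset (Finset W)} (ha : a ∉ verts β) : Set.InjOn (insert a : Finset W → Finset W) β := by
  intro e he e' he' h
  have h1 := erase_insert (notMem_of_notMem_verts ha he)
  have h2 := erase_insert (notMem_of_notMem_verts ha he')
  rw [← h1, ← h2]
  rw [show insert a e = insert a e' from h]

theorem card_cone {a : W} {β : Finset (Finset W)} (ha : a ∉ verts β) : #(cone a β) = #β := card_image_of_injOn (cone_injOn ha)

theorem cone_filter_base {a : W} {β : Finset (Finset W)} (hβ : ∀ e ∈ β, #e = 2)
    {e : Finset W} (he : #e = 2) (hae : a ∉ e) :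
    #((cone a β).filter (e ⊆ ·)) = if e ∈ β then 1 else 0 := by
  have key : ∀ e' ∈ β, e ⊆ insert a e' → e = e' := fun e' he' h =>
    eq_of_subset_of_card_le ((subset_insert_iff_of_notMem hae).1 h) (by rw [he, hβ e' he'])
  split_ifs with h
  · rw [card_eq_one]
    refine ⟨insert a e, ?_⟩
    ext t
    rw [mem_filter, mem_cone, mem_singleton]
    constructor
    · rintro ⟨⟨e', he', rfl⟩, h'⟩; rw [key e' he' h']
    · rintro rfl; exact ⟨⟨e, h, rfl⟩, subset_insert _ _⟩
  · rw [card_eq_zero, filter_eq_empty_iff]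
    intro t ht h'
    obtain ⟨e', he', rfl⟩ := mem_cone.1 ht
    exact h (key e' he' h' ▸ he')

theorem cone_filter_side {a : W} {β : Finset (Finset W)} (ha : a ∉ verts β)
    {v : W} (hv : v ≠ a) :
    #((cone a β).filter ({a, v} ⊆ ·)) = #(β.filter (v ∈ ·)) := by
  rw [cone, filter_image, card_image_of_injOn ((cone_injOn ha).mono (by
    intro e he; exact (mem_filter.1 he).1))]
  congr 1
  ext e
  simp only [mem_filter, insert_subset_iff, mem_insert_self, singleton_subset_iff, mem_insert, hv,
    true_and, false_or]

theorem mem_bd_cone_iff {a : W} {β : Finset (Finset W)} (hβ : ∀ e ∈ β, #e = 2)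
    {e : Finset W} (hae : a ∉ e) : e ∈ bd 2 (cone a β) ↔ e ∈ β := by
  rw [mem_bd]
  constructor
  · rintro ⟨h1, h2⟩
    rw [cone_filter_base hβ h1 hae] at h2
    by_contra h; simp [h] at h2
  · intro h
    refine ⟨hβ e h, ?_⟩
    rw [cone_filter_base hβ (hβ e h) hae, if_pos h]; decide

theorem IsCircuit.bd_cone {β : Finset (Finset W)} (hβ : IsCircuit β) {a : W} (ha : a ∉ verts β) :
    bd 2 (cone a β) = β := by
  ext e
  by_cases hae : a ∈ e
  · refine iff_of_false ?_ (fun h => notMem_of_notMem_verts ha h hae)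
    intro h
    obtain ⟨h1, h2⟩ := mem_bd.1 h
    obtain ⟨v, hav, rfl⟩ := exists_pair_of_mem h1 hae
    rw [cone_filter_side ha hav.symm] at h2
    obtain ⟨e, he⟩ := card_pos.1 h2.pos
    rw [hβ.card_filter (mem_verts.2 ⟨e, (mem_filter.1 he).1, (mem_filter.1 he).2⟩)] at h2
    exact absurd h2 (by decide)
  · exact mem_bd_cone_iff hβ.card_eq hae

/-- The cone over a circuit is a disc. -/
theorem isDisc_cone {β : Finset (Finset W)} (hβ : IsCircuit β) {a : W} (ha : a ∉ verts β) :
    IsDisc (cone a β) := by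
  have hc3 : ∀ t ∈ cone a β, #t = 3 := by
    intro t ht
    obtain ⟨e, he, rfl⟩ := mem_cone.1 ht
    rw [card_insert_of_notMem (notMem_of_notMem_verts ha he), hβ.card_eq e he]
  refine ⟨hc3, ?_, ?_, ?_, ?_⟩
  · intro e he
    by_cases hae : a ∈ e
    · obtain ⟨v, hav, rfl⟩ := exists_pair_of_mem he hae
      rw [cone_filter_side ha hav.symm]
      by_cases hv : v ∈ verts β
      · exact (hβ.card_filter hv).le
      · rw [filter_eq_empty_iff.2 fun e he hve => hv (mem_verts.2 ⟨e, he, hve⟩)]; simp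
    · rw [cone_filter_base hβ.card_eq he hae]; split_ifs <;> simp
  · intro q hq S hS hne hcl
    have key : ∀ e ∈ β, ∀ e' ∈ β, ∀ v ∈ e, v ∈ e' → q ⊆ {a, v} → insert a e ∈ S →
        insert a e' ∈ S := by
      intro e he e' he' v hv hv' hqv h
      have hva : a ≠ v := fun h => notMem_of_notMem_verts ha he (h ▸ hv)
      refine hcl _ h _ (mem_cone.2 ⟨e', he', rfl⟩) {a, v} (card_pair hva) hqv ?_ ?_ <;>
        simp [insert_subset_iff, hv, hv']
    obtain ⟨t₀, ht₀, hqt₀⟩ := hne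
    obtain ⟨e₀, he₀, rfl⟩ := mem_cone.1 (hS ht₀)
    -- around the apex: the base edges whose cone lies in `S` have all degrees even, so they are all
    -- of `β`; around a base vertex there are only two triangles, and they share an edge
    by_cases hqa : q ⊆ {a}
    · have hA : β.filter (fun e => insert a e ∈ S) = β := by
        refine (hβ.minimal _ (filter_subset _ _) ?_).resolve_left
          (ne_empty_of_mem (mem_filter.2 ⟨he₀, ht₀⟩))
        rw [eq_empty_iff_forall_notMem]
        intro s hs
        obtain ⟨hs1, hs2⟩ := mem_bd.1 hs
        obtain ⟨v, rfl⟩ := card_eq_one.1 hs1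
        have : ({v} : Finset W) ∉ bd 1 β := by rw [hβ.bd_eq]; simp
        apply this
        refine mem_bd.2 ⟨hs1, ?_⟩
        convert hs2 using 2
        obtain ⟨e, he⟩ := card_pos.1 hs2.pos
        simp only [mem_filter, singleton_subset_iff] at he
        ext e'
        simp only [mem_filter, singleton_subset_iff]
        constructor
        · rintro ⟨h1, h2⟩
          exact ⟨⟨h1, key e he.1.1 e' h1 v he.2 h2 (hqa.trans (by simp)) he.1.2⟩, h2⟩
        · rintro ⟨⟨h1, _⟩, h2⟩; exact ⟨h1, h2⟩
      intro t ht _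
      obtain ⟨e, he, rfl⟩ := mem_cone.1 ht
      rw [← hA] at he
      exact (mem_filter.1 he).2
    · rcases card_le_one_cases hq with rfl | ⟨v, rfl⟩
      · simp at hqa
      · have hva : v ≠ a := by rintro rfl; simp at hqa
        intro t ht hqt
        obtain ⟨e, he, rfl⟩ := mem_cone.1 ht
        rw [singleton_subset_iff, mem_insert] at hqt hqt₀
        exact key e₀ he₀ e he v (hqt₀.resolve_left hva) (hqt.resolve_left hva) (by simp) ht₀
  · rw [hβ.bd_cone ha]; exact hβ.nonempty
  · intro z hz hz0
    -- the cone over the base edges of `z` has boundary `z`: the difference is a cycle of edges at the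
    -- apex, in which every other vertex has degree at most `1`, so it is empty
    set y := z.filter (a ∉ ·) with hy
    have hyβ : y ⊆ β := by
      intro e he
      obtain ⟨h1, h2⟩ := mem_filter.1 he
      obtain ⟨h3, t, ht, het⟩ := mem_edges.1 (hz h1)
      obtain ⟨e', he', rfl⟩ := mem_cone.1 ht
      have := eq_of_subset_of_card_le ((subset_insert_iff_of_notMem h2).1 het)
        (by rw [h3, hβ.card_eq e' he'])
      rw [this]; exact he'
    have hSs : cone a y ⊆ cone a β := image_subset_image hyβ
    refine ⟨cone a y, hSs, ?_⟩
    have hy2 : ∀ e ∈ y, #e = 2 := fun e he => hβ.card_eq e (hyβ he)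
    have hz' : ∀ e ∈ bd 2 (cone a y) ∆ z, #e = 2 ∧ a ∈ e := by
      intro e he
      rw [mem_symmDiff] at he
      have h2 : #e = 2 := by
        rcases he with h | h
        exacts [(mem_bd.1 h.1).1, (mem_edges.1 (hz h.1)).1]
      refine ⟨h2, ?_⟩
      by_contra hae
      rw [mem_bd_cone_iff hy2 hae, hy, mem_filter] at he
      tauto
    have h0 : bd 1 (bd 2 (cone a y) ∆ z) = ∅ := by
      rw [bd_symmDiff, hz0, bd_one_bd_two fun t ht => hc3 t (hSs ht)]; simp
    have : bd 2 (cone a y) ∆ z = ∅ := by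
      rw [eq_empty_iff_forall_notMem]
      intro e he
      obtain ⟨v, hav, rfl⟩ := exists_pair_of_mem (hz' e he).1 (hz' e he).2
      have hv : {v} ∈ bd 1 (bd 2 (cone a y) ∆ z) := by
        refine mem_bd.2 ⟨by simp, ?_⟩
        have : (bd 2 (cone a y) ∆ z).filter ({v} ⊆ ·) = {{a, v}} := by
          ext e'
          rw [mem_filter, mem_singleton, singleton_subset_iff]
          constructor
          · rintro ⟨h1, h2⟩
            exact pair_eq_of_mem (hz' e' h1).1 (hz' e' h1).2 h2 hav
          · rintro rfl; exact ⟨he, by simp⟩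
        rw [this]; simp
      rw [h0] at hv
      simp at hv
    exact symmDiff_eq_bot.1 this

theorem IsDisc.card_filter_bd {P : Finset (Finset W)} (hP : IsDisc P) {e : Finset W}
    (he : e ∈ bd 2 P) : #(P.filter (e ⊆ ·)) = 1 := by
  obtain ⟨h1, h2⟩ := mem_bd.1 he
  have := hP.edge_le e h1
  rw [Nat.odd_iff] at h2
  omega

/-- Gluing two discs along a common boundary edge gives a disc. -/
theorem IsDisc.glue {P Q : Finset (Finset W)} (hP : IsDisc P) (hQ : IsDisc Q) {e : Finset W}
    (heP : e ∈ bd 2 P) (heQ : e ∈ bd 2 Q) (hv : ∀ v ∈ verts P, v ∈ verts Q → v ∈ e) :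
    IsDisc (P ∪ Q) ∧ Disjoint P Q ∧ bd 2 (P ∪ Q) = bd 2 P ∆ bd 2 Q := by
  have he2 : #e = 2 := (mem_bd.1 heP).1
  have hsub : ∀ {s t t' : Finset W}, t ∈ P → t' ∈ Q → s ⊆ t → s ⊆ t' → s ⊆ e :=
    fun ht ht' h1 h2 v hvs => hv v (mem_verts.2 ⟨_, ht, h1 hvs⟩) (mem_verts.2 ⟨_, ht', h2 hvs⟩)
  have hdisj : Disjoint P Q := by
    rw [disjoint_left]
    intro t ht ht'
    have := card_le_card (hsub ht ht' Subset.rfl Subset.rfl)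
    rw [hP.card_eq t ht, he2] at this
    omega
  have hbd : bd 2 (P ∪ Q) = bd 2 P ∆ bd 2 Q := by
    rw [← bd_symmDiff, hdisj.symmDiff_eq_sup]; rfl
  have heq : ∀ {e' t t' : Finset W}, #e' = 2 → t ∈ P → t' ∈ Q → e' ⊆ t → e' ⊆ t' → e' = e :=
    fun h ht ht' h1 h2 => eq_of_subset_of_card_le (hsub ht ht' h1 h2) (by rw [h, he2])
  obtain ⟨p₀, hp₀, hep₀⟩ := exists_of_mem_bd heP
  obtain ⟨q₀, hq₀, heq₀⟩ := exists_of_mem_bd heQ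
  refine ⟨⟨?_, ?_, ?_, ?_, ?_⟩, hdisj, hbd⟩
  · intro t ht
    rcases mem_union.1 ht with h | h
    exacts [hP.card_eq t h, hQ.card_eq t h]
  · intro e' he'
    rw [filter_union]
    refine (card_union_le _ _).trans ?_
    have h1 := hP.edge_le e' he'
    have h2 := hQ.edge_le e' he'
    by_cases h : e' = e
    · subst h; rw [hP.card_filter_bd heP, hQ.card_filter_bd heQ]
    · by_cases h3 : #(P.filter (e' ⊆ ·)) = 0
      · omega
      · have : #(Q.filter (e' ⊆ ·)) = 0 := by
          by_contra h4
          obtain ⟨t, ht⟩ := card_pos.1 (Nat.pos_of_ne_zero h3)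
          obtain ⟨t', ht'⟩ := card_pos.1 (Nat.pos_of_ne_zero h4)
          rw [mem_filter] at ht ht'
          exact h (heq he' ht.1 ht'.1 ht.2 ht'.2)
        omega
  · intro q hq A hA hne hcl
    have hAP : (∃ t ∈ A, t ∈ P ∧ q ⊆ t) → ∀ t ∈ P, q ⊆ t → t ∈ A := by
      rintro ⟨t, htA, htP, hqt⟩ t' ht' hqt'
      exact (mem_inter.1 (hP.conn q hq (A ∩ P) inter_subset_right ⟨t, mem_inter.2 ⟨htA, htP⟩, hqt⟩
        (fun t ht t' ht' e h1 h2 h3 h4 => mem_inter.2 ⟨hcl t (mem_inter.1 ht).1 t'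
            (mem_union_left _ ht') e h1 h2 h3 h4, ht'⟩) t' ht' hqt')).1
    have hAQ : (∃ t ∈ A, t ∈ Q ∧ q ⊆ t) → ∀ t ∈ Q, q ⊆ t → t ∈ A := by
      rintro ⟨t, htA, htP, hqt⟩ t' ht' hqt'
      exact (mem_inter.1 (hQ.conn q hq (A ∩ Q) inter_subset_right ⟨t, mem_inter.2 ⟨htA, htP⟩, hqt⟩
        (fun t ht t' ht' e h1 h2 h3 h4 => mem_inter.2 ⟨hcl t (mem_inter.1 ht).1 t'
            (mem_union_right _ ht') e h1 h2 h3 h4, ht'⟩) t' ht' hqt')).1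
    obtain ⟨t₀, ht₀, hqt₀⟩ := hne
    -- chains around `q` pass from one disc to the other across `e`, if at all
    by_cases hqe : q ⊆ e
    · have hp₀A : p₀ ∈ A ∧ q₀ ∈ A := by
        rcases mem_union.1 (hA ht₀) with h | h
        · have := hAP ⟨t₀, ht₀, h, hqt₀⟩ p₀ hp₀ (hqe.trans hep₀)
          exact ⟨this, hcl p₀ this q₀ (mem_union_right _ hq₀) e he2 hqe hep₀ heq₀⟩
        · have := hAQ ⟨t₀, ht₀, h, hqt₀⟩ q₀ hq₀ (hqe.trans heq₀)
          exact ⟨hcl q₀ this p₀ (mem_union_left _ hp₀) e he2 hqe heq₀ hep₀, this⟩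
      intro t ht hqt
      rcases mem_union.1 ht with h | h
      · exact hAP ⟨p₀, hp₀A.1, hp₀, hqe.trans hep₀⟩ t h hqt
      · exact hAQ ⟨q₀, hp₀A.2, hq₀, hqe.trans heq₀⟩ t h hqt
    · intro t ht hqt
      rcases mem_union.1 (hA ht₀) with h0 | h0 <;> rcases mem_union.1 ht with h | h
      · exact hAP ⟨t₀, ht₀, h0, hqt₀⟩ t h hqt
      · exact absurd (hsub h0 h hqt₀ hqt) hqe
      · exact absurd (hsub h h0 hqt hqt₀) hqe
      · exact hAQ ⟨t₀, ht₀, h0, hqt₀⟩ t h hqt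
  · have h3 := three_le_card_of_bd_eq hP.bd_nonempty (fun e he => (mem_bd.1 he).1)
      (bd_one_bd_two hP.card_eq)
    have h1 : 0 < #((bd 2 P).erase e) := by rw [card_erase_of_mem heP]; omega
    obtain ⟨e', he'⟩ := card_pos.1 h1
    obtain ⟨hne, he'⟩ := mem_erase.1 he'
    refine ⟨e', ?_⟩
    rw [hbd, mem_symmDiff]
    refine Or.inl ⟨he', fun h => hne ?_⟩
    obtain ⟨t, ht, het⟩ := exists_of_mem_bd he'
    obtain ⟨t', ht', het'⟩ := exists_of_mem_bd h
    exact heq (mem_bd.1 he').1 ht ht' het het'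
  · intro z hz hz0
    set zP := z.filter (· ∈ edges P) with hzP
    set zR := z.filter (· ∉ edges P) with hzR
    have hzPR : zP ∆ zR = z := by
      ext e; simp only [hzP, hzR, mem_symmDiff, mem_filter]; tauto
    have hRT : zR ⊆ edges Q := by
      intro e he
      obtain ⟨h1, h2⟩ := mem_filter.1 he
      obtain ⟨hc, t, ht, het⟩ := mem_edges.1 (hz h1)
      rcases mem_union.1 ht with h | h
      · exact absurd (mem_edges.2 ⟨hc, t, h, het⟩) h2
      · exact mem_edges.2 ⟨hc, t, h, het⟩
    have hPP : zP ⊆ edges P := fun e he => (mem_filter.1 he).2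
    have hbb : bd 1 zP = bd 1 zR := by
      rw [← hzPR, bd_symmDiff] at hz0
      exact symmDiff_eq_bot.1 hz0
    -- odd vertices common to both parts lie on `e`, so both parts are closed up by `e` or by nothing
    have hex : ∃ p : Finset (Finset W), p ⊆ {e} ∧ bd 1 p = bd 1 zP := by
      by_cases h0 : bd 1 zP = ∅
      · exact ⟨∅, by simp, by simp [h0]⟩
      · refine ⟨{e}, Subset.rfl, ?_⟩
        rw [bd_singleton]
        symm
        apply eq_of_subset_of_card_le
        · intro s h
          obtain ⟨v, rfl⟩ := card_eq_one.1 (mem_bd.1 h).1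
          have h' := h
          rw [hbb] at h'
          obtain ⟨e₁, he, hve⟩ := exists_of_mem_bd h
          obtain ⟨e₂, he', hve'⟩ := exists_of_mem_bd h'
          obtain ⟨_, t, ht, het⟩ := mem_edges.1 (hPP he)
          obtain ⟨_, t', ht', het'⟩ := mem_edges.1 (hRT he')
          exact mem_powersetCard.2 ⟨hsub ht ht' (hve.trans het) (hve'.trans het'), by simp⟩
        · have h1 := even_card_bd_one (z := zP) (fun e he => (mem_edges.1 (hPP he)).1)
          have h2 := card_pos.2 (nonempty_iff_ne_empty.2 h0)
          rw [card_powersetCard, he2, Nat.choose_one_right]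
          rw [Nat.even_iff] at h1
          omega
    obtain ⟨p, hp, hpb⟩ := hex
    have hpP : p ⊆ edges P := hp.trans (singleton_subset_iff.2 (bd_subset_edges P heP))
    have hpQ : p ⊆ edges Q := hp.trans (singleton_subset_iff.2 (bd_subset_edges Q heQ))
    obtain ⟨S1, hS1, hS1b⟩ := hP.acyclic (zP ∆ p) (symmDiff_subset_of hPP hpP)
      (by rw [bd_symmDiff, hpb]; exact symmDiff_self _)
    obtain ⟨S2, hS2, hS2b⟩ := hQ.acyclic (zR ∆ p) (symmDiff_subset_of hRT hpQ)
      (by rw [bd_symmDiff, hpb, hbb]; exact symmDiff_self _)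
    refine ⟨S1 ∆ S2, symmDiff_subset_of (hS1.trans subset_union_left)
      (hS2.trans subset_union_right), ?_⟩
    rw [bd_symmDiff, hS1b, hS2b, symmDiff_cancel_right, hzPR]

end

section
/-! ### Fillings of short circuits -/

variable {V : Type*} {W : Type*}

/-- The number of members of `T` (triangles, usually) containing the vertex `v`. -/
def deg (T : Finset (Finset W)) (v : W) : ℕ := #(T.filter (v ∈ ·))

/-- The vertex map `f` sends every member of `T` to pairwise near points. -/
def IsSimp (near : V → V → Prop) (f : W → V) (T : Finset (Finset W)) : Prop :=
  ∀ t ∈ T, ∀ x ∈ t, ∀ y ∈ t, near (f x) (f y)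

/-- The form in which `7`-locatedness enters: `near` is reflexive and symmetric, and a circuit of
length `4` to `7` mapped without near pairs other than its edges has an image near one point. -/
structure IsNearLocated (W : Type*) (near : V → V → Prop) : Prop where
  refl : ∀ a, near a a
  symm : ∀ a b, near a b → near b a
  exists_center : ∀ (β : Finset (Finset W)) (f : W → V), IsCircuit β → 4 ≤ #β → #β ≤ 7 →
    IsSimp near f β →
    (∀ x ∈ verts β, ∀ y ∈ verts β, near (f x) (f y) → x = y ∨ {x, y} ∈ β) →
    ∃ c, ∀ x ∈ verts β, near c (f x)

/-- An upper bound for the area of a minimal filling of a circuit of length `m ≤ 7`: the larger of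
`m`, the area of a cone, and the greatest sum of two earlier values for the circuits cut off by a
chord. The values for `m < 3` and `m > 7` are irrelevant. -/
def fillBound : ℕ → ℕ
  | 3 => 1
  | 4 => 4
  | 5 => 5
  | 6 => 8
  | 7 => 9
  | _ => 0

/-- A number of new vertices of degree `4` in a filling of a circuit of length `m` that attains
`fillBound m`. -/
def fillCount : ℕ → ℕ
  | 4 => 1
  | 6 => 2
  | 7 => 1
  | _ => 0

/-- `(P, g)` is a disc spanning the circuit `β`, extending `f`, and meeting the set `A` of old
vertices in `β` only. -/
structure IsFill (near : V → V → Prop) (A : Finset W) (β : Finset (Finset W)) (f : W → V)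
    (P : Finset (Finset W)) (g : W → V) : Prop where
  disc : IsDisc P
  bd_eq : bd 2 P = β
  simp : IsSimp near g P
  eqOn : ∀ v ∈ A, g v = f v
  verts_inter : ∀ v ∈ verts P, v ∈ A → v ∈ verts β

/-- If the image of the circuit is near one point, the circuit spans a cone with a new vertex as
apex; for length `4` the apex is a new vertex of degree `4`. -/
theorem exists_fill_cone [Infinite W] {near : V → V → Prop} (hr : ∀ a, near a a)
    (hs : ∀ a b, near a b → near b a)
    {A : Finset W} {β : Finset (Finset W)} (hβ : IsCircuit β) (hA : verts β ⊆ A) {f : W → V}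
    (hf : IsSimp near f β) {c : V} (hc : ∀ x ∈ verts β, near c (f x)) :
    ∃ P g, IsFill near A β f P g ∧ #P = #β ∧
      (#β = 4 → 1 ≤ #((verts P \ A).filter fun v => deg P v = 4)) := by
  obtain ⟨a, ha⟩ := Infinite.exists_notMem_finset A
  have haβ : a ∉ verts β := fun h => ha (hA h)
  have hvert : ∀ v ∈ verts (cone a β), v = a ∨ v ∈ verts β := by
    intro v hv
    obtain ⟨t, ht, hvt⟩ := mem_verts.1 hv
    obtain ⟨e, he, rfl⟩ := mem_cone.1 ht
    rw [mem_insert] at hvt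
    exact hvt.imp_right fun h => mem_verts.2 ⟨e, he, h⟩
  have hg : ∀ v ∈ A, Function.update f a c v = f v := by
    intro v hv
    rw [Function.update_of_ne]
    rintro rfl; exact ha hv
  refine ⟨cone a β, Function.update f a c, ⟨isDisc_cone hβ haβ, hβ.bd_cone haβ, ?_, hg, ?_⟩,
    card_cone haβ, ?_⟩
  · intro t ht x hx y hy
    obtain ⟨e, he, rfl⟩ := mem_cone.1 ht
    have hev : ∀ v ∈ e, v ∈ verts β := fun v hv => mem_verts.2 ⟨e, he, hv⟩
    rw [mem_insert] at hx hy
    rcases hx with rfl | hx <;> rcases hy with rfl | hy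
    · exact hr _
    · rw [hg y (hA (hev y hy)), Function.update_self]; exact hc y (hev y hy)
    · rw [hg x (hA (hev x hx)), Function.update_self]; exact hs _ _ (hc x (hev x hx))
    · rw [hg x (hA (hev x hx)), hg y (hA (hev y hy))]; exact hf e he x hx y hy
  · intro v hv hvA
    rcases hvert v hv with rfl | h
    exacts [absurd hvA ha, h]
  · intro h4
    rw [Nat.succ_le_iff, card_pos]
    refine ⟨a, mem_filter.2 ⟨mem_sdiff.2 ⟨?_, ha⟩, ?_⟩⟩
    · obtain ⟨e, he⟩ := hβ.nonempty
      exact mem_verts.2 ⟨_, mem_cone.2 ⟨e, he, rfl⟩, mem_insert_self _ _⟩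
    · rw [deg, filter_true_of_mem, card_cone haβ, h4]
      intro t ht
      obtain ⟨e, he, rfl⟩ := mem_cone.1 ht
      exact mem_insert_self _ _

theorem mem_verts_insert {e : Finset W} {p : Finset (Finset W)} {v : W} :
    v ∈ verts (insert e p) ↔ v ∈ e ∨ v ∈ verts p := by
  simp [verts]

/-- The two circuits cut off by a chord have total length `#β + 2` and are shorter than `β`. -/
theorem IsCircuit.split' {β : Finset (Finset W)} (hβ : IsCircuit β) {x y : W} (hxy : x ≠ y)
    (hx : x ∈ verts β) (hy : y ∈ verts β) (he : {x, y} ∉ β) :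
    ∃ β₁ β₂, IsCircuit β₁ ∧ IsCircuit β₂ ∧ {x, y} ∈ β₁ ∧ {x, y} ∈ β₂ ∧ β₁ ∆ β₂ = β ∧
      #β₁ + #β₂ = #β + 2 ∧ #β₁ < #β ∧ #β₂ < #β ∧ verts β₁ ∩ verts β₂ ⊆ {x, y} ∧
      verts β₁ ⊆ verts β ∧ verts β₂ ⊆ verts β ∧ β₁ ⊆ insert {x, y} β ∧ β₂ ⊆ insert {x, y} β := by
  obtain ⟨p, q, hpq, hd, h1, h2, h3⟩ := hβ.split hxy hx hy he
  have hp : p ⊆ β := hpq ▸ subset_union_left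
  have hq : q ⊆ β := hpq ▸ subset_union_right
  have hep : {x, y} ∉ p := fun h => he (hp h)
  have heq : {x, y} ∉ q := fun h => he (hq h)
  have hc : #p + #q = #β := by rw [← hpq, card_union_of_disjoint hd]
  have hc1 := h1.three_le_card
  have hc2 := h2.three_le_card
  have hcard1 := card_insert_of_notMem hep
  have hcard2 := card_insert_of_notMem heq
  have hv : ∀ r ⊆ β, verts (insert {x, y} r) ⊆ verts β := by
    intro r hr v hv
    rw [mem_verts_insert] at hv
    rcases hv with hv | hv
    · simp only [mem_insert, mem_singleton] at hv
      rcases hv with rfl | rfl <;> assumption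
    · exact verts_mono hr hv
  refine ⟨_, _, h1, h2, mem_insert_self _ _, mem_insert_self _ _, ?_, by omega, by omega, by omega,
    h3, hv p hp, hv q hq, insert_subset_insert _ hp, insert_subset_insert _ hq⟩
  rw [insert_eq_symmDiff hep, insert_eq_symmDiff heq, symmDiff_comm _ q, symmDiff_comm _ p,
    symmDiff_cancel_right, hd.symmDiff_eq_sup]
  exact hpq

/-- Every circuit of length at most `7` whose edges are mapped to near pairs spans a disc of area at
most `fillBound`; the disc has `fillCount` many new vertices of degree `4` in the extreme case. -/
theorem exists_fill [Infinite W] {near : V → V → Prop} (hloc : IsNearLocated W near) (m : ℕ)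
    (hm : m ≤ 7) : ∀ (A : Finset W) (β : Finset (Finset W)) (f : W → V), IsCircuit β → #β = m →
      verts β ⊆ A → IsSimp near f β →
      ∃ P g, IsFill near A β f P g ∧ #P ≤ fillBound m ∧
        (#P = fillBound m → fillCount m ≤ #((verts P \ A).filter fun v => deg P v = 4)) := by
  induction m using Nat.strong_induction_on with
  | _ m ih =>
  intro A β f hβ hβm hA hf
  have h3 := hβ.three_le_card
  have hedge : ∀ x y, {x, y} ∈ β → near (f x) (f y) := fun x y h =>
    hf _ h x (by simp) y (by simp)
  by_cases hm3 : m = 3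
  · subst hm3
    obtain ⟨t, ht, rfl⟩ := hβ.exists_triangle hβm
    have hvt : ∀ v ∈ t, v ∈ verts (powersetCard 2 t) := by
      intro v hv
      obtain ⟨x, hx⟩ := card_pos.1 (by rw [card_erase_of_mem hv]; omega : 0 < #(t.erase v))
      rw [mem_erase] at hx
      refine mem_verts.2 ⟨{v, x}, mem_powersetCard.2 ⟨?_, card_pair hx.1.symm⟩, by simp⟩
      simp [insert_subset_iff, hv, hx.2]
    refine ⟨{t}, f, ⟨isDisc_triangle ht, bd_singleton 2 t, ?_, fun _ _ => rfl, ?_⟩, by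
      simp [fillBound], by simp [fillCount]⟩
    · intro t' ht' x hx y hy
      rw [mem_singleton.1 ht'] at hx hy
      by_cases hxy : x = y
      · subst hxy; exact hloc.refl _
      · refine hedge x y (mem_powersetCard.2 ⟨?_, card_pair hxy⟩)
        simp [insert_subset_iff, hx, hy]
    · intro v hv _
      exact hvt v (by simpa [verts] using hv)
  by_cases hcen : ∃ c, ∀ x ∈ verts β, near c (f x)
  · obtain ⟨c, hc⟩ := hcen
    obtain ⟨P, g, h1, h2, h4⟩ := exists_fill_cone hloc.refl hloc.symm hβ hA hf hc
    refine ⟨P, g, h1, ?_, ?_⟩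
    · rw [h2, hβm]
      rw [hβm] at h3
      interval_cases m <;> simp [fillBound] at *
    · rw [h2, hβm]
      rw [hβm] at h3 h4
      interval_cases m <;> simp [fillBound, fillCount] at *
      exact h4
  · -- without a centre there is a near pair that is not an edge of `β`
    have hch : ∃ x ∈ verts β, ∃ y ∈ verts β, near (f x) (f y) ∧ x ≠ y ∧ {x, y} ∉ β := by
      by_contra hno
      push Not at hno
      exact hcen (hloc.exists_center β f hβ (by omega) (by omega) hf fun x hx y hy hxy => by
        by_cases h : x = y
        exacts [Or.inl h, Or.inr (hno x hx y hy hxy h)])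
    obtain ⟨x, hx, y, hy, hnear, hxy, he⟩ := hch
    obtain ⟨β₁, β₂, hβ₁, hβ₂, he₁, he₂, hsd, hcard, hlt₁, hlt₂, hvi, hv₁, hv₂, hs₁, hs₂⟩ :=
      hβ.split' hxy hx hy he
    have hk₁ := hβ₁.three_le_card
    have hk₂ := hβ₂.three_le_card
    have hf' : IsSimp near f (insert {x, y} β) := by
      intro e h a ha b hb
      rcases mem_insert.1 h with rfl | h
      · simp only [mem_insert, mem_singleton] at ha hb
        rcases ha with rfl | rfl <;> rcases hb with rfl | rfl
        exacts [hloc.refl _, hnear, hloc.symm _ _ hnear, hloc.refl _]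
      · exact hf e h a ha b hb
    -- a circuit of length `4` with a near diagonal has a centre
    have hm4 : m ≠ 4 := by
      rintro rfl
      apply hcen
      have h1 : #β₁ = 3 := by omega
      have h2 : #β₂ = 3 := by omega
      have htri : ∀ β' : Finset (Finset W), IsCircuit β' → #β' = 3 → {x, y} ∈ β' →
          β' ⊆ insert {x, y} β → ∀ v ∈ verts β', near (f x) (f v) := by
        intro β' hβ' h3' hxy' hsub v hv
        obtain ⟨t, ht, rfl⟩ := hβ'.exists_triangle h3'
        obtain ⟨e, he, hve⟩ := mem_verts.1 hv
        have hvt := (mem_powersetCard.1 he).1 hve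
        by_cases hxv : x = v
        · subst hxv; exact hloc.refl _
        · have hxt : x ∈ t := (mem_powersetCard.1 hxy').1 (by simp)
          refine hf' {x, v} (hsub (mem_powersetCard.2 ⟨?_, card_pair hxv⟩)) x (by simp) v (by simp)
          simp [insert_subset_iff, hvt, hxt]
      refine ⟨f x, fun v hv => ?_⟩
      obtain ⟨e, heβ, hve⟩ := mem_verts.1 hv
      rw [← hsd, mem_symmDiff] at heβ
      rcases heβ with h | h
      · exact htri β₁ hβ₁ h1 he₁ hs₁ v (mem_verts.2 ⟨e, h.1, hve⟩)
      · exact htri β₂ hβ₂ h2 he₂ hs₂ v (mem_verts.2 ⟨e, h.1, hve⟩)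
    -- both circuits cut off by the chord are filled, with disjoint sets of new vertices, and glued
    obtain ⟨P₁, g₁, hP₁, hb₁, hn₁⟩ := ih #β₁ (by omega) (by omega) A β₁ f hβ₁ rfl (hv₁.trans hA)
      (fun e h => hf' e (hs₁ h))
    obtain ⟨P₂, g₂, hP₂, hb₂, hn₂⟩ := ih #β₂ (by omega) (by omega) (A ∪ verts P₁) β₂ g₁ hβ₂ rfl
      ((hv₂.trans hA).trans subset_union_left) (by
        intro e h a ha b hb
        rw [hP₁.eqOn a (hA (hv₂ (mem_verts.2 ⟨e, h, ha⟩))),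
          hP₁.eqOn b (hA (hv₂ (mem_verts.2 ⟨e, h, hb⟩)))]
        exact hf' e (hs₂ h) a ha b hb)
    have hvP : ∀ v ∈ verts P₁, v ∈ verts P₂ → v ∈ ({x, y} : Finset W) := by
      intro v h1 h2
      have h3 := hP₂.verts_inter v h2 (mem_union_right _ h1)
      exact hvi (mem_inter.2 ⟨hP₁.verts_inter v h1 (hA (hv₂ h3)), h3⟩)
    obtain ⟨hd, hdisj, hbd⟩ := hP₁.disc.glue hP₂.disc (e := {x, y}) (by rw [hP₁.bd_eq]; exact he₁)
      (by rw [hP₂.bd_eq]; exact he₂) hvP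
    have hxyA : ({x, y} : Finset W) ⊆ A := by
      simp [insert_subset_iff, hA hx, hA hy]
    have hvu : verts (P₁ ∪ P₂) = verts P₁ ∪ verts P₂ := by
      ext v; simp [verts, or_and_right, exists_or]
    refine ⟨P₁ ∪ P₂, g₂, ⟨hd, by rw [hbd, hP₁.bd_eq, hP₂.bd_eq, hsd], ?_, ?_, ?_⟩, ?_, ?_⟩
    · intro t ht a ha b hb
      rcases mem_union.1 ht with h | h
      · rw [hP₂.eqOn a (mem_union_right _ (mem_verts.2 ⟨t, h, ha⟩)),
          hP₂.eqOn b (mem_union_right _ (mem_verts.2 ⟨t, h, hb⟩))]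
        exact hP₁.simp t h a ha b hb
      · exact hP₂.simp t h a ha b hb
    · intro v hv
      rw [hP₂.eqOn v (mem_union_left _ hv), hP₁.eqOn v hv]
    · intro v hv hvA
      rw [hvu] at hv
      rcases mem_union.1 hv with h | h
      · exact hv₁ (hP₁.verts_inter v h hvA)
      · exact hv₂ (hP₂.verts_inter v h (mem_union_left _ hvA))
    · rw [card_union_of_disjoint hdisj]
      generalize #β₁ = k₁ at *
      generalize #β₂ = k₂ at *
      generalize #P₁ = p₁ at *
      generalize #P₂ = p₂ at *
      clear * - hm hcard hlt₁ hlt₂ hk₁ hk₂ hm4 hb₁ hb₂ hβm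
      have : k₂ = m + 2 - k₁ := by omega
      subst this hβm
      generalize #β = m at *
      interval_cases m <;> interval_cases k₁ <;> simp [fillBound] at * <;> omega
    · have hnn : #((verts P₁ \ A).filter fun v => deg P₁ v = 4) +
          #((verts P₂ \ (A ∪ verts P₁)).filter fun v => deg P₂ v = 4) ≤
          #((verts (P₁ ∪ P₂) \ A).filter fun v => deg (P₁ ∪ P₂) v = 4) := by
        rw [← card_union_of_disjoint]
        · apply card_le_card
          have hz : ∀ (Q : Finset (Finset W)) v, v ∉ verts Q → Q.filter (v ∈ ·) = ∅ := by
            intro Q v hv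
            rw [filter_eq_empty_iff]
            exact fun t ht hvt => hv (mem_verts.2 ⟨t, ht, hvt⟩)
          intro v hv
          rw [mem_filter, mem_sdiff, hvu]
          rcases mem_union.1 hv with h | h
          · obtain ⟨h1, h2⟩ := mem_filter.1 h
            obtain ⟨h1, h3⟩ := mem_sdiff.1 h1
            refine ⟨⟨mem_union_left _ h1, h3⟩, ?_⟩
            rw [deg, filter_union, hz P₂ v fun h' => h3 (hxyA (hvP v h1 h')), union_empty]
            exact h2
          · obtain ⟨h1, h2⟩ := mem_filter.1 h
            obtain ⟨h1, h3⟩ := mem_sdiff.1 h1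
            rw [mem_union, not_or] at h3
            refine ⟨⟨mem_union_right _ h1, h3.1⟩, ?_⟩
            rw [deg, filter_union, hz P₁ v h3.2, empty_union]
            exact h2
        · rw [disjoint_left]
          intro v h1 h2
          have h3 := (mem_sdiff.1 (mem_filter.1 h2).1).2
          exact h3 (mem_union_right _ (mem_sdiff.1 (mem_filter.1 h1).1).1)
      intro hP
      refine le_trans ?_ hnn
      rw [card_union_of_disjoint hdisj] at hP
      generalize #((verts P₁ \ A).filter fun v => deg P₁ v = 4) = c₁ at *
      generalize #((verts P₂ \ (A ∪ verts P₁)).filter fun v => deg P₂ v = 4) = c₂ at *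
      generalize #β₁ = k₁ at *
      generalize #β₂ = k₂ at *
      generalize #P₁ = p₁ at *
      generalize #P₂ = p₂ at *
      clear * - hm hcard hlt₁ hlt₂ hk₁ hk₂ hm4 hb₁ hb₂ hβm hP hn₁ hn₂
      have : k₂ = m + 2 - k₁ := by omega
      subst this hβm
      generalize #β = m at *
      interval_cases m <;> interval_cases k₁ <;> simp [fillBound, fillCount] at * <;> omega

end

section
/-! ### Minimal discs -/

variable {V : Type*} {W : Type*}

/-- `(T, f)` is a disc with a simplicial map of least area among those with the same boundary and
the same boundary values. -/
structure IsMin (near : V → V → Prop) (T : Finset (Finset W)) (f : W → V) : Prop where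
  disc : IsDisc T
  simp : IsSimp near f T
  min : ∀ (T' : Finset (Finset W)) (f' : W → V), IsDisc T' → IsSimp near f' T' →
    bd 2 T' = bd 2 T → (∀ v ∈ verts (bd 2 T), f' v = f v) → #T ≤ #T'

theorem verts_bd_subset (T : Finset (Finset W)) : verts (bd 2 T) ⊆ verts T := by
  intro v hv
  obtain ⟨e, he, hve⟩ := mem_verts.1 hv
  obtain ⟨t, ht, het⟩ := exists_of_mem_bd he
  exact mem_verts.2 ⟨t, ht, het hve⟩

/-- The disc inside a chordless circuit can be replaced by a small filling of that circuit. -/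
theorem IsMin.exists_refill [Infinite W] {near : V → V → Prop} (hloc : IsNearLocated W near)
    {T : Finset (Finset W)} {f : W → V} (h : IsMin near T f) {S : Finset (Finset W)} (hS : S ⊆ T)
    (hβ : IsCircuit (bd 2 S)) (hm : #(bd 2 S) ≤ 7)
    (hch : ∀ e ∈ edges T, e ⊆ verts (bd 2 S) → e ∈ bd 2 S) :
    ∃ P g, IsFill near (verts T) (bd 2 S) f P g ∧ #P ≤ fillBound #(bd 2 S) ∧
      (#P = fillBound #(bd 2 S) →
        fillCount #(bd 2 S) ≤ #((verts P \ verts T).filter fun v => deg P v = 4)) ∧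
      (∀ e ∈ edges P, e ∈ edges T → e ∈ bd 2 S) ∧
      IsSimp near g (T \ S ∪ P) ∧ #S ≤ #P := by
  have hvT : verts (bd 2 S) ⊆ verts T := (verts_bd_subset S).trans (verts_mono hS)
  obtain ⟨P, g, hP, h1, h2⟩ := exists_fill hloc _ hm (verts T) (bd 2 S) f hβ rfl hvT (by
    intro e he x hx y hy
    obtain ⟨t, ht, het⟩ := exists_of_mem_bd he
    exact h.simp t (hS ht) x (het hx) y (het hy))
  have he : ∀ e ∈ edges P, e ∈ edges T → e ∈ bd 2 S := by
    intro e heP heT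
    refine hch e heT fun v hv => ?_
    obtain ⟨_, t, ht, het⟩ := mem_edges.1 heP
    obtain ⟨_, t', ht', het'⟩ := mem_edges.1 heT
    exact hP.verts_inter v (mem_verts.2 ⟨t, ht, het hv⟩) (mem_verts.2 ⟨t', ht', het' hv⟩)
  have hsimp : IsSimp near g (T \ S ∪ P) := by
    intro t ht x hx y hy
    rcases mem_union.1 ht with ht | ht
    · have htT := (mem_sdiff.1 ht).1
      rw [hP.eqOn x (mem_verts.2 ⟨t, htT, hx⟩), hP.eqOn y (mem_verts.2 ⟨t, htT, hy⟩)]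
      exact h.simp t htT x hx y hy
    · exact hP.simp t ht x hx y hy
  obtain ⟨hd, hbd, hdisj⟩ := h.disc.replace hP.disc hS hβ hP.bd_eq he hP.verts_inter
  have := h.min _ g hd hsimp hbd fun v hv => hP.eqOn v (verts_bd_subset T hv)
  rw [card_union_of_disjoint hdisj] at this
  have h3 := card_sdiff_add_card_eq_card hS
  exact ⟨P, g, hP, h1, h2, he, hsimp, by omega⟩

theorem card_symmDiff_le {α : Type*} [DecidableEq α] (s t : Finset α) : #(s ∆ t) ≤ #s + #t :=
  (card_le_card (symmDiff_subset_of subset_union_left subset_union_right)).trans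
    (card_union_le s t)

/-- Cutting along a chord. -/
theorem IsDisc.exists_split {T : Finset (Finset W)} (hT : IsDisc T) {S : Finset (Finset W)}
    (hS : S ⊆ T) (hβ : IsCircuit (bd 2 S)) {e : Finset W} (he : e ∈ edges T)
    (hev : e ⊆ verts (bd 2 S)) (heβ : e ∉ bd 2 S) :
    ∃ S₁ S₂, S₁ ⊆ T ∧ S₂ ⊆ T ∧ S₁ ∆ S₂ = S ∧ e ∈ bd 2 S₁ ∧ e ∈ bd 2 S₂ ∧
      #(bd 2 S₁) + #(bd 2 S₂) = #(bd 2 S) + 2 ∧ #(bd 2 S₁) < #(bd 2 S) ∧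
      #(bd 2 S₂) < #(bd 2 S) ∧ 3 ≤ #(bd 2 S₁) ∧ 3 ≤ #(bd 2 S₂) ∧
      verts (bd 2 S₁) ⊆ verts (bd 2 S) ∧ verts (bd 2 S₂) ⊆ verts (bd 2 S) := by
  obtain ⟨x, y, hxy, rfl⟩ := card_eq_two.1 (mem_edges.1 he).1
  simp only [insert_subset_iff, singleton_subset_iff] at hev
  obtain ⟨β₁, β₂, hβ₁, hβ₂, he₁, he₂, hsd, hcard, hlt₁, hlt₂, hvi, hv₁, hv₂, hs₁, hs₂⟩ :=
    hβ.split' hxy hev.1 hev.2 heβ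
  have hsub : insert {x, y} (bd 2 S) ⊆ edges T :=
    insert_subset he ((bd_subset_edges S).trans (edges_mono hS))
  obtain ⟨S₁, hS₁, rfl⟩ := hT.acyclic β₁ (hs₁.trans hsub) hβ₁.bd_eq
  obtain ⟨S₂, hS₂, rfl⟩ := hT.acyclic β₂ (hs₂.trans hsub) hβ₂.bd_eq
  refine ⟨S₁, S₂, hS₁, hS₂, ?_, he₁, he₂, hcard, hlt₁, hlt₂, hβ₁.three_le_card,
    hβ₂.three_le_card, hv₁, hv₂⟩
  apply hT.bd_injOn (symmDiff_subset_of hS₁ hS₂) hS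
  rw [bd_symmDiff, hsd]

/-- The bound for the two circuits cut off by a chord. -/
theorem fillBound_split {m k₁ k₂ : ℕ} (hm : m ≤ 7) (h : k₁ + k₂ = m + 2) (h₁ : k₁ < m)
    (h₂ : k₂ < m) (h₃ : 3 ≤ k₁) (h₄ : 3 ≤ k₂) : fillBound k₁ + fillBound k₂ ≤ fillBound m := by
  obtain rfl : k₂ = m + 2 - k₁ := by omega
  interval_cases m <;> interval_cases k₁ <;> simp [fillBound] at *

/-- The bound for two circuits without common edges, strict for the lengths `6` and `7`. -/
theorem fillBound_add {m k : ℕ} (hm : m ≤ 7) (hk : k < m) (h3 : 3 ≤ k) :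
    fillBound k + fillBound (m - k) ≤ fillBound m ∧
      (6 ≤ m → fillBound k + fillBound (m - k) < fillBound m) := by
  interval_cases m <;> interval_cases k <;> simp [fillBound] at *

/-- A union of circuits decomposes. -/
theorem IsDisc.exists_decomp {T : Finset (Finset W)} (hT : IsDisc T) {S : Finset (Finset W)}
    (hS : S ⊆ T) (hne : bd 2 S ≠ ∅) (hβ : ¬ IsCircuit (bd 2 S)) :
    ∃ S₁ S₂, S₁ ⊆ T ∧ S₂ ⊆ T ∧ #S ≤ #S₁ + #S₂ ∧ 3 ≤ #(bd 2 S₁) ∧ #(bd 2 S₁) < #(bd 2 S) ∧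
      #(bd 2 S₂) = #(bd 2 S) - #(bd 2 S₁) := by
  obtain ⟨β, hβS, hβc⟩ := exists_circuit_subset (nonempty_iff_ne_empty.2 hne)
    (fun e he => (mem_bd.1 he).1) (bd_one_bd_two fun t ht => hT.card_eq t (hS ht))
  have hβne : β ≠ bd 2 S := by rintro rfl; exact hβ hβc
  obtain ⟨S₁, hS₁, rfl⟩ := hT.acyclic β (hβS.trans ((bd_subset_edges S).trans (edges_mono hS)))
    hβc.bd_eq
  have hsd : bd 2 (S ∆ S₁) = bd 2 S \ bd 2 S₁ := by
    rw [bd_symmDiff]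
    ext e; simp only [mem_sdiff, mem_symmDiff]
    constructor
    · rintro (h | h)
      · exact h
      · exact absurd (hβS h.1) h.2
    · exact fun h => Or.inl h
  refine ⟨S₁, S ∆ S₁, hS₁, symmDiff_subset_of hS hS₁, ?_, hβc.three_le_card,
    card_lt_card (hβS.ssubset_of_ne hβne), ?_⟩
  · have : S = S₁ ∆ (S ∆ S₁) := by rw [symmDiff_comm S, symmDiff_symmDiff_cancel_left]
    calc #S = #(S₁ ∆ (S ∆ S₁)) := by rw [← this]
      _ ≤ _ := card_symmDiff_le _ _
  · rw [hsd, card_sdiff_of_subset hβS]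

/-- The isoperimetric inequality for short boundaries inside a minimal disc. -/
theorem IsMin.card_le_fillBound [Infinite W] {near : V → V → Prop} (hloc : IsNearLocated W near)
    {T : Finset (Finset W)} {f : W → V} (h : IsMin near T f) (m : ℕ) (hm : m ≤ 7) :
    ∀ S ⊆ T, #(bd 2 S) = m → #S ≤ fillBound m := by
  induction m using Nat.strong_induction_on with
  | _ m ih =>
  intro S hS hSm
  by_cases hne : bd 2 S = ∅
  · rw [h.disc.eq_empty hS hne]; simp
  by_cases hβ : IsCircuit (bd 2 S)
  · by_cases hch : ∀ e ∈ edges T, e ⊆ verts (bd 2 S) → e ∈ bd 2 S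
    · obtain ⟨P, g, _, h1, _, _, _, h2⟩ := h.exists_refill hloc hS hβ (by omega) hch
      rw [hSm] at h1
      exact h2.trans h1
    · push Not at hch
      obtain ⟨e, he, hev, heβ⟩ := hch
      obtain ⟨S₁, S₂, hS₁, hS₂, hsd, _, _, hc, hl₁, hl₂, h3₁, h3₂, _, _⟩ :=
        h.disc.exists_split hS hβ he hev heβ
      have h1 := ih _ (by omega) (by omega) S₁ hS₁ rfl
      have h2 := ih _ (by omega) (by omega) S₂ hS₂ rfl
      have h3 := fillBound_split hm (by omega) (by omega) (by omega) h3₁ h3₂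
      have h4 := card_symmDiff_le S₁ S₂
      rw [hsd] at h4
      omega
  · obtain ⟨S₁, S₂, hS₁, hS₂, hle, h3, hlt, heq⟩ := h.disc.exists_decomp hS hne hβ
    have h1 := ih _ (by omega) (by omega) S₁ hS₁ rfl
    have h2 := ih _ (by omega) (by omega) S₂ hS₂ rfl
    have h4 := (fillBound_add hm (by omega) h3).1
    rw [← hSm, ← heq, hSm] at h4
    omega

theorem fillBound_mono {k m : ℕ} (h : k ≤ m) (hm : m ≤ 7) : fillBound k ≤ fillBound m := by
  interval_cases m <;> interval_cases k <;> simp [fillBound]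

theorem IsMin.card_le [Infinite W] {near : V → V → Prop} (hloc : IsNearLocated W near)
    {T : Finset (Finset W)} {f : W → V} (h : IsMin near T f) {m : ℕ} (hm : m ≤ 7)
    {S : Finset (Finset W)} (hS : S ⊆ T) (hSm : #(bd 2 S) ≤ m) : #S ≤ fillBound m :=
  (h.card_le_fillBound hloc _ (hSm.trans hm) S hS rfl).trans (fillBound_mono hSm hm)

/-- A part attaining the bound for `m = 6, 7` is bounded by a circuit of length `m`. -/
theorem IsMin.isCircuit_of_fillBound_le [Infinite W] {near : V → V → Prop}
    (hloc : IsNearLocated W near)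
    {T : Finset (Finset W)} {f : W → V} (h : IsMin near T f) {m : ℕ} (hm : m ≤ 7) (h6 : 6 ≤ m)
    {S : Finset (Finset W)} (hS : S ⊆ T) (hSm : #(bd 2 S) ≤ m) (hSc : fillBound m ≤ #S) :
    IsCircuit (bd 2 S) ∧ #(bd 2 S) = m := by
  have hcard : #(bd 2 S) = m := by
    by_contra hne
    have h1 := h.card_le hloc (m := m - 1) (by omega) hS (by omega)
    interval_cases m <;> simp [fillBound] at * <;> omega
  refine ⟨?_, hcard⟩
  by_contra hβ
  obtain ⟨S₁, S₂, hS₁, hS₂, hle, h3, hlt, heq⟩ := h.disc.exists_decomp hS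
    (by rintro h0; rw [h0] at hcard; simp at hcard; omega) hβ
  have h1 := h.card_le_fillBound hloc _ (by omega) S₁ hS₁ rfl
  have h2 := h.card_le_fillBound hloc _ (by omega) S₂ hS₂ rfl
  have h4 := (fillBound_add hm (by omega) h3).2 h6
  rw [← hcard, ← heq, hcard] at h4
  omega

/-- At a vertex off the boundary of `S`, either all triangles belong to `S` or none does. -/
theorem IsDisc.star_subset {T : Finset (Finset W)} (hT : IsDisc T) {S : Finset (Finset W)}
    (hS : S ⊆ T) {v : W} (hv : v ∉ verts (bd 2 S)) {t t' : Finset W} (ht : t ∈ S) (hvt : v ∈ t)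
    (ht' : t' ∈ T) (hvt' : v ∈ t') : t' ∈ S :=
  hT.conn {v} (by simp) S hS ⟨t, ht, by simpa using hvt⟩
    (fun _ ha _ hb _ h1 h2 h3 h4 => hT.mem_of_notMem_bd hS h1
      (fun h => hv (mem_verts.2 ⟨_, h, h2 (mem_singleton_self v)⟩)) ha hb h3 h4)
    t' ht' (by simpa using hvt')

/-- The stars of two adjacent inner vertices, if they attain the bound, form a disc whose boundary
circuit has no chord. -/
theorem IsMin.chordless_of_pair [Infinite W] {near : V → V → Prop} (hloc : IsNearLocated W near)
    {T : Finset (Finset W)} {f : W → V} (h : IsMin near T f)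
    {S : Finset (Finset W)} (hS : S ⊆ T) (hβ : IsCircuit (bd 2 S)) (hm : #(bd 2 S) ≤ 7)
    (hSc : fillBound #(bd 2 S) ≤ #S) {v w : W} (hv : v ∉ verts (bd 2 S))
    (hw : w ∉ verts (bd 2 S)) (hvw : ∃ t ∈ T, v ∈ t ∧ w ∈ t) (hall : ∀ t ∈ S, v ∈ t ∨ w ∈ t) :
    ∀ e ∈ edges T, e ⊆ verts (bd 2 S) → e ∈ bd 2 S := by
  intro e he hev
  by_contra heβ
  obtain ⟨S₁, S₂, hS₁, hS₂, hsd, he₁, he₂, hc, hl₁, hl₂, h3₁, h3₂, hv₁, hv₂⟩ :=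
    h.disc.exists_split hS hβ he hev heβ
  have h1 := h.card_le_fillBound hloc _ (by omega) S₁ hS₁ rfl
  have h2 := h.card_le_fillBound hloc _ (by omega) S₂ hS₂ rfl
  have h3 := fillBound_split hm hc hl₁ hl₂ h3₁ h3₂
  have hdisj : Disjoint S₁ S₂ := by
    rw [disjoint_iff_inter_eq_empty, ← card_eq_zero]
    have h4 : S₁ ∆ S₂ ⊆ (S₁ ∪ S₂) \ (S₁ ∩ S₂) := by rw [symmDiff_eq_sup_sdiff_inf]; rfl
    have h5 := card_le_card h4
    rw [card_sdiff_of_subset (inter_subset_left.trans subset_union_left), hsd] at h5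
    have h6 := card_union_le S₁ S₂
    have h7 := card_le_card (inter_subset_left.trans subset_union_left : S₁ ∩ S₂ ⊆ S₁ ∪ S₂)
    omega
  have hun : S₁ ∪ S₂ = S := by rw [← hsd, hdisj.symmDiff_eq_sup]; rfl
  obtain ⟨t₁, ht₁, het₁⟩ := exists_of_mem_bd he₁
  obtain ⟨t₂, ht₂, het₂⟩ := exists_of_mem_bd he₂
  have he2 := (mem_edges.1 he).1
  have hve : v ∉ e := fun h => hv (hev h)
  have hwe : w ∉ e := fun h => hw (hev h)
  -- a triangle of `S` on `e` is the join of `e` with `v` or with `w`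
  have htri : ∀ t ∈ T, e ⊆ t → ∀ x, x ∉ e → x ∈ t → t = insert x e := by
    intro t ht het x hxe hxt
    symm
    apply eq_of_subset_of_card_le (insert_subset hxt het)
    rw [h.disc.card_eq t ht, card_insert_of_notMem hxe, he2]
  have hne : t₁ ≠ t₂ := by rintro rfl; exact disjoint_left.1 hdisj ht₁ ht₂
  obtain ⟨t₃, ht₃, hvt₃, hwt₃⟩ := hvw
  -- vertices off the boundary with a common triangle have their stars on the same side of the chord
  have hcross : ∀ x y, x ∈ t₁ → y ∈ t₂ → x ∉ verts (bd 2 S) → y ∉ verts (bd 2 S) → x ∈ t₃ →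
      y ∈ t₃ → False := by
    intro x y hx hy hxβ hyβ hx₃ hy₃
    have h1 := h.disc.star_subset hS₁ (fun h => hxβ (hv₁ h)) ht₁ hx ht₃ hx₃
    have h2 := h.disc.star_subset hS₂ (fun h => hyβ (hv₂ h)) ht₂ hy ht₃ hy₃
    exact disjoint_left.1 hdisj h1 h2
  rcases hall t₁ (hun ▸ mem_union_left _ ht₁) with h1 | h1 <;>
    rcases hall t₂ (hun ▸ mem_union_right _ ht₂) with h2 | h2
  · exact hne ((htri t₁ (hS₁ ht₁) het₁ v hve h1).trans (htri t₂ (hS₂ ht₂) het₂ v hve h2).symm)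
  · exact hcross v w h1 h2 hv hw hvt₃ hwt₃
  · exact hcross w v h1 h2 hw hv hwt₃ hvt₃
  · exact hne ((htri t₁ (hS₁ ht₁) het₁ w hwe h1).trans (htri t₂ (hS₂ ht₂) het₂ w hwe h2).symm)

/-- The inner vertices of a disc: those off its boundary. -/
def inner (T : Finset (Finset W)) : Finset W := verts T \ verts (bd 2 T)

/-- The inner vertices of degree `4`. -/
def innerFour (T : Finset (Finset W)) : Finset W := (inner T).filter fun v => deg T v = 4

/-- `T₀` is a subdisc of the minimal disc `T`, and the number of its inner vertices of degree `4`
cannot be increased by passing to another subdisc of a minimal disc with the same boundary and the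
same area. -/
structure IsExtremal (near : V → V → Prop) (T T₀ : Finset (Finset W)) (f : W → V) : Prop where
  min : IsMin near T f
  subset : T₀ ⊆ T
  disc : IsDisc T₀
  max : ∀ (T' T₀' : Finset (Finset W)) (f' : W → V), IsMin near T' f' → T₀' ⊆ T' → IsDisc T₀' →
    bd 2 T₀' = bd 2 T₀ → #T₀' = #T₀ → #(innerFour T₀') ≤ #(innerFour T₀)

theorem card_verts_le {T : Finset (Finset W)} (hT : ∀ t ∈ T, #t = 3) : #(verts T) ≤ 3 * #T := by
  refine card_biUnion_le.trans ?_
  exact (sum_le_card_nsmul T _ 3 fun t ht => (hT t ht).le).trans (by rw [smul_eq_mul, mul_comm])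

/-- An extremal subdisc exists because the number of vertices is bounded in terms of the area. -/
theorem exists_isExtremal {near : V → V → Prop} {T T₀ : Finset (Finset W)} {f : W → V}
    (h : IsMin near T f) (h₀ : T₀ ⊆ T) (hd : IsDisc T₀) :
    ∃ (T' T₀' : Finset (Finset W)) (f' : W → V), IsExtremal near T' T₀' f' ∧
      bd 2 T₀' = bd 2 T₀ ∧ #T₀' = #T₀ := by
  let p : ℕ → Prop := fun k => ∃ (T' T₀' : Finset (Finset W)) (f' : W → V), IsMin near T' f' ∧
    T₀' ⊆ T' ∧ IsDisc T₀' ∧ bd 2 T₀' = bd 2 T₀ ∧ #T₀' = #T₀ ∧ #(innerFour T₀') = k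
  have hb : ∀ k, p k → k ≤ 3 * #T₀ := by
    rintro k ⟨T', T₀', f', _, _, h3, _, h5, rfl⟩
    rw [← h5]
    exact (card_le_card ((filter_subset _ _).trans sdiff_subset)).trans (card_verts_le h3.card_eq)
  have hp : p #(innerFour T₀) := ⟨T, T₀, f, h, h₀, hd, rfl, rfl, rfl⟩
  have hspec := Nat.findGreatest_spec (hb _ hp) hp
  obtain ⟨T', T₀', f', h1, h2, h3, h4, h5, h6⟩ := hspec
  refine ⟨T', T₀', f', ⟨h1, h2, h3, fun T'' T₀'' f'' g1 g2 g3 g4 g5 => ?_⟩, h4, h5⟩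
  rw [h6]
  have : p #(innerFour T₀'') := ⟨T'', T₀'', f'', g1, g2, g3, g4.trans h4, g5.trans h5, rfl⟩
  exact Nat.le_findGreatest (hb _ this) this

/-- Refilling a part of an extremal subdisc cannot create more inner vertices of degree `4` than
it destroys. -/
theorem IsExtremal.fillCount_le [Infinite W] {near : V → V → Prop} (hloc : IsNearLocated W near)
    {T T₀ : Finset (Finset W)} {f : W → V} (h : IsExtremal near T T₀ f) {S : Finset (Finset W)}
    (hS : S ⊆ T₀) (hβ : IsCircuit (bd 2 S)) (hm : #(bd 2 S) ≤ 7)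
    (hch : ∀ e ∈ edges T, e ⊆ verts (bd 2 S) → e ∈ bd 2 S) (hSc : fillBound #(bd 2 S) ≤ #S) :
    fillCount #(bd 2 S) ≤ #((innerFour T₀).filter (· ∈ verts S)) := by
  obtain ⟨P, g, hP, h1, h2, he, hsimp, h3⟩ :=
    h.min.exists_refill hloc (hS.trans h.subset) hβ hm hch
  have hcard : #P = #S := by omega
  obtain ⟨hd, hbd, hdisj⟩ := h.min.disc.replace hP.disc (hS.trans h.subset) hβ hP.bd_eq he
    hP.verts_inter
  obtain ⟨hd₀, hbd₀, hdisj₀⟩ := h.disc.replace hP.disc hS hβ hP.bd_eq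
    (fun e h1 h2 => he e h1 (edges_mono h.subset h2))
    (fun v h1 h2 => hP.verts_inter v h1 (verts_mono h.subset h2))
  have hc := card_sdiff_add_card_eq_card (hS.trans h.subset)
  have hc₀ := card_sdiff_add_card_eq_card hS
  have hmin : IsMin near (T \ S ∪ P) g := by
    refine ⟨hd, hsimp, fun T' f' g1 g2 g3 g4 => ?_⟩
    rw [card_union_of_disjoint hdisj, hcard, hc]
    rw [hbd] at g3 g4
    exact h.min.min T' f' g1 g2 g3 fun v hv =>
      (g4 v hv).trans (hP.eqOn v (verts_bd_subset T hv))
  have hmax := h.max (T \ S ∪ P) (T₀ \ S ∪ P) g hmin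
    (union_subset_union (sdiff_subset_sdiff h.subset Subset.rfl) Subset.rfl) hd₀ hbd₀
    (by rw [card_union_of_disjoint hdisj₀]; omega)
  have hcnt := h2 (by omega)
  -- vertices of degree `4` off `S` survive the replacement, and the new ones in `P` are added
  have hsub : (innerFour T₀).filter (· ∉ verts S) ∪
      (verts P \ verts T).filter (fun v => deg P v = 4) ⊆ innerFour (T₀ \ S ∪ P) := by
    have hz : ∀ (Q : Finset (Finset W)) v, v ∉ verts Q → Q.filter (v ∈ ·) = ∅ := by
      intro Q v hv
      rw [filter_eq_empty_iff]
      exact fun t ht hvt => hv (mem_verts.2 ⟨t, ht, hvt⟩)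
    have hvu : verts (T₀ \ S ∪ P) = verts (T₀ \ S) ∪ verts P := by
      ext v; simp [verts, or_and_right, exists_or]
    intro v hv
    rw [innerFour, mem_filter, inner, mem_sdiff, hbd₀, hvu]
    rcases mem_union.1 hv with hv | hv
    · obtain ⟨hv, hvS⟩ := mem_filter.1 hv
      obtain ⟨hv, hv4⟩ := mem_filter.1 hv
      obtain ⟨hv, hvb⟩ := mem_sdiff.1 hv
      obtain ⟨t, ht, hvt⟩ := mem_verts.1 hv
      have htS : t ∉ S := fun h => hvS (mem_verts.2 ⟨t, h, hvt⟩)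
      have hvP : v ∉ verts P := fun h' => hvS (verts_bd_subset S
        (hP.verts_inter v h' (verts_mono h.subset hv)))
      refine ⟨⟨mem_union_left _ (mem_verts.2 ⟨t, mem_sdiff.2 ⟨ht, htS⟩, hvt⟩), hvb⟩, ?_⟩
      rw [deg, filter_union, hz P v hvP, union_empty, ← hv4, deg]
      congr 1
      ext t'
      simp only [mem_filter, mem_sdiff]
      constructor
      · rintro ⟨⟨h1, _⟩, h2⟩; exact ⟨h1, h2⟩
      · rintro ⟨h1, h2⟩; exact ⟨⟨h1, fun h => hvS (mem_verts.2 ⟨t', h, h2⟩)⟩, h2⟩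
    · obtain ⟨hv, hv4⟩ := mem_filter.1 hv
      obtain ⟨hvP, hvT⟩ := mem_sdiff.1 hv
      refine ⟨⟨mem_union_right _ hvP, fun h' =>
        hvT (verts_mono h.subset (verts_bd_subset T₀ h'))⟩, ?_⟩
      rw [deg, filter_union, hz (T₀ \ S) v fun h' => hvT (verts_mono (sdiff_subset.trans h.subset) h'),
        empty_union]
      exact hv4
  have hcu := card_le_card hsub
  rw [card_union_of_disjoint] at hcu
  · have := card_filter_add_card_filter_not (s := innerFour T₀) (· ∈ verts S)
    omega
  · rw [disjoint_left]
    intro v hv hv'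
    have h1 := (mem_sdiff.1 (mem_filter.1 hv').1).2
    have h2 := (mem_sdiff.1 (mem_filter.1 (mem_filter.1 hv).1).1).1
    exact h1 (verts_mono h.subset h2)

end

section
/-! ### Degrees in an extremal disc -/

variable {V : Type*} {W : Type*}

/-- Two distinct vertices of a common triangle. -/
def Nbr (T : Finset (Finset W)) (v w : W) : Prop := v ≠ w ∧ ∃ t ∈ T, v ∈ t ∧ w ∈ t

theorem Nbr.symm {T : Finset (Finset W)} {v w : W} (h : Nbr T v w) : Nbr T w v := by
  obtain ⟨h, t, ht, h1, h2⟩ := h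
  exact ⟨h.symm, t, ht, h2, h1⟩

theorem pair_subset_iff {v w : W} {t : Finset W} : {v, w} ⊆ t ↔ v ∈ t ∧ w ∈ t := by
  simp [insert_subset_iff]

theorem Nbr.mem_edges {T : Finset (Finset W)} {v w : W} (h : Nbr T v w) : {v, w} ∈ edges T := by
  obtain ⟨h, t, ht, h1, h2⟩ := h
  exact DiscFilling.mem_edges.2 ⟨card_pair h, t, ht, pair_subset_iff.2 ⟨h1, h2⟩⟩

theorem notMem_bd_of_inner {T : Finset (Finset W)} {v : W} (hv : v ∈ inner T) {e : Finset W}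
    (he : v ∈ e) : e ∉ bd 2 T := fun h => (mem_sdiff.1 hv).2 (mem_verts.2 ⟨e, h, he⟩)

/-- An edge at an inner vertex lies in exactly two triangles. -/
theorem IsDisc.card_filter_of_inner {T : Finset (Finset W)} (hT : IsDisc T) {v : W}
    (hv : v ∈ inner T) {e : Finset W} (he : e ∈ edges T) (hve : v ∈ e) :
    #(T.filter (e ⊆ ·)) = 2 := by
  obtain ⟨h2, t, ht, het⟩ := DiscFilling.mem_edges.1 he
  have h1 := hT.edge_le e h2
  have h3 : 0 < #(T.filter (e ⊆ ·)) := card_pos.2 ⟨t, mem_filter.2 ⟨ht, het⟩⟩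
  have h4 : ¬ Odd #(T.filter (e ⊆ ·)) := fun h => notMem_bd_of_inner hv hve (mem_bd.2 ⟨h2, h⟩)
  rw [Nat.odd_iff] at h4
  omega

theorem card_edges_at {t : Finset W} (ht : #t = 3) {v : W} (hv : v ∈ t) :
    #((powersetCard 2 t).filter (v ∈ ·)) = 2 := by
  have : (powersetCard 2 t).filter (v ∈ ·) = (t.erase v).image fun w => {v, w} := by
    ext e
    simp only [mem_filter, mem_powersetCard, mem_image, mem_erase]
    constructor
    · rintro ⟨⟨h1, h2⟩, h3⟩
      obtain ⟨w, hvw, rfl⟩ := exists_pair_of_mem h2 h3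
      exact ⟨w, ⟨hvw.symm, h1 (by simp)⟩, rfl⟩
    · rintro ⟨w, ⟨h1, h2⟩, rfl⟩
      exact ⟨⟨pair_subset_iff.2 ⟨hv, h2⟩, card_pair (Ne.symm h1)⟩, by simp⟩
  rw [this, card_image_of_injOn, card_erase_of_mem hv, ht]
  intro x hx y hy h
  simp only [coe_erase, Set.mem_sdiff, mem_coe, Set.mem_singleton_iff] at hx hy
  have : x ∈ ({v, y} : Finset W) := by
    rw [← show ({v, x} : Finset W) = {v, y} from h]; simp
  simp only [mem_insert, mem_singleton] at this
  exact this.resolve_left hx.2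

/-- An inner vertex lies on as many edges as triangles. -/
theorem IsDisc.card_edges_inner {T : Finset (Finset W)} (hT : IsDisc T) {v : W}
    (hv : v ∈ inner T) : #((edges T).filter (v ∈ ·)) = deg T v := by
  have h := sum_card_bipartiteAbove_eq_sum_card_bipartiteBelow (s := (edges T).filter (v ∈ ·))
    (t := T.filter (v ∈ ·)) (fun e t => e ⊆ t)
  rw [sum_congr rfl (g := fun _ => 2), sum_congr (s₁ := T.filter (v ∈ ·)) rfl (g := fun _ => 2)] at h
  · simp only [sum_const, smul_eq_mul] at h
    rw [deg]; omega
  · intro t ht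
    obtain ⟨ht, hvt⟩ := mem_filter.1 ht
    rw [← card_edges_at (hT.card_eq t ht) hvt]
    congr 1
    ext e
    simp only [mem_bipartiteBelow, mem_filter, mem_powersetCard, DiscFilling.mem_edges]
    constructor
    · rintro ⟨⟨⟨h1, _⟩, h2⟩, h3⟩; exact ⟨⟨h3, h1⟩, h2⟩
    · rintro ⟨⟨h3, h1⟩, h2⟩; exact ⟨⟨⟨h1, t, ht, h3⟩, h2⟩, h3⟩
  · intro e he
    obtain ⟨he, hve⟩ := mem_filter.1 he
    rw [← hT.card_filter_of_inner hv he hve]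
    congr 1
    ext t
    simp only [mem_bipartiteAbove, mem_filter]
    constructor
    · rintro ⟨⟨h1, _⟩, h2⟩; exact ⟨h1, h2⟩
    · rintro ⟨h1, h2⟩; exact ⟨⟨h1, h2 hve⟩, h2⟩

/-- Counting edge-triangle incidences in `S`, where the edges in `E` lie in two triangles of `S`. -/
theorem card_bd_add_le {S E : Finset (Finset W)} (hS : ∀ t ∈ S, #t = 3) (hE : E ⊆ edges S)
    (h2 : ∀ e ∈ E, #(S.filter (e ⊆ ·)) = 2) : #(bd 2 S) + 2 * #E ≤ 3 * #S := by
  have h := sum_card_bipartiteAbove_eq_sum_card_bipartiteBelow (s := edges S) (t := S)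
    (fun e t => e ⊆ t)
  have h3 : ∑ t ∈ S, #((edges S).bipartiteBelow (fun e t => e ⊆ t) t) = 3 * #S := by
    rw [sum_congr rfl (g := fun _ => 3), sum_const, smul_eq_mul, mul_comm]
    intro t ht
    have : (edges S).bipartiteBelow (fun e t => e ⊆ t) t = powersetCard 2 t := by
      ext e
      simp only [mem_bipartiteBelow, mem_powersetCard, mem_edges]
      constructor
      · rintro ⟨⟨h1, _⟩, h2⟩; exact ⟨h2, h1⟩
      · rintro ⟨h2, h1⟩; exact ⟨⟨h1, t, ht, h2⟩, h2⟩
    rw [this, card_powersetCard, hS t ht]; decide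
  have hdisj : Disjoint (bd 2 S) E := by
    rw [disjoint_left]
    intro e he he'
    have := (mem_bd.1 he).2
    rw [h2 e he'] at this
    exact absurd this (by decide)
  have h4 : ∑ e ∈ bd 2 S ∪ E, #(S.filter (e ⊆ ·)) ≤ ∑ e ∈ edges S, #(S.filter (e ⊆ ·)) :=
    sum_le_sum_of_subset (union_subset (bd_subset_edges S) hE)
  rw [sum_union hdisj, sum_congr (s₁ := E) rfl h2, sum_const, smul_eq_mul] at h4
  have h5 : #(bd 2 S) ≤ ∑ e ∈ bd 2 S, #(S.filter (e ⊆ ·)) := by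
    rw [card_eq_sum_ones]
    exact sum_le_sum fun e he => (mem_bd.1 he).2.pos
  have h6 : ∑ e ∈ edges S, #(S.filter (e ⊆ ·)) = 3 * #S := by rw [← h3, ← h]; rfl
  omega

/-- The triangles of `T` meeting a set of vertices. -/
def starOf (T : Finset (Finset W)) (I : Finset W) : Finset (Finset W) :=
  T.filter fun t => ∃ v ∈ I, v ∈ t

theorem starOf_subset (T : Finset (Finset W)) (I : Finset W) : starOf T I ⊆ T := filter_subset _ _

theorem filter_starOf {T : Finset (Finset W)} {I : Finset W} {v : W} (hv : v ∈ I) {e : Finset W}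
    (he : v ∈ e) : (starOf T I).filter (e ⊆ ·) = T.filter (e ⊆ ·) := by
  ext t
  simp only [starOf, mem_filter]
  constructor
  · rintro ⟨⟨h1, _⟩, h2⟩; exact ⟨h1, h2⟩
  · rintro ⟨h1, h2⟩; exact ⟨⟨h1, v, hv, h2 he⟩, h2⟩

theorem notMem_verts_bd_starOf {T : Finset (Finset W)} {I : Finset W} (hI : I ⊆ inner T) {v : W}
    (hv : v ∈ I) : v ∉ verts (bd 2 (starOf T I)) := by
  intro h
  obtain ⟨e, he, hve⟩ := mem_verts.1 h
  obtain ⟨h1, h2⟩ := mem_bd.1 he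
  rw [filter_starOf hv hve] at h2
  exact notMem_bd_of_inner (hI hv) hve (mem_bd.2 ⟨h1, h2⟩)

theorem card_bd_starOf {T : Finset (Finset W)} (hT : IsDisc T) {I : Finset W} (hI : I ⊆ inner T) :
    #(bd 2 (starOf T I)) + 2 * #((edges T).filter fun e => ∃ v ∈ I, v ∈ e) ≤
      3 * #(starOf T I) := by
  apply card_bd_add_le (fun t ht => hT.card_eq t (starOf_subset T I ht))
  · intro e he
    obtain ⟨he, v, hv, hve⟩ := mem_filter.1 he
    obtain ⟨h2, t, ht, het⟩ := mem_edges.1 he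
    exact mem_edges.2 ⟨h2, t, mem_filter.2 ⟨ht, v, hv, het hve⟩, het⟩
  · intro e he
    obtain ⟨he, v, hv, hve⟩ := mem_filter.1 he
    rw [filter_starOf hv hve]
    exact hT.card_filter_of_inner (hI hv) he hve

theorem Nbr.card_filter {T : Finset (Finset W)} (hT : IsDisc T) {v w : W} (hv : v ∈ inner T)
    (h : Nbr T v w) : #(T.filter fun t => v ∈ t ∧ w ∈ t) = 2 := by
  rw [← hT.card_filter_of_inner hv h.mem_edges (by simp)]
  simp only [pair_subset_iff]

theorem Nbr.card_filter_edges {T : Finset (Finset W)} {v w : W} (h : Nbr T v w) :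
    #((edges T).filter fun e => v ∈ e ∧ w ∈ e) = 1 := by
  rw [card_eq_one]
  refine ⟨{v, w}, ?_⟩
  ext e
  rw [mem_filter, mem_singleton]
  constructor
  · rintro ⟨h1, h2, h3⟩; exact pair_eq_of_mem (DiscFilling.mem_edges.1 h1).1 h2 h3 h.1
  · rintro rfl; exact ⟨h.mem_edges, by simp, by simp⟩

theorem card_filter_or_add {α : Type*} (s : Finset α) (p q : α → Prop) [DecidablePred p]
    [DecidablePred q] :
    #(s.filter fun x => p x ∨ q x) + #(s.filter fun x => p x ∧ q x) =
      #(s.filter p) + #(s.filter q) := by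
  rw [filter_or, filter_and, card_union_add_card_inter]

/-- The number of triangles and a bound for the number of boundary edges of the union of the stars of
two adjacent inner vertices. -/
theorem card_starOf_pair {T : Finset (Finset W)} (hT : IsDisc T) {v w : W} (hv : v ∈ inner T)
    (hw : w ∈ inner T) (h : Nbr T v w) :
    #(starOf T {v, w}) + 2 = deg T v + deg T w ∧
      #(bd 2 (starOf T {v, w})) + 4 ≤ deg T v + deg T w := by
  have h1 := card_filter_or_add T (v ∈ ·) (w ∈ ·)
  have h2 := card_filter_or_add (edges T) (v ∈ ·) (w ∈ ·)
  rw [h.card_filter hT hv] at h1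
  rw [h.card_filter_edges, hT.card_edges_inner hv, hT.card_edges_inner hw] at h2
  have h3 := card_bd_starOf hT (I := {v, w}) (by simp [insert_subset_iff, hv, hw])
  simp only [starOf, mem_insert, mem_singleton, exists_eq_or_imp, exists_eq_left] at h3 ⊢
  simp only [deg] at *
  omega

/-- The number of triangles and a bound for the number of boundary edges of the union of the stars
along a path `v`, `w`, `u` of inner vertices. -/
theorem card_starOf_path {T : Finset (Finset W)} (hT : IsDisc T) {v w u : W} (hv : v ∈ inner T)
    (hw : w ∈ inner T) (hu : u ∈ inner T) (h : Nbr T v w) (h' : Nbr T w u)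
    (hvu : ∀ t ∈ T, v ∈ t → u ∉ t) :
    #(starOf T {v, w, u}) + 4 = deg T v + deg T w + deg T u ∧
      #(bd 2 (starOf T {v, w, u})) + 8 ≤ deg T v + deg T w + deg T u := by
  have h1 := card_filter_or_add T (v ∈ ·) (fun t => w ∈ t ∨ u ∈ t)
  have h2 := card_filter_or_add T (w ∈ ·) (u ∈ ·)
  have h1' := card_filter_or_add (edges T) (v ∈ ·) (fun t => w ∈ t ∨ u ∈ t)
  have h2' := card_filter_or_add (edges T) (w ∈ ·) (u ∈ ·)
  have h3 : T.filter (fun t => v ∈ t ∧ (w ∈ t ∨ u ∈ t)) = T.filter fun t => v ∈ t ∧ w ∈ t := by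
    apply filter_congr
    intro t ht
    have := hvu t ht
    tauto
  have h3' : (edges T).filter (fun t => v ∈ t ∧ (w ∈ t ∨ u ∈ t)) =
      (edges T).filter fun t => v ∈ t ∧ w ∈ t := by
    apply filter_congr
    intro e he
    obtain ⟨_, t, ht, het⟩ := DiscFilling.mem_edges.1 he
    have h5 := hvu t ht
    have h6 := @het v
    have h7 := @het u
    tauto
  rw [h3, h.card_filter hT hv] at h1
  rw [h'.card_filter hT hw] at h2
  rw [h3', h.card_filter_edges, hT.card_edges_inner hv] at h1'
  rw [h'.card_filter_edges, hT.card_edges_inner hw, hT.card_edges_inner hu] at h2'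
  have h4 := card_bd_starOf hT (I := {v, w, u}) (by simp [insert_subset_iff, hv, hw, hu])
  simp only [starOf, mem_insert, mem_singleton, exists_eq_or_imp, exists_eq_left] at h4 ⊢
  simp only [deg] at *
  omega

section Extremal
variable [Infinite W] {near : V → V → Prop} {T T₀ : Finset (Finset W)} {f : W → V}

/-- The star of an inner vertex of degree `d` has `d` triangles and at most `d` boundary edges,
against `fillBound d < d` for `d ≤ 3`. -/
theorem IsExtremal.four_le_deg (hloc : IsNearLocated W near) (h : IsExtremal near T T₀ f) {v : W}
    (hv : v ∈ inner T₀) : 4 ≤ deg T₀ v := by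
  by_contra hlt
  have h1 := card_bd_starOf h.disc (I := {v}) (by simpa using hv)
  have h2 : starOf T₀ {v} = T₀.filter (v ∈ ·) := by simp [starOf]
  have h3 : (edges T₀).filter (fun e => ∃ x ∈ ({v} : Finset W), x ∈ e) =
    (edges T₀).filter (v ∈ ·) := by simp
  rw [h3, h2, h.disc.card_edges_inner hv] at h1
  rw [deg] at hlt h1
  have h4 := h.min.card_le hloc (m := #(T₀.filter (v ∈ ·))) (by omega)
    ((filter_subset _ _).trans h.subset) (S := T₀.filter (v ∈ ·)) (by omega)
  obtain ⟨t, ht, hvt⟩ := mem_verts.1 (mem_sdiff.1 hv).1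
  have h5 : 0 < #(T₀.filter (v ∈ ·)) := card_pos.2 ⟨t, mem_filter.2 ⟨ht, hvt⟩⟩
  generalize #(T₀.filter (v ∈ ·)) = d at *
  interval_cases d <;> simp [fillBound] at h4

/-- The degrees of two inner neighbours add up to at least `10`: for degree sum `s` the union of the
stars has `s - 2` triangles and at most `s - 4` boundary edges. -/
theorem IsExtremal.ten_le_of_nbr (hloc : IsNearLocated W near) (h : IsExtremal near T T₀ f)
    {v w : W} (hv : v ∈ inner T₀) (hw : w ∈ inner T₀) (hvw : Nbr T₀ v w) :
    10 ≤ deg T₀ v + deg T₀ w := by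
  by_contra hlt
  obtain ⟨h1, h2⟩ := card_starOf_pair h.disc hv hw hvw
  have h3 := h.four_le_deg hloc hv
  have h4 := h.four_le_deg hloc hw
  have h5 := h.min.card_le hloc (m := deg T₀ v + deg T₀ w - 4) (by omega)
    ((starOf_subset _ _).trans h.subset) (S := starOf T₀ {v, w}) (by omega)
  have h6 : deg T₀ v + deg T₀ w = 8 ∨ deg T₀ v + deg T₀ w = 9 := by omega
  rcases h6 with h6 | h6 <;> rw [h6] at h5 <;> simp [fillBound] at h5 <;> omega

/-- The degree sum of a path of three inner vertices is neither `14` nor `15`: the union of the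
stars would have `10` triangles and `6` boundary edges, or `11` triangles and `7` boundary edges. -/
theorem IsExtremal.path_bound (hloc : IsNearLocated W near) (h : IsExtremal near T T₀ f)
    {v w u : W} (hv : v ∈ inner T₀) (hw : w ∈ inner T₀) (hu : u ∈ inner T₀) (hvw : Nbr T₀ v w)
    (hwu : Nbr T₀ w u) (hvu : ∀ t ∈ T₀, v ∈ t → u ∉ t) :
    16 ≤ deg T₀ v + deg T₀ w + deg T₀ u ∨ deg T₀ v + deg T₀ w + deg T₀ u < 14 := by
  by_contra hlt
  obtain ⟨h1, h2⟩ := card_starOf_path h.disc hv hw hu hvw hwu hvu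
  have h5 := h.min.card_le hloc (m := deg T₀ v + deg T₀ w + deg T₀ u - 8) (by omega)
    ((starOf_subset _ _).trans h.subset) (S := starOf T₀ {v, w, u}) (by omega)
  have h6 : deg T₀ v + deg T₀ w + deg T₀ u = 14 ∨ deg T₀ v + deg T₀ w + deg T₀ u = 15 := by omega
  rcases h6 with h6 | h6 <;> rw [h6] at h5 <;> simp [fillBound] at h5 <;> omega

/-- An inner neighbour of an inner vertex of degree at most `5` has degree at least `7`. Otherwise
the degree sum is `10` or `11`, the two stars attain `fillBound`, and exchanging them for a filling
of the same area increases the number of inner vertices of degree `4`. -/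
theorem IsExtremal.seven_le_deg (hloc : IsNearLocated W near) (h : IsExtremal near T T₀ f)
    {v w : W} (hv : v ∈ inner T₀) (hw : w ∈ inner T₀) (hvw : Nbr T₀ v w) (hd : deg T₀ v ≤ 5) :
    7 ≤ deg T₀ w := by
  by_contra hlt
  obtain ⟨h1, h2⟩ := card_starOf_pair h.disc hv hw hvw
  have h3 := h.four_le_deg hloc hv
  have h4 := h.four_le_deg hloc hw
  have h10 := h.ten_le_of_nbr hloc hv hw hvw
  have hI : ({v, w} : Finset W) ⊆ inner T₀ := by simp [insert_subset_iff, hv, hw]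
  set S := starOf T₀ {v, w} with hS
  have hST : S ⊆ T₀ := starOf_subset _ _
  have hSc : fillBound (deg T₀ v + deg T₀ w - 4) ≤ #S := by
    have h6 : deg T₀ v + deg T₀ w = 10 ∨ deg T₀ v + deg T₀ w = 11 := by omega
    rcases h6 with h6 | h6 <;> rw [h6] <;> simp [fillBound] <;> omega
  -- the union of the two stars attains the bound for its boundary length, so it can be exchanged for
  -- a filling of the same area
  obtain ⟨hβ, hm⟩ := h.min.isCircuit_of_fillBound_le hloc
    (m := deg T₀ v + deg T₀ w - 4) (by omega) (by omega) (hST.trans h.subset) (by omega) hSc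
  rw [← hm] at hSc
  obtain ⟨hne, t, ht, hvt, hwt⟩ := hvw
  have hch := h.min.chordless_of_pair hloc (hST.trans h.subset) hβ (by omega) hSc
    (v := v) (w := w) (notMem_verts_bd_starOf hI (by simp)) (notMem_verts_bd_starOf hI (by simp))
    ⟨t, h.subset ht, hvt, hwt⟩ (by
      intro t ht
      obtain ⟨_, x, hx, hxt⟩ := mem_filter.1 ht
      simp only [mem_insert, mem_singleton] at hx
      rcases hx with rfl | rfl
      exacts [Or.inl hxt, Or.inr hxt])
  have hfc := h.fillCount_le hloc hST hβ (by omega) hch hSc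
  have hnbr : Nbr T₀ v w := ⟨hne, t, ht, hvt, hwt⟩
  -- a further vertex `u` of degree `4` is not adjacent to `v`, as the degree sum would be less than
  -- `10`, so `v`, `w`, `u` would be a path of degree sum `14` or `15`
  have hfour : (innerFour T₀).filter (· ∈ verts S) ⊆ {v, w} := by
    intro u hu
    obtain ⟨huf, huS⟩ := mem_filter.1 hu
    obtain ⟨hui, hu4⟩ := mem_filter.1 huf
    by_contra hne'
    simp only [mem_insert, mem_singleton, not_or] at hne'
    have hvu : ¬ Nbr T₀ v u := by
      intro hn
      have := h.ten_le_of_nbr hloc hv hui hn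
      omega
    have hvu' : ∀ t ∈ T₀, v ∈ t → u ∉ t := fun t ht h1 h2 => hvu ⟨Ne.symm hne'.1, t, ht, h1, h2⟩
    obtain ⟨t', ht', hut'⟩ := mem_verts.1 huS
    obtain ⟨htT, x, hx, hxt⟩ := mem_filter.1 ht'
    simp only [mem_insert, mem_singleton] at hx
    rcases hx with hx | hx
    · exact hvu' t' htT (hx ▸ hxt) hut'
    · have hwu : Nbr T₀ w u := ⟨Ne.symm hne'.2, t', htT, hx ▸ hxt, hut'⟩
      have := h.ten_le_of_nbr hloc hw hui hwu
      have := h.path_bound hloc hv hw hui hnbr hwu hvu'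
      omega
  -- the filling has more vertices of degree `4` than the stars, against extremality
  have hcard : #((innerFour T₀).filter (· ∈ verts S)) < fillCount #(bd 2 S) := by
    rw [hm]
    have hcase : (deg T₀ v = 4 ∧ deg T₀ w = 6) ∨ (deg T₀ v = 5 ∧ deg T₀ w = 5) ∨
        (deg T₀ v = 5 ∧ deg T₀ w = 6) := by omega
    have hin : ∀ x ∈ (innerFour T₀).filter (· ∈ verts S), deg T₀ x = 4 := fun x hx =>
      (mem_filter.1 (mem_filter.1 hx).1).2
    rcases hcase with ⟨ha, hb⟩ | hab
    · have : (innerFour T₀).filter (· ∈ verts S) ⊆ {v} := by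
        intro x hx
        have h6 := hfour hx
        simp only [mem_insert, mem_singleton] at h6 ⊢
        rcases h6 with rfl | rfl
        · rfl
        · have := hin _ hx; omega
      have := card_le_card this
      rw [ha, hb]
      simp only [card_singleton] at this
      simp only [fillCount]; omega
    · have : (innerFour T₀).filter (· ∈ verts S) = ∅ := by
        rw [eq_empty_iff_forall_notMem]
        intro x hx
        have h6 := hfour hx
        have h7 := hin x hx
        simp only [mem_insert, mem_singleton] at h6
        rcases h6 with rfl | rfl <;> omega
      rw [this]
      rcases hab with ⟨ha, hb⟩ | ⟨ha, hb⟩ <;> rw [ha, hb] <;> simp [fillCount]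
  omega

/-- An inner vertex of degree `7` has at most one inner neighbour of degree `4`. -/
theorem IsExtremal.eq_of_nbr_seven (hloc : IsNearLocated W near) (h : IsExtremal near T T₀ f)
    {v w u : W} (hv : v ∈ innerFour T₀) (hw : w ∈ inner T₀) (hu : u ∈ innerFour T₀)
    (hvw : Nbr T₀ w v) (hwu : Nbr T₀ w u) (hd : deg T₀ w = 7) : v = u := by
  obtain ⟨hv, hv4⟩ := mem_filter.1 hv
  obtain ⟨hu, hu4⟩ := mem_filter.1 hu
  by_contra hne
  have := h.path_bound hloc hv hw hu hvw.symm hwu (fun t ht h1 h2 => by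
    have := h.ten_le_of_nbr hloc hv hu ⟨hne, t, ht, h1, h2⟩
    omega)
  omega

end Extremal

end

section
/-! ### The Euler characteristic -/

variable {W : Type*}

/-- The indicator function of `p`, as a chain on `S` with coefficients mod `2`. -/
def ind {α : Type*} (S p : Finset α) : S → ZMod 2 := fun s => if s.1 ∈ p then 1 else 0

/-- The linear map given by an incidence relation between two finite sets. -/
def inc {α β : Type*} (r : α → β → Prop) [∀ a, DecidablePred (r a)] (R : Finset α) (S : Finset β) :
    (S → ZMod 2) →ₗ[ZMod 2] (R → ZMod 2) where
  toFun x a := ∑ s : S, if r a.1 s.1 then x s else 0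
  map_add' x y := by
    ext a
    simp only [Pi.add_apply, ← sum_add_distrib]
    exact sum_congr rfl fun s _ => by split_ifs <;> simp
  map_smul' c x := by
    ext a
    simp only [Pi.smul_apply, smul_eq_mul, RingHom.id_apply, mul_sum]
    exact sum_congr rfl fun s _ => by split_ifs <;> simp

theorem inc_ind {α β : Type*} (r : α → β → Prop) [∀ a, DecidablePred (r a)] (R : Finset α)
    (S : Finset β) {p : Finset β}
    (hp : p ⊆ S) (a : R) : inc r R S (ind S p) a = (#(p.filter (r a.1)) : ZMod 2) := by
  have h1 : inc r R S (ind S p) a = ∑ s ∈ S, if r a.1 s ∧ s ∈ p then (1 : ZMod 2) else 0 := by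
    rw [← sum_coe_sort]
    refine sum_congr rfl fun s _ => ?_
    simp only [ind]
    by_cases h1 : r a.1 s.1 <;> by_cases h2 : s.1 ∈ p <;> simp [h1, h2]
  rw [h1, ← sum_filter, sum_const, nsmul_eq_mul, mul_one]
  congr 2
  ext s
  simp only [mem_filter]
  constructor
  · rintro ⟨_, h1, h2⟩; exact ⟨h2, h1⟩
  · rintro ⟨h2, h1⟩; exact ⟨hp h2, h1, h2⟩

theorem exists_eq_ind {α : Type*} (S : Finset α) (x : S → ZMod 2) : ∃ p ⊆ S, x = ind S p := by
  refine ⟨S.filter fun s => ∃ h : s ∈ S, x ⟨s, h⟩ = 1, filter_subset _ _, ?_⟩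
  ext s
  have h01 : ∀ a : ZMod 2, a = 0 ∨ a = 1 := by decide
  rcases h01 (x s) with h | h
  · have : ¬ (s.1 ∈ S.filter fun s => ∃ h : s ∈ S, x ⟨s, h⟩ = 1) := by
      rw [mem_filter]; rintro ⟨_, _, h'⟩
      rw [show x ⟨s.1, _⟩ = x s from rfl, h] at h'
      exact absurd h' (by decide)
    simp only [ind, if_neg this, h]
  · have : s.1 ∈ S.filter fun s => ∃ h : s ∈ S, x ⟨s, h⟩ = 1 :=
      mem_filter.2 ⟨s.2, s.2, h⟩
    simp only [ind, if_pos this, h]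

theorem ind_injOn {α : Type*} {S p q : Finset α} (hp : p ⊆ S) (hq : q ⊆ S)
    (h : ind S p = ind S q) : p = q := by
  ext s
  by_cases hs : s ∈ S
  · have := congrFun h ⟨s, hs⟩
    simp only [ind] at this
    by_cases h1 : s ∈ p <;> by_cases h2 : s ∈ q <;> simp_all
  · exact iff_of_false (fun h => hs (hp h)) (fun h => hs (hq h))

theorem natCast_eq_ite (n : ℕ) : (n : ZMod 2) = if Odd n then 1 else 0 := by
  split_ifs with h
  · obtain ⟨k, rfl⟩ := h
    push_cast
    rw [show (2 : ZMod 2) = 0 by decide]; simp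
  · exact (ZMod.natCast_eq_zero_iff_even).2 (Nat.not_odd_iff_even.1 h)

/-- The incidence map from edges to vertices is the boundary operator `bd 1`. -/
theorem inc_mem_eq_zero {A : Finset W} {E p : Finset (Finset W)} (hp : p ⊆ E)
    (hE : ∀ e ∈ E, e ⊆ A) : inc (fun v e => v ∈ e) A E (ind E p) = 0 ↔ bd 1 p = ∅ := by
  constructor
  · intro h
    rw [eq_empty_iff_forall_notMem]
    intro s hs
    obtain ⟨h1, h2⟩ := mem_bd.1 hs
    obtain ⟨v, rfl⟩ := card_eq_one.1 h1
    simp only [singleton_subset_iff] at h2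
    obtain ⟨e, he⟩ := card_pos.1 h2.pos
    rw [mem_filter] at he
    have := congrFun h ⟨v, hE e (hp he.1) he.2⟩
    rw [inc_ind _ _ _ hp, natCast_eq_ite, if_pos h2] at this
    simp at this
  · intro h
    ext v
    rw [inc_ind _ _ _ hp, natCast_eq_ite, if_neg, Pi.zero_apply]
    intro ho
    have : ({v.1} : Finset W) ∈ bd 1 p := mem_bd.2 ⟨by simp, by simpa using ho⟩
    rw [h] at this
    simp at this

/-- The incidence map from triangles to edges is the boundary operator `bd 2`. -/
theorem inc_subset_eq {E F S z : Finset (Finset W)} (hS : S ⊆ F) (hz : z ⊆ E)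
    (hE : ∀ e ∈ E, #e = 2) (hF : edges F ⊆ E) :
    inc (fun e t => e ⊆ t) E F (ind F S) = ind E z ↔ bd 2 S = z := by
  have : inc (fun e t => e ⊆ t) E F (ind F S) = ind E (bd 2 S) := by
    ext e
    rw [inc_ind _ _ _ hS, natCast_eq_ite, ind]
    simp only [mem_bd, hE e.1 e.2, true_and]
  rw [this]
  exact ⟨fun h => ind_injOn ((bd_subset_edges S).trans ((edges_mono hS).trans hF)) hz h,
    fun h => by rw [h]⟩

theorem finrank_chain {α : Type*} (S : Finset α) : Module.finrank (ZMod 2) (S → ZMod 2) = #S := by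
  rw [Module.finrank_fintype_fun_eq_card, Fintype.card_coe]

/-- If all mod `2` cycles of a finite `2`-complex bound, its Euler characteristic is at least the
number of values of any vertex labelling that is constant along edges. -/
theorem card_image_le_euler {κ : Type*} [DecidableEq κ] {A : Finset W} {E F : Finset (Finset W)} (ℓ : W → κ)
    (hE : ∀ e ∈ E, #e = 2 ∧ e ⊆ A) (hℓ : ∀ e ∈ E, ∀ x ∈ e, ∀ y ∈ e, ℓ x = ℓ y)
    (hF : edges F ⊆ E) (hac : ∀ z ⊆ E, bd 1 z = ∅ → ∃ S ⊆ F, bd 2 S = z) :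
    #(A.image ℓ) + #E ≤ #A + #F := by
  set d₁ := inc (fun v e => v ∈ e) A E
  set d₂ := inc (fun e t => e ⊆ t) E F
  set L := inc (fun k v => ℓ v = k) (A.image ℓ) A
  -- `L` sums a `0`-chain over the fibres of `ℓ`; it is surjective and kills boundaries, so the rank
  -- of `d₁` is at most `#A` minus the number of labels
  have hker : LinearMap.ker d₁ ≤ LinearMap.range d₂ := by
    intro x hx
    obtain ⟨p, hp, rfl⟩ := exists_eq_ind E x
    rw [LinearMap.mem_ker, inc_mem_eq_zero hp fun e he => (hE e he).2] at hx
    obtain ⟨S, hS, hSp⟩ := hac p hp hx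
    exact ⟨ind F S, (inc_subset_eq hS hp (fun e he => (hE e he).1) hF).2 hSp⟩
  have hL : LinearMap.range d₁ ≤ LinearMap.ker L := by
    rintro _ ⟨x, rfl⟩
    rw [LinearMap.mem_ker]
    ext k
    have h1 : L (d₁ x) k = ∑ e : E, ∑ v ∈ A, if ℓ v = k.1 ∧ v ∈ e.1 then x e else 0 := by
      rw [sum_comm, ← sum_coe_sort]
      refine sum_congr rfl fun v _ => ?_
      by_cases hv : ℓ v.1 = k.1
      · simp only [hv, if_true, true_and]; rfl
      · simp [hv]
    rw [h1, Pi.zero_apply]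
    refine sum_eq_zero fun e _ => ?_
    rw [← sum_filter, sum_const, nsmul_eq_mul, natCast_eq_ite, if_neg, zero_mul]
    by_cases hk : ∃ v ∈ e.1, ℓ v = k.1
    · obtain ⟨v, hv, hvk⟩ := hk
      have : A.filter (fun v => ℓ v = k.1 ∧ v ∈ e.1) = e.1 := by
        ext u
        rw [mem_filter]
        exact ⟨fun h => h.2.2, fun h => ⟨(hE e.1 e.2).2 h, (hℓ e.1 e.2 u h v hv).trans hvk, h⟩⟩
      rw [this, (hE e.1 e.2).1]; decide
    · rw [filter_eq_empty_iff.2 fun v _ h => hk ⟨v, h.2, h.1⟩]; simp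
  have hLs : LinearMap.range L = ⊤ := by
    rw [LinearMap.range_eq_top]
    intro y
    have hsec : ∀ k : A.image ℓ, ∃ v ∈ A, ℓ v = k.1 := fun k => by
      obtain ⟨v, hv, h⟩ := mem_image.1 k.2; exact ⟨v, hv, h⟩
    choose s hsA hs using hsec
    refine ⟨fun v => if s ⟨ℓ v.1, mem_image_of_mem ℓ v.2⟩ = v.1 then
      y ⟨ℓ v.1, mem_image_of_mem ℓ v.2⟩ else 0, ?_⟩
    ext k
    refine (sum_eq_single (⟨s k, hsA k⟩ : A) ?_ ?_).trans ?_
    · intro v _ hv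
      by_cases h : ℓ v.1 = k.1
      · have h2 : (⟨ℓ v.1, mem_image_of_mem ℓ v.2⟩ : A.image ℓ) = k := Subtype.ext h
        have h3 : s ⟨ℓ v.1, mem_image_of_mem ℓ v.2⟩ ≠ v.1 := by
          rw [h2]
          intro h3
          exact hv (Subtype.ext h3.symm)
        exact (if_pos h).trans (if_neg h3)
      · rw [if_neg h]
    · intro h; exact absurd (mem_univ _) h
    · have h2 : (⟨ℓ (s k), mem_image_of_mem ℓ (hsA k)⟩ : A.image ℓ) = k := Subtype.ext (hs k)
      have h3 : s ⟨ℓ (s k), mem_image_of_mem ℓ (hsA k)⟩ = s k := by rw [h2]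
      exact (if_pos (hs k)).trans ((if_pos h3).trans (by rw [h2]))
  have e1 := LinearMap.finrank_range_add_finrank_ker d₁
  have e2 := LinearMap.finrank_range_add_finrank_ker d₂
  have e3 := LinearMap.finrank_range_add_finrank_ker L
  have e4 := Submodule.finrank_mono hker
  have e5 := Submodule.finrank_mono hL
  rw [hLs, finrank_top] at e3
  rw [finrank_chain] at e1 e2 e3
  rw [finrank_chain] at e3
  omega

/-- A connected `2`-complex without nonzero mod `2` cycles of triangles has Euler characteristic at
most `1`, and if it is equal to `1` then every mod `2` cycle of edges bounds. -/
theorem euler_of_connected {A : Finset W} {E F : Finset (Finset W)}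
    (hE : ∀ e ∈ E, #e = 2 ∧ e ⊆ A) (hF : edges F ⊆ E) (hF3 : ∀ t ∈ F, #t = 3)
    (hconn : ∃ r ∈ A, ∀ v ∈ A, ∃ p ⊆ E, bd 1 p = {{v}} ∆ {{r}})
    (hinj : ∀ S ⊆ F, bd 2 S = ∅ → S = ∅) :
    #A + #F ≤ #E + 1 ∧
      (#A + #F = #E + 1 → ∀ z ⊆ E, bd 1 z = ∅ → ∃ S ⊆ F, bd 2 S = z) := by
  set d₁ := inc (fun v e => v ∈ e) A E with hd₁
  set d₂ := inc (fun e t => e ⊆ t) E F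
  have hE2 : ∀ e ∈ E, #e = 2 := fun e he => (hE e he).1
  have hle : LinearMap.range d₂ ≤ LinearMap.ker d₁ := by
    rintro _ ⟨x, rfl⟩
    obtain ⟨S, hS, rfl⟩ := exists_eq_ind F x
    have hb : bd 2 S ⊆ E := (bd_subset_edges S).trans ((edges_mono hS).trans hF)
    rw [(inc_subset_eq hS hb hE2 hF).2 rfl, LinearMap.mem_ker,
      inc_mem_eq_zero hb fun e he => (hE e he).2]
    exact bd_one_bd_two fun t ht => hF3 t (hS ht)
  have hker : LinearMap.ker d₂ = ⊥ := by
    rw [LinearMap.ker_eq_bot']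
    intro x hx
    obtain ⟨S, hS, rfl⟩ := exists_eq_ind F x
    have h0 : (0 : E → ZMod 2) = ind E ∅ := by ext; simp [ind]
    rw [h0, inc_subset_eq hS (empty_subset _) hE2 hF] at hx
    rw [hinj S hS hx]
    ext; simp [ind]
  obtain ⟨r, hr, hp⟩ := hconn
  -- up to boundaries every `0`-chain is a multiple of the vertex `r`, so `d₁` has rank at least
  -- `#A - 1`, while `d₂` is injective
  have htop : LinearMap.range d₁ ⊔ Submodule.span (ZMod 2) {ind A {r}} = ⊤ := by
    rw [eq_top_iff]
    intro x _
    have hx : x = ∑ v : A, x v • ind A {v.1} := by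
      ext u
      rw [Finset.sum_apply, sum_eq_single u]
      · simp [ind]
      · intro v _ hv
        have : u.1 ≠ v.1 := fun h => hv (Subtype.ext h.symm)
        simp [ind, this]
      · intro h; exact absurd (mem_univ _) h
    rw [hx]
    refine Submodule.sum_mem _ fun v _ => Submodule.smul_mem _ _ ?_
    obtain ⟨p, hpE, hpb⟩ := hp v.1 v.2
    have hxor : ∀ P Q : Prop, (if P then (1 : ZMod 2) else 0) =
        (if (P ∧ ¬ Q) ∨ (Q ∧ ¬ P) then 1 else 0) + if Q then 1 else 0 := by
      intro P Q
      by_cases hP : P <;> by_cases hQ : Q <;> simp [hP, hQ]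
      decide
    have h1 : ind A {v.1} = d₁ (ind E p) + ind A {r} := by
      ext u
      have h2 : Odd #(p.filter fun e => u.1 ∈ e) ↔ ({u.1} : Finset W) ∈ bd 1 p := by
        rw [mem_bd]; simp
      rw [hpb, mem_symmDiff, mem_singleton, mem_singleton, singleton_inj, singleton_inj] at h2
      rw [Pi.add_apply, hd₁, inc_ind _ _ _ hpE, natCast_eq_ite]
      simp only [h2, mem_singleton, ind]
      exact hxor _ _
    rw [h1]
    exact Submodule.add_mem_sup ⟨_, rfl⟩ (Submodule.mem_span_singleton_self _)
  have e1 := LinearMap.finrank_range_add_finrank_ker d₁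
  have e2 := LinearMap.finrank_range_add_finrank_ker d₂
  have e3 := Submodule.finrank_add_le_finrank_add_finrank (LinearMap.range d₁)
    (Submodule.span (ZMod 2) {ind A {r}})
  have e4 := Submodule.finrank_mono hle
  have e5 : Module.finrank (ZMod 2) (Submodule.span (ZMod 2) {ind A {r}}) ≤ 1 :=
    (finrank_span_le_card _).trans (by simp)
  rw [htop, finrank_top] at e3
  rw [hker, finrank_bot] at e2
  rw [finrank_chain] at e1 e2 e3
  refine ⟨by omega, fun heq z hz hz0 => ?_⟩
  have hEq : LinearMap.range d₂ = LinearMap.ker d₁ :=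
    Submodule.eq_of_le_of_finrank_le hle (by omega)
  have hzk : ind E z ∈ LinearMap.ker d₁ := by
    rw [LinearMap.mem_ker, inc_mem_eq_zero hz fun e he => (hE e he).2]; exact hz0
  rw [← hEq] at hzk
  obtain ⟨x, hx⟩ := hzk
  obtain ⟨S, hS, rfl⟩ := exists_eq_ind F x
  exact ⟨S, hS, (inc_subset_eq hS hz hE2 hF).1 hx⟩

theorem edges_subset_verts {T : Finset (Finset W)} {e : Finset W} (he : e ∈ edges T) :
    e ⊆ verts T := by
  obtain ⟨_, t, ht, het⟩ := mem_edges.1 he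
  exact fun v hv => mem_verts.2 ⟨t, ht, het hv⟩

/-- Any two vertices of a disc are joined by an edge path. -/
theorem exists_path_of_conn {T : Finset (Finset W)}
    (hconn : ∀ S ⊆ T, S.Nonempty →
      (∀ t ∈ S, ∀ t' ∈ T, ∀ e : Finset W, e.card = 2 → e ⊆ t → e ⊆ t' → t' ∈ S) → S = T)
    {r : W} (hr : r ∈ verts T) : ∀ v ∈ verts T, ∃ p ⊆ edges T, bd 1 p = {{v}} ∆ {{r}} := by
  let R : W → Prop := fun v => ∃ p ⊆ edges T, bd 1 p = {{v}} ∆ {{r}}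
  have hstep : ∀ t ∈ T, ∀ x ∈ t, ∀ y ∈ t, R x → R y := by
    rintro t ht x hx y hy ⟨p, hp, hpb⟩
    by_cases hxy : x = y
    · subst hxy; exact ⟨p, hp, hpb⟩
    refine ⟨{{y, x}} ∆ p, symmDiff_subset_of ?_ hp, ?_⟩
    · rw [singleton_subset_iff, mem_edges]
      exact ⟨card_pair (Ne.symm hxy), t, ht, by simp [insert_subset_iff, hx, hy]⟩
    · rw [bd_symmDiff, hpb, bd_one_edge rfl (Ne.symm hxy)]
      exact symmDiff_cancel _ _ _
  obtain ⟨t₀, ht₀, hrt₀⟩ := mem_verts.1 hr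
  have hS := hconn (T.filter fun t => ∃ x ∈ t, R x) (filter_subset _ _)
    ⟨t₀, mem_filter.2 ⟨ht₀, r, hrt₀, ∅, empty_subset _, by simp⟩⟩ (by
      intro t ht t' ht' e he het het'
      obtain ⟨ht, x, hx, hxR⟩ := mem_filter.1 ht
      obtain ⟨y, hy⟩ := card_pos.1 (by omega : 0 < #e)
      exact mem_filter.2 ⟨ht', y, het' hy, hstep t ht x hx y (het hy) hxR⟩)
  intro v hv
  obtain ⟨t, ht, hvt⟩ := mem_verts.1 hv
  rw [← hS] at ht
  obtain ⟨ht, x, hx, hxR⟩ := mem_filter.1 ht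
  exact hstep t ht x hx v hvt hxR

theorem IsDisc.verts_nonempty {T : Finset (Finset W)} (hT : IsDisc T) : (verts T).Nonempty := by
  obtain ⟨e, he⟩ := hT.bd_nonempty
  obtain ⟨t, ht, -⟩ := exists_of_mem_bd he
  obtain ⟨v, hv⟩ := card_pos.1 (by rw [hT.card_eq t ht]; norm_num : 0 < #t)
  exact ⟨v, mem_verts.2 ⟨t, ht, hv⟩⟩

/-- Euler's formula for discs. -/
theorem IsDisc.euler {T : Finset (Finset W)} (hT : IsDisc T) :
    #(verts T) + #T = #(edges T) + 1 := by
  obtain ⟨r, hr⟩ := hT.verts_nonempty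
  have hE : ∀ e ∈ edges T, #e = 2 ∧ e ⊆ verts T := fun e he =>
    ⟨(mem_edges.1 he).1, edges_subset_verts he⟩
  have h1 := (euler_of_connected hE Subset.rfl hT.card_eq
    ⟨r, hr, exists_path_of_conn hT.eq_of_closed hr⟩ fun S hS h => hT.eq_empty hS h).1
  have h2 := card_image_le_euler (fun _ : W => ()) hE (fun _ _ _ _ _ _ => rfl) Subset.rfl
    hT.acyclic
  have h3 : 0 < #((verts T).image fun _ : W => ()) := card_pos.2 ⟨(), mem_image.2 ⟨r, hr, rfl⟩⟩
  omega

end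

section
/-! ### Tame discs and layers -/

variable {W : Type*}

/-- The neighbours of a vertex. -/
def nbrs (T : Finset (Finset W)) (v : W) : Finset W := (verts T).filter (Nbr T v ·)

theorem mem_nbrs {T : Finset (Finset W)} {v w : W} : w ∈ nbrs T v ↔ Nbr T v w := by
  rw [nbrs, mem_filter]
  constructor
  · exact fun h => h.2
  · rintro ⟨h, t, ht, hv, hw⟩
    exact ⟨mem_verts.2 ⟨t, ht, hw⟩, h, t, ht, hv, hw⟩

theorem sum_deg (𝒰 : Finset (Finset W)) (B : Finset W) :
    ∑ v ∈ B, deg 𝒰 v = ∑ t ∈ 𝒰, #(t ∩ B) := by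
  have h := sum_card_bipartiteAbove_eq_sum_card_bipartiteBelow (s := B) (t := 𝒰) (fun v t => v ∈ t)
  rw [show ∑ v ∈ B, deg 𝒰 v = ∑ v ∈ B, #(𝒰.bipartiteAbove (fun v t => v ∈ t) v) from rfl, h]
  refine sum_congr rfl fun t _ => ?_
  congr 1
  ext v
  simp [and_comm]

theorem sum_card_eq {α : Type*} (s : Finset α) (c : α → ℕ) (h : ∀ a ∈ s, c a ≤ 3) :
    ∑ a ∈ s, c a = #(s.filter (c · = 1)) + 2 * #(s.filter (c · = 2)) +
      3 * #(s.filter (c · = 3)) := by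
  simp only [card_filter, mul_sum, ← sum_add_distrib]
  refine sum_congr rfl fun a ha => ?_
  have := h a ha
  interval_cases c a <;> simp

/-- The members of `T` with exactly `k` vertices in `A`. -/
def lay (T : Finset (Finset W)) (A : Finset W) (k : ℕ) : Finset (Finset W) :=
  T.filter fun t => #(t ∩ A) = k

theorem mem_lay {T : Finset (Finset W)} {A : Finset W} {k : ℕ} {t : Finset W} :
    t ∈ lay T A k ↔ t ∈ T ∧ #(t ∩ A) = k := mem_filter

theorem deg_lay (T : Finset (Finset W)) (A : Finset W) (k : ℕ) (v : W) :
    deg (lay T A k) v = #((T.filter (v ∈ ·)).filter fun t => #(t ∩ A) = k) := by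
  rw [deg, lay, filter_comm]

theorem card_inter_le_three {T : Finset (Finset W)} (hT : ∀ t ∈ T, #t = 3) {t : Finset W}
    (ht : t ∈ T) (A : Finset W) : #(t ∩ A) ≤ 3 := (card_le_card inter_subset_left).trans (hT t ht).le

/-- Counting the neighbours of an inner vertex `v` in a set `B` by the triangles at `v`. -/
theorem IsDisc.two_mul_card_nbrs_inter {T : Finset (Finset W)} (hT : IsDisc T) {v : W}
    (hv : v ∈ inner T) {B : Finset W} (hB : v ∉ B) :
    2 * #(nbrs T v ∩ B) = deg (lay T B 1) v + 2 * deg (lay T B 2) v := by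
  have h := sum_card_bipartiteAbove_eq_sum_card_bipartiteBelow (s := nbrs T v ∩ B)
    (t := T.filter (v ∈ ·)) (fun w t => w ∈ t)
  rw [sum_congr rfl (g := fun _ => 2), sum_congr (s₁ := T.filter (v ∈ ·)) rfl
    (g := fun t => #(t ∩ B)), sum_const, smul_eq_mul, mul_comm] at h
  · rw [h, sum_card_eq _ _ fun t ht => card_inter_le_three hT.card_eq (mem_filter.1 ht).1 B,
      ← deg_lay, ← deg_lay]
    have : ((T.filter (v ∈ ·)).filter fun t => #(t ∩ B) = 3) = ∅ := by
      rw [filter_eq_empty_iff]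
      intro t ht h3
      obtain ⟨ht, hvt⟩ := mem_filter.1 ht
      have := eq_of_subset_of_card_le (inter_subset_left : t ∩ B ⊆ t) (by rw [hT.card_eq t ht, h3])
      rw [← this] at hvt
      exact hB (mem_inter.1 hvt).2
    rw [this]; simp
  · intro t ht
    obtain ⟨ht, hvt⟩ := mem_filter.1 ht
    congr 1
    ext w
    simp only [mem_bipartiteBelow, mem_inter, mem_nbrs]
    constructor
    · rintro ⟨⟨_, h1⟩, h2⟩; exact ⟨h2, h1⟩
    · rintro ⟨h2, h1⟩
      exact ⟨⟨⟨fun h => hB (h ▸ h1), t, ht, hvt, h2⟩, h1⟩, h2⟩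
  · intro w hw
    rw [mem_inter, mem_nbrs] at hw
    rw [← hw.1.card_filter hT hv]
    congr 1
    ext t
    simp only [mem_bipartiteAbove, mem_filter, and_assoc]

theorem IsDisc.card_nbrs {T : Finset (Finset W)} (hT : IsDisc T) {v : W}
    (hv : v ∈ inner T) : #(nbrs T v) = deg T v := by
  have h := hT.two_mul_card_nbrs_inter hv (B := (verts T).erase v) (by simp)
  have h1 : nbrs T v ∩ (verts T).erase v = nbrs T v := by
    rw [inter_eq_left]
    intro w hw
    exact mem_erase.2 ⟨(mem_nbrs.1 hw).1.symm, (mem_filter.1 hw).1⟩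
  have h2 : ∀ t ∈ T, v ∈ t → #(t ∩ (verts T).erase v) = 2 := by
    intro t ht hvt
    have : t ∩ (verts T).erase v = t.erase v := by
      ext w
      simp only [mem_inter, mem_erase]
      constructor
      · rintro ⟨h1, h2, _⟩; exact ⟨h2, h1⟩
      · rintro ⟨h2, h1⟩; exact ⟨h1, h2, mem_verts.2 ⟨t, ht, h1⟩⟩
    rw [this, card_erase_of_mem hvt, hT.card_eq t ht]
  rw [h1, deg_lay, deg_lay, filter_eq_empty_iff.2, filter_true_of_mem] at h
  · rw [deg]; simp at h; omega
  · intro t ht; exact h2 t (mem_filter.1 ht).1 (mem_filter.1 ht).2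
  · intro t ht; rw [h2 t (mem_filter.1 ht).1 (mem_filter.1 ht).2]; decide

/-- If no triangle at `v` has exactly one vertex in `B`, the link of `v` lies inside `B` or
outside `B`, by connectedness. -/
theorem IsDisc.nbr_mem_of_deg_lay_eq_zero {T : Finset (Finset W)} (hT : IsDisc T) {v : W}
    {B : Finset W} (hB : v ∉ B) (h0 : deg (lay T B 1) v = 0) {w : W} (hw : Nbr T v w)
    (hwB : w ∈ B) {u : W} (hu : Nbr T v u) : u ∈ B := by
  have hno : ∀ t ∈ T, v ∈ t → #(t ∩ B) ≠ 1 := by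
    intro t ht hvt h1
    rw [deg_lay, card_eq_zero, filter_eq_empty_iff] at h0
    exact h0 (mem_filter.2 ⟨ht, hvt⟩) h1
  have hall : ∀ t ∈ T, v ∈ t → ∀ x ∈ t, x ∈ B → ∀ y ∈ t, y ≠ v → y ∈ B := by
    intro t ht hvt x hx hxB y hy hyv
    have h1 : t ∩ B ⊆ t.erase v := fun a ha =>
      mem_erase.2 ⟨fun h => hB (h ▸ (mem_inter.1 ha).2), (mem_inter.1 ha).1⟩
    have h2 : #(t.erase v) = 2 := by rw [card_erase_of_mem hvt, hT.card_eq t ht]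
    have h3 : 0 < #(t ∩ B) := card_pos.2 ⟨x, mem_inter.2 ⟨hx, hxB⟩⟩
    have h4 := hno t ht hvt
    have h5 := eq_of_subset_of_card_le h1 (by omega)
    have : y ∈ t ∩ B := by rw [h5]; exact mem_erase.2 ⟨hyv, hy⟩
    exact (mem_inter.1 this).2
  obtain ⟨hvw, t₀, ht₀, hvt₀, hwt₀⟩ := hw
  obtain ⟨hvu, t₁, ht₁, hvt₁, hut₁⟩ := hu
  have := hT.conn {v} (by simp) (T.filter fun t => v ∈ t ∧ ∃ x ∈ t, x ∈ B) (filter_subset _ _)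
    ⟨t₀, mem_filter.2 ⟨ht₀, hvt₀, w, hwt₀, hwB⟩, by simpa using hvt₀⟩ (by
      intro t ht t' ht' e he hve het het'
      obtain ⟨ht, hvt, x, hx, hxB⟩ := mem_filter.1 ht
      obtain ⟨y, hvy, rfl⟩ := exists_pair_of_mem he (singleton_subset_iff.1 hve)
      rw [pair_subset_iff] at het het'
      exact mem_filter.2 ⟨ht', het'.1, y, het'.2, hall t ht hvt x hx hxB y het.2 hvy.symm⟩)
    t₁ ht₁ (by simpa using hvt₁)
  obtain ⟨_, _, x, hx, hxB⟩ := mem_filter.1 this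
  exact hall t₁ ht₁ hvt₁ x hx hxB u hut₁ hvu.symm

/-- A disc satisfying the local conditions on the degrees of the inner vertices on which the counting
argument rests: the degree is at least `4`, the inner neighbours of a vertex of degree at most `5`
have degree at least `7`, and a vertex of degree `7` has at most one inner neighbour of degree
`4`. -/
structure IsTame (T : Finset (Finset W)) : Prop where
  disc : IsDisc T
  four_le : ∀ v ∈ inner T, 4 ≤ deg T v
  seven_le : ∀ v ∈ inner T, ∀ w ∈ inner T, Nbr T v w → deg T v ≤ 5 → 7 ≤ deg T w
  eq_of_nbr : ∀ v ∈ innerFour T, ∀ w ∈ inner T, ∀ u ∈ innerFour T, Nbr T w v → Nbr T w u →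
    deg T w = 7 → v = u

theorem IsExtremal.isTame {V : Type*} [Infinite W] {near : V → V → Prop} {T T₀ : Finset (Finset W)}
    {f : W → V} (hloc : IsNearLocated W near) (h : IsExtremal near T T₀ f) : IsTame T₀ :=
  ⟨h.disc, fun _ hv => h.four_le_deg hloc hv, fun _ hv _ hw => h.seven_le_deg hloc hv hw,
    fun _ hv _ hw _ hu => h.eq_of_nbr_seven hloc hv hw hu⟩

/-- A triangle has at most one inner vertex of degree at most `5`. -/
theorem IsTame.sum_deg_le {T : Finset (Finset W)} (hT : IsTame T) {B : Finset W}
    (hB : ∀ v ∈ B, v ∈ inner T ∧ deg T v ≤ 5) {𝒰 : Finset (Finset W)} (h𝒰 : 𝒰 ⊆ T) :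
    ∑ v ∈ B, deg 𝒰 v ≤ #𝒰 := by
  rw [sum_deg, card_eq_sum_ones]
  refine sum_le_sum fun t ht => ?_
  rw [card_le_one]
  intro x hx y hy
  rw [mem_inter] at hx hy
  by_contra hxy
  have h1 := hT.seven_le x (hB x hx.2).1 y (hB y hy.2).1 ⟨hxy, t, h𝒰 ht, hx.1, hy.1⟩ (hB x hx.2).2
  have := (hB y hy.2).2
  omega

/-- `A` and `A'` behave like the sets of vertices at distance at least `j` and at least `j + 1` from
the boundary, for some `j ≥ 1`. The difference `A \ A'` is called the bottom level of the layer `A`,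
and vertices outside `A` are said to lie below. -/
structure IsLayer (T : Finset (Finset W)) (A A' : Finset W) : Prop where
  subset_inner : A ⊆ inner T
  subset : A' ⊆ A
  nbr_mem : ∀ v ∈ A', ∀ w, Nbr T v w → w ∈ A
  exists_nbr : ∀ v ∈ A, v ∉ A' → ∃ w, Nbr T v w ∧ w ∉ A
  acyclic : ∀ z ⊆ (edges T).filter (· ⊆ A), bd 1 z = ∅ → ∃ S ⊆ T.filter (· ⊆ A), bd 2 S = z

/-- Twice the Euler characteristic of the full subcomplex on a set of inner vertices. -/
def eul (T : Finset (Finset W)) (A : Finset W) : ℤ := 2 * #A - #(lay T A 3) - #(lay T A 2)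

theorem lay_three {T : Finset (Finset W)} (hT : ∀ t ∈ T, #t = 3) (A : Finset W) :
    lay T A 3 = T.filter (· ⊆ A) := by
  apply filter_congr
  intro t ht
  rw [← hT t ht]
  constructor
  · intro h
    exact inter_eq_left.1 (eq_of_subset_of_card_le inter_subset_left h.ge)
  · intro h; rw [inter_eq_left.2 h]

/-- Every edge inside a set of inner vertices lies in two triangles, which have two or three vertices
in the set. -/
theorem IsDisc.two_mul_card_edges_filter {T : Finset (Finset W)} (hT : IsDisc T) {A : Finset W}
    (hA : A ⊆ inner T) :
    2 * #((edges T).filter (· ⊆ A)) = 3 * #(lay T A 3) + #(lay T A 2) := by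
  have h := sum_card_bipartiteAbove_eq_sum_card_bipartiteBelow (s := (edges T).filter (· ⊆ A))
    (t := T) (fun e t => e ⊆ t)
  rw [sum_congr rfl (g := fun _ => 2), sum_congr (s₁ := T) rfl
    (g := fun t => (#(t ∩ A)).choose 2), sum_const, smul_eq_mul, mul_comm] at h
  · rw [h]
    simp only [lay, card_filter, mul_sum, ← sum_add_distrib]
    refine sum_congr rfl fun t ht => ?_
    have := card_inter_le_three hT.card_eq ht A
    interval_cases #(t ∩ A) <;> simp
  · intro t ht
    rw [← card_powersetCard]
    congr 1
    ext e
    simp only [mem_bipartiteBelow, mem_filter, mem_powersetCard, subset_inter_iff,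
      DiscFilling.mem_edges]
    constructor
    · rintro ⟨⟨⟨h1, _⟩, h2⟩, h3⟩; exact ⟨⟨h3, h2⟩, h1⟩
    · rintro ⟨⟨h3, h2⟩, h1⟩; exact ⟨⟨⟨h1, t, ht, h3⟩, h2⟩, h3⟩
  · intro e he
    obtain ⟨he, heA⟩ := mem_filter.1 he
    obtain ⟨v, hv⟩ := card_pos.1 (by rw [(DiscFilling.mem_edges.1 he).1]; norm_num : 0 < #e)
    exact hT.card_filter_of_inner (hA (heA hv)) he hv

/-- The Euler characteristic of a layer bounds the number of its components from above. -/
theorem IsLayer.card_image_le_eul {T : Finset (Finset W)} (hT : IsDisc T) {A A' : Finset W}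
    (h : IsLayer T A A') {κ : Type*} [DecidableEq κ] (ℓ : W → κ)
    (hℓ : ∀ x ∈ A, ∀ y ∈ A, Nbr T x y → ℓ x = ℓ y) : 2 * (#(A.image ℓ) : ℤ) ≤ eul T A := by
  have h1 := card_image_le_euler (A := A) (E := (edges T).filter (· ⊆ A)) (F := T.filter (· ⊆ A)) ℓ
    (fun e he => ⟨(mem_edges.1 (mem_filter.1 he).1).1, (mem_filter.1 he).2⟩) (by
      intro e he x hx y hy
      obtain ⟨he, heA⟩ := mem_filter.1 he
      obtain ⟨_, t, ht, het⟩ := mem_edges.1 he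
      by_cases hxy : x = y
      · rw [hxy]
      · exact hℓ x (heA hx) y (heA hy) ⟨hxy, t, ht, het hx, het hy⟩) (by
      intro e he
      obtain ⟨h2, t, ht, het⟩ := mem_edges.1 he
      obtain ⟨ht, htA⟩ := mem_filter.1 ht
      exact mem_filter.2 ⟨mem_edges.2 ⟨h2, t, ht, het⟩, het.trans htA⟩) h.acyclic
  have h2 := hT.two_mul_card_edges_filter h.subset_inner
  rw [← lay_three hT.card_eq] at h1
  rw [eul]
  omega

/-- Combinatorial Gauss-Bonnet for a set of inner vertices. -/
theorem IsDisc.sum_six_sub_deg {T : Finset (Finset W)} (hT : IsDisc T) (A : Finset W) :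
    ∑ v ∈ A, (6 - (deg T v : ℤ)) = 3 * eul T A + #(lay T A 2) - #(lay T A 1) := by
  have h1 := sum_deg T A
  rw [sum_card_eq _ _ fun t ht => card_inter_le_three hT.card_eq ht A] at h1
  rw [sum_sub_distrib, ← Nat.cast_sum, h1, sum_const, nsmul_eq_mul, eul]
  simp only [lay]
  push_cast
  ring

/-- The triangles with all vertices in `A` and none in `A'`. -/
def flat (T : Finset (Finset W)) (A A' : Finset W) : Finset (Finset W) :=
  T.filter fun t => t ⊆ A ∧ Disjoint t A'

section Layer
variable {T : Finset (Finset W)} {A A' : Finset W}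

/-- A triangle with a vertex in `A'` lies in `A`. -/
theorem IsLayer.subset_of_mem (h : IsLayer T A A') {t : Finset W} (ht : t ∈ T) {v : W}
    (hv : v ∈ t) (hvA : v ∈ A') : t ⊆ A := by
  intro w hw
  by_cases hvw : v = w
  · exact hvw ▸ h.subset hvA
  · exact h.nbr_mem v hvA w ⟨hvw, t, ht, hv, hw⟩

/-- The triangles inside `A`, sorted by the number of their vertices in `A'`. -/
theorem card_filter_subset_eq (hT : ∀ t ∈ T, #t = 3)
    (h : ∀ t ∈ T, ∀ v ∈ t, v ∈ A' → t ⊆ A) :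
    #(T.filter (· ⊆ A)) = #(lay T A' 3) + #(lay T A' 2) + #(lay T A' 1) + #(flat T A A') := by
  simp only [lay, flat, card_filter, ← sum_add_distrib]
  refine sum_congr rfl fun t ht => ?_
  have h3 := card_inter_le_three hT ht A'
  by_cases hd : Disjoint t A'
  · have h0 : #(t ∩ A') = 0 := by rw [disjoint_iff_inter_eq_empty.1 hd]; rfl
    simp [h0, hd]
  · obtain ⟨v, hv, hvA⟩ := not_disjoint_iff.1 hd
    have h1 : 0 < #(t ∩ A') := card_pos.2 ⟨v, mem_inter.2 ⟨hv, hvA⟩⟩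
    have h2 := h t ht v hv hvA
    generalize #(t ∩ A') = k at *
    interval_cases k <;> simp [h2, hd]

/-- The number of triangles with one vertex in the next layer, expressed by the Euler characteristics
of both layers and the triangles of the current one. -/
theorem IsLayer.card_lay_one_next (hT : IsDisc T) (h : IsLayer T A A') :
    (#(lay T A' 1) : ℤ) = 2 * #(A \ A') - #(flat T A A') - #(lay T A 2) - eul T A + eul T A' := by
  have h1 := card_filter_subset_eq hT.card_eq fun t ht v hv hvA => h.subset_of_mem ht hv hvA
  rw [← lay_three hT.card_eq] at h1
  have h2 := card_sdiff_add_card_eq_card h.subset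
  simp only [eul]
  omega

/-- A triangle which is not inside `A` has no vertex in the next layer `A'`. -/
theorem IsLayer.inter_sdiff_eq (hT : IsDisc T) (h : IsLayer T A A') {k : ℕ} (hk : k < 3)
    {t : Finset W} (ht : t ∈ lay T A k) : t ∩ (A \ A') = t ∩ A := by
  obtain ⟨ht, htk⟩ := mem_lay.1 ht
  ext v
  simp only [mem_inter, mem_sdiff]
  constructor
  · rintro ⟨h1, h2, _⟩; exact ⟨h1, h2⟩
  · rintro ⟨h1, h2⟩
    refine ⟨h1, h2, fun h3 => ?_⟩
    have := h.subset_of_mem ht h1 h3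
    rw [inter_eq_left.2 this, hT.card_eq t ht] at htk
    omega

theorem IsLayer.sum_deg_lay (hT : IsDisc T) (h : IsLayer T A A') {k : ℕ} (hk : k < 3) :
    ∑ v ∈ A \ A', deg (lay T A k) v = k * #(lay T A k) := by
  rw [sum_deg, sum_congr rfl (g := fun _ => k), sum_const, smul_eq_mul, mul_comm]
  intro t ht
  rw [h.inter_sdiff_eq hT hk ht, (mem_lay.1 ht).2]

theorem lay_compl (hT : ∀ t ∈ T, #t = 3) (A : Finset W) {k l : ℕ} (hkl : k + l = 3) :
    lay T (verts T \ A) k = lay T A l := by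
  apply filter_congr
  intro t ht
  have h1 := card_sdiff_add_card_inter t A
  have h2 : t ∩ (verts T \ A) = t \ A := by
    ext v
    simp only [mem_inter, mem_sdiff]
    constructor
    · rintro ⟨h1, _, h2⟩; exact ⟨h1, h2⟩
    · rintro ⟨h1, h2⟩; exact ⟨h1, mem_verts.2 ⟨t, ht, h1⟩, h2⟩
  rw [h2]
  have := hT t ht
  omega

/-- The number of neighbours outside `A`. -/
theorem IsDisc.two_mul_card_nbrs_sdiff (hT : IsDisc T) {v : W} (hv : v ∈ inner T) (hvA : v ∈ A) :
    2 * #(nbrs T v \ A) = deg (lay T A 2) v + 2 * deg (lay T A 1) v := by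
  have h := hT.two_mul_card_nbrs_inter hv (B := verts T \ A) (fun h => (mem_sdiff.1 h).2 hvA)
  rw [lay_compl hT.card_eq A (l := 2) rfl, lay_compl hT.card_eq A (l := 1) rfl] at h
  rw [← h]
  congr 2
  ext w
  simp only [mem_sdiff, mem_inter]
  constructor
  · rintro ⟨h1, h2⟩; exact ⟨h1, (mem_filter.1 h1).1, h2⟩
  · rintro ⟨h1, _, h2⟩; exact ⟨h1, h2⟩

/-- A vertex with neighbours both inside and outside `A` lies on triangles with exactly two
vertices in `A`. -/
theorem IsDisc.two_le_deg_lay_two (hT : IsDisc T) {v : W} (hv : v ∈ inner T) (hvA : v ∈ A)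
    {w u : W} (hw : Nbr T v w) (hwA : w ∉ A) (hu : Nbr T v u) (huA : u ∈ A) :
    2 ≤ deg (lay T A 2) v := by
  have h := hT.two_mul_card_nbrs_sdiff hv hvA
  have h0 : deg (lay T A 2) v ≠ 0 := by
    intro h0
    rw [← lay_compl hT.card_eq A (k := 1) rfl] at h0
    have := hT.nbr_mem_of_deg_lay_eq_zero (fun h => (mem_sdiff.1 h).2 hvA) h0 hw
      (mem_sdiff.2 ⟨(mem_filter.1 (mem_nbrs.2 hw)).1, hwA⟩) hu
    exact (mem_sdiff.1 this).2 huA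
  omega

end Layer

end

section
/-! ### Discharging and local estimates -/

variable {W : Type*} {T : Finset (Finset W)} {A A' : Finset W}

/-- The vertices of degree `k` in `B`. -/
def ofDeg (T : Finset (Finset W)) (B : Finset W) (k : ℕ) : Finset W := B.filter (deg T · = k)

theorem sum_card_nbrs_inter (B Q : Finset W) :
    ∑ w ∈ B, #(nbrs T w ∩ Q) = ∑ u ∈ Q, #(nbrs T u ∩ B) := by
  have h := sum_card_bipartiteAbove_eq_sum_card_bipartiteBelow (s := B) (t := Q)
    (fun w u => Nbr T w u)
  have h1 : ∀ w, B.bipartiteBelow (fun w u => Nbr T w u) w = nbrs T w ∩ B := by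
    intro w; ext x
    simp only [mem_bipartiteBelow, mem_inter, mem_nbrs]
    exact ⟨fun h => ⟨h.2.symm, h.1⟩, fun h => ⟨h.2, h.1.symm⟩⟩
  have h2 : ∀ w, Q.bipartiteAbove (fun w u => Nbr T w u) w = nbrs T w ∩ Q := by
    intro w; ext x
    simp only [mem_bipartiteAbove, mem_inter, mem_nbrs]
    exact ⟨fun h => ⟨h.2, h.1⟩, fun h => ⟨h.2, h.1⟩⟩
  simpa only [h1, h2] using h

theorem mem_ofDeg {B : Finset W} {k : ℕ} {v : W} : v ∈ ofDeg T B k ↔ v ∈ B ∧ deg T v = k :=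
  mem_filter

/-- At most half of the neighbours of an inner vertex are inner vertices of degree at most `5`. -/
theorem IsTame.card_low_nbrs (hT : IsTame T) {w : W} (hw : w ∈ inner T) (hd : 6 ≤ deg T w) :
    2 * (#(nbrs T w ∩ ofDeg T (inner T) 4) + #(nbrs T w ∩ ofDeg T (inner T) 5)) ≤ deg T w := by
  set Q := ofDeg T (inner T) 4 ∪ ofDeg T (inner T) 5 with hQ
  have hQm : ∀ x ∈ Q, x ∈ inner T ∧ deg T x ≤ 5 := by
    intro x hx
    rcases mem_union.1 hx with h | h <;> rw [mem_ofDeg] at h <;> exact ⟨h.1, by omega⟩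
  have hwQ : w ∉ Q := fun h => by have := (hQm w h).2; omega
  have h := hT.disc.two_mul_card_nbrs_inter hw hwQ
  have h2 : deg (lay T Q 2) w = 0 := by
    rw [deg_lay, card_eq_zero, filter_eq_empty_iff]
    intro t ht h2
    obtain ⟨x, y, hxy, hxyt⟩ := card_eq_two.1 h2
    have hx : x ∈ t ∩ Q := by rw [hxyt]; simp
    have hy : y ∈ t ∩ Q := by rw [hxyt]; simp
    rw [mem_inter] at hx hy
    have h3 := hT.seven_le x (hQm x hx.2).1 y (hQm y hy.2).1
      ⟨hxy, t, (mem_filter.1 ht).1, hx.1, hy.1⟩ (hQm x hx.2).2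
    have := (hQm y hy.2).2
    omega
  have h3 : deg (lay T Q 1) w ≤ deg T w := card_le_card (filter_subset_filter _ (filter_subset _ _))
  have h4 : #(nbrs T w ∩ Q) =
      #(nbrs T w ∩ ofDeg T (inner T) 4) + #(nbrs T w ∩ ofDeg T (inner T) 5) := by
    rw [hQ, inter_union_distrib_left, card_union_of_disjoint]
    rw [disjoint_left]
    intro x hx hy
    have h1 := (mem_ofDeg.1 (mem_inter.1 hx).2).2
    have h2 := (mem_ofDeg.1 (mem_inter.1 hy).2).2
    omega
  omega

/-- The discharging rule, in quarters: an inner vertex of degree at least `6` can give a half to each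
inner neighbour of degree `4` and a quarter to each inner neighbour of degree `5` without its
curvature becoming positive. -/
theorem IsTame.discharge (hT : IsTame T) {w : W} (hw : w ∈ inner T) :
    4 * (6 - (deg T w : ℤ)) + 2 * #(nbrs T w ∩ ofDeg T (inner T) 4) +
      #(nbrs T w ∩ ofDeg T (inner T) 5) ≤
      (if deg T w = 4 then 8 else 0) + (if deg T w = 5 then 4 else 0) := by
  have h4 := hT.four_le w hw
  have hempty : ∀ k, k ≤ 5 → deg T w < 7 → #(nbrs T w ∩ ofDeg T (inner T) k) = 0 := by
    intro k hk hd
    rw [card_eq_zero, eq_empty_iff_forall_notMem]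
    intro x hx
    rw [mem_inter, mem_nbrs, mem_ofDeg] at hx
    have := hT.seven_le x hx.2.1 w hw hx.1.symm (by omega)
    omega
  by_cases h7 : deg T w < 7
  · rw [hempty 4 (by norm_num) h7, hempty 5 (by norm_num) h7]
    generalize deg T w = d at *
    interval_cases d <;> simp
  · have h2 := hT.card_low_nbrs hw (by omega)
    rw [if_neg (by omega), if_neg (by omega)]
    by_cases h8 : deg T w = 7
    · have : #(nbrs T w ∩ ofDeg T (inner T) 4) ≤ 1 := by
        rw [card_le_one]
        intro x hx y hy
        rw [mem_inter, mem_nbrs] at hx hy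
        exact hT.eq_of_nbr x hx.2 w hw y hy.2 hx.1 hy.1 h8
      omega
    · omega

theorem sum_ite_deg (B : Finset W) (k : ℕ) (c : ℤ) :
    ∑ w ∈ B, (if deg T w = k then c else 0) = c * #(ofDeg T B k) := by
  rw [← sum_filter, sum_const, nsmul_eq_mul, mul_comm]; rfl

/-- The total curvature of a layer after discharging, in quarters. Vertices of degree `4` and `5` in
`A` miss what their neighbours below would give them. `G` is a set of vertices of degree `4` just
outside the layer, each of which receives at least a half from the layer. -/
theorem IsLayer.curvature_le (hT : IsTame T) (h : IsLayer T A A') {G : Finset W}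
    (hG : ∀ v ∈ G, v ∈ innerFour T ∧ v ∉ A ∧ ∃ w ∈ A, Nbr T v w) :
    4 * ∑ v ∈ A, (6 - (deg T v : ℤ)) ≤
      ∑ v ∈ ofDeg T (A \ A') 4, 2 * (#(nbrs T v \ A) : ℤ) +
      ∑ v ∈ ofDeg T (A \ A') 5, ((#(nbrs T v \ A) : ℤ) - 1) - #(ofDeg T A' 5) - 2 * #G := by
  have h1 := sum_le_sum fun w (hw : w ∈ A) => hT.discharge (h.subset_inner hw)
  rw [sum_add_distrib, sum_add_distrib, sum_add_distrib, sum_ite_deg, sum_ite_deg, ← mul_sum,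
    ← mul_sum, ← Nat.cast_sum, ← Nat.cast_sum, sum_card_nbrs_inter A (ofDeg T (inner T) 4),
    sum_card_nbrs_inter A (ofDeg T (inner T) 5)] at h1
  -- with the order of summation exchanged, a vertex of degree `k ≤ 5` in `A` receives its share from
  -- its neighbours in `A`; these are all its neighbours if it lies in `A'`
  have hAk : ∀ k, ofDeg T A k = ofDeg T (A \ A') k ∪ ofDeg T A' k := by
    intro k; rw [ofDeg, ofDeg, ofDeg, ← filter_union, sdiff_union_of_subset h.subset]
  have hdis : ∀ k, Disjoint (ofDeg T (A \ A') k) (ofDeg T A' k) := fun k =>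
    disjoint_filter_filter sdiff_disjoint
  have hsub : ∀ k, ofDeg T A k ⊆ ofDeg T (inner T) k := fun k =>
    filter_subset_filter _ h.subset_inner
  have hV : ∀ k, ∀ v ∈ ofDeg T (A \ A') k, (#(nbrs T v ∩ A) : ℤ) = k - #(nbrs T v \ A) := by
    intro k v hv
    obtain ⟨hv, hd⟩ := mem_ofDeg.1 hv
    have h2 := hT.disc.card_nbrs (h.subset_inner (mem_sdiff.1 hv).1)
    have h3 := card_sdiff_add_card_inter (nbrs T v) A
    omega
  have hA' : ∀ k, ∀ v ∈ ofDeg T A' k, #(nbrs T v ∩ A) = k := by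
    intro k v hv
    obtain ⟨hv, hd⟩ := mem_ofDeg.1 hv
    have h2 := hT.disc.card_nbrs (h.subset_inner (h.subset hv))
    rw [inter_eq_left.2, h2, hd]
    exact fun w hw => h.nbr_mem v hv w (mem_nbrs.1 hw)
  have h4 : ∑ u ∈ G, 1 + ∑ u ∈ ofDeg T A 4, #(nbrs T u ∩ A) ≤
      ∑ u ∈ ofDeg T (inner T) 4, #(nbrs T u ∩ A) := by
    have hGA : Disjoint G (ofDeg T A 4) := by
      rw [disjoint_left]
      intro v hv hv'
      exact (hG v hv).2.1 (mem_ofDeg.1 hv').1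
    refine le_trans ?_ (sum_le_sum_of_subset (union_subset (fun v hv => (hG v hv).1) (hsub 4)))
    rw [sum_union hGA]
    refine Nat.add_le_add_right (sum_le_sum fun v hv => ?_) _
    obtain ⟨_, _, w, hw, hvw⟩ := hG v hv
    exact card_pos.2 ⟨w, mem_inter.2 ⟨mem_nbrs.2 hvw, hw⟩⟩
  have h5 : ∑ u ∈ ofDeg T A 5, #(nbrs T u ∩ A) ≤ ∑ u ∈ ofDeg T (inner T) 5, #(nbrs T u ∩ A) :=
    sum_le_sum_of_subset (hsub 5)
  have hsum : ∀ k : ℕ, (∑ u ∈ ofDeg T A k, #(nbrs T u ∩ A) : ℤ) =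
      k * #(ofDeg T A k) - ∑ v ∈ ofDeg T (A \ A') k, (#(nbrs T v \ A) : ℤ) := by
    intro k
    rw [hAk, sum_union (hdis k), sum_congr rfl (hV k), card_union_of_disjoint (hdis k),
      sum_sub_distrib, sum_const, sum_congr (s₁ := ofDeg T A' k) rfl
      (fun v hv => by rw [hA' k v hv]), sum_const]
    simp only [nsmul_eq_mul]
    push_cast
    ring
  have hc5 : #(ofDeg T A 5) = #(ofDeg T (A \ A') 5) + #(ofDeg T A' 5) := by
    rw [hAk, card_union_of_disjoint (hdis 5)]
  have h6 := hsum 4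
  have h7 := hsum 5
  rw [sum_const, smul_eq_mul, mul_one] at h4
  zify at h4 h5
  have e5 : ∑ v ∈ ofDeg T (A \ A') 5, ((#(nbrs T v \ A) : ℤ) - 1) =
      ∑ v ∈ ofDeg T (A \ A') 5, (#(nbrs T v \ A) : ℤ) - #(ofDeg T (A \ A') 5) := by
    rw [sum_sub_distrib, sum_const, nsmul_eq_mul, mul_one]
  rw [e5, ← mul_sum]
  rw [h6] at h4
  rw [h7] at h5
  zify at hc5
  push_cast at h1 h4 h5
  linarith

/-- The vertices of the bottom level of a layer with all neighbours below. -/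
def isos (T : Finset (Finset W)) (A A' : Finset W) : Finset W :=
  (A \ A').filter fun v => nbrs T v ∩ A = ∅

/-- The vertices of degree `4` of the bottom level with three neighbours below and one at the same
level, described by the triangles at the vertex. -/
def leaves (T : Finset (Finset W)) (A A' : Finset W) : Finset W :=
  (A \ A').filter fun v => deg T v = 4 ∧ deg (lay T A 1) v = 2 ∧ deg (lay T A 2) v = 2

/-- The vertices of the bottom level whose neighbours not below are leaves, of which there is at
least one. -/
def stars (T : Finset (Finset W)) (A A' : Finset W) : Finset W :=
  (A \ A').filter fun v => (nbrs T v ∩ leaves T A A').Nonempty ∧ nbrs T v ∩ A ⊆ leaves T A A'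

/-- The vertices of degree `4` at the bottom level of a layer with a neighbour in the next layer. -/
def upFour (T : Finset (Finset W)) (A A' : Finset W) : Finset W :=
  (A \ A').filter fun v => deg T v = 4 ∧ (nbrs T v ∩ A').Nonempty

section Vertex
variable {v : W}

/-- The triangles at a vertex of the bottom level, sorted by the number of their vertices in `A`, and
those inside `A` by the number of their vertices in `A'`. -/
theorem IsLayer.deg_eq (hT : IsTame T) (h : IsLayer T A A') (hv : v ∈ A \ A') :
    deg T v = deg (lay T A 1) v + deg (lay T A 2) v + deg (flat T A A') v +
      deg (lay T A' 1) v + deg (lay T A' 2) v := by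
  obtain ⟨hvA, hvA'⟩ := mem_sdiff.1 hv
  have h1 := card_filter_subset_eq (T := T.filter (v ∈ ·)) (A := A) (A' := A')
    (fun t ht => hT.disc.card_eq t (mem_filter.1 ht).1)
    (fun t ht w hw hwA => h.subset_of_mem (mem_filter.1 ht).1 hw hwA)
  have h2 : lay (T.filter (v ∈ ·)) A' 3 = ∅ := by
    rw [lay_three (fun t ht => hT.disc.card_eq t (mem_filter.1 ht).1), filter_eq_empty_iff]
    intro t ht hs
    exact hvA' (hs (mem_filter.1 ht).2)
  have h3 : ∀ B k, #(lay (T.filter (v ∈ ·)) B k) = deg (lay T B k) v := by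
    intro B k; rw [deg_lay, lay]
  have h4 : #(flat (T.filter (v ∈ ·)) A A') = deg (flat T A A') v := by
    rw [flat, flat, deg, filter_comm]
  rw [h2, h3, h3, h4, ← lay_three (fun t ht => hT.disc.card_eq t (mem_filter.1 ht).1), h3] at h1
  have h5 : deg T v = deg (lay T A 1) v + deg (lay T A 2) v + deg (lay T A 3) v := by
    rw [deg_lay, deg_lay, deg_lay, deg, card_eq_sum_ones]
    rw [card_filter (fun t => #(t ∩ A) = 1), card_filter (fun t => #(t ∩ A) = 2),
      card_filter (fun t => #(t ∩ A) = 3), ← sum_add_distrib, ← sum_add_distrib]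
    refine sum_congr rfl fun t ht => ?_
    obtain ⟨ht, hvt⟩ := mem_filter.1 ht
    have h6 := card_inter_le_three hT.disc.card_eq ht A
    have h7 : 0 < #(t ∩ A) := card_pos.2 ⟨v, mem_inter.2 ⟨hvt, hvA⟩⟩
    generalize #(t ∩ A) = k at *
    interval_cases k <;> simp
  simp at h1
  omega

theorem IsLayer.exists_nbr_sdiff (h : IsLayer T A A') (hv : v ∈ A \ A') :
    ∃ w, Nbr T v w ∧ w ∉ A := h.exists_nbr v (mem_sdiff.1 hv).1 (mem_sdiff.1 hv).2

theorem IsLayer.mem_inner (h : IsLayer T A A') (hv : v ∈ A \ A') : v ∈ inner T :=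
  h.subset_inner (mem_sdiff.1 hv).1

/-- The neighbours below a vertex of the bottom level, counted by triangles. -/
theorem IsLayer.two_mul_below (hT : IsTame T) (h : IsLayer T A A') (hv : v ∈ A \ A') :
    2 * #(nbrs T v \ A) = deg (lay T A 2) v + 2 * deg (lay T A 1) v :=
  hT.disc.two_mul_card_nbrs_sdiff (h.mem_inner hv) (mem_sdiff.1 hv).1

theorem IsLayer.two_le_of_not_iso (hT : IsTame T) (h : IsLayer T A A') (hv : v ∈ A \ A')
    (hi : v ∉ isos T A A') : 2 ≤ deg (lay T A 2) v := by
  obtain ⟨w, hw, hwA⟩ := h.exists_nbr_sdiff hv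
  have : nbrs T v ∩ A ≠ ∅ := fun h => hi (mem_filter.2 ⟨hv, h⟩)
  obtain ⟨u, hu⟩ := nonempty_iff_ne_empty.2 this
  rw [mem_inter, mem_nbrs] at hu
  exact hT.disc.two_le_deg_lay_two (h.mem_inner hv) (mem_sdiff.1 hv).1 hw hwA hu.1 hu.2

/-- A vertex of the bottom level with a neighbour in the next layer lies on at least two triangles
with exactly one vertex in the next layer, since its link is connected and meets the complement of
`A`. -/
theorem IsLayer.two_le_up (hT : IsTame T) (h : IsLayer T A A') (hv : v ∈ A \ A')
    (hu : (nbrs T v ∩ A').Nonempty) : 2 ≤ deg (lay T A' 1) v := by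
  obtain ⟨w, hw, hwA⟩ := h.exists_nbr_sdiff hv
  obtain ⟨u, hu⟩ := hu
  rw [mem_inter, mem_nbrs] at hu
  have hvA' := (mem_sdiff.1 hv).2
  have h1 := hT.disc.two_mul_card_nbrs_inter (h.mem_inner hv) hvA'
  have h2 : deg (lay T A' 1) v ≠ 0 := fun h0 =>
    hwA (h.subset (hT.disc.nbr_mem_of_deg_lay_eq_zero hvA' h0 hu.1 hu.2 hw))
  omega

theorem IsLayer.up_eq_zero (hT : IsTame T) (h : IsLayer T A A') (hv : v ∈ A \ A')
    (hu : ¬ (nbrs T v ∩ A').Nonempty) : deg (lay T A' 1) v = 0 ∧ deg (lay T A' 2) v = 0 := by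
  have h1 := hT.disc.two_mul_card_nbrs_inter (h.mem_inner hv) (mem_sdiff.1 hv).2
  rw [not_nonempty_iff_eq_empty.1 hu, card_empty] at h1
  omega

theorem mem_leaves : v ∈ leaves T A A' ↔ v ∈ A \ A' ∧ deg T v = 4 ∧ deg (lay T A 1) v = 2 ∧
    deg (lay T A 2) v = 2 := mem_filter

/-- A leaf has at most one neighbour in the layer. -/
theorem IsLayer.leaf_nbr_unique (hT : IsTame T) (h : IsLayer T A A') (hv : v ∈ leaves T A A')
    {x y : W} (hx : Nbr T v x) (hxA : x ∈ A) (hy : Nbr T v y) (hyA : y ∈ A) : x = y := by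
  obtain ⟨hv, h4, h1, h2⟩ := mem_leaves.1 hv
  have h3 := h.two_mul_below hT hv
  have h5 := hT.disc.card_nbrs (h.mem_inner hv)
  have h6 := card_sdiff_add_card_inter (nbrs T v) A
  have : #(nbrs T v ∩ A) ≤ 1 := by omega
  exact card_le_one.1 this x (mem_inter.2 ⟨mem_nbrs.2 hx, hxA⟩) y (mem_inter.2 ⟨mem_nbrs.2 hy, hyA⟩)

/-- A leaf has a neighbour at the same level; a neighbour in the next layer would need triangles for
which there is no room. -/
theorem IsLayer.leaf_nbr (hT : IsTame T) (h : IsLayer T A A') (hv : v ∈ leaves T A A') :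
    (nbrs T v ∩ (A \ A')).Nonempty := by
  have hv' := hv
  obtain ⟨hv, h4, h1, h2⟩ := mem_leaves.1 hv
  have h3 := h.two_mul_below hT hv
  have h5 := hT.disc.card_nbrs (h.mem_inner hv)
  have h6 := card_sdiff_add_card_inter (nbrs T v) A
  obtain ⟨x, hx⟩ := card_pos.1 (by omega : 0 < #(nbrs T v ∩ A))
  obtain ⟨hx, hxA⟩ := mem_inter.1 hx
  refine ⟨x, mem_inter.2 ⟨hx, mem_sdiff.2 ⟨hxA, fun hxA' => ?_⟩⟩⟩
  have h7 := h.two_le_up hT hv ⟨x, mem_inter.2 ⟨hx, hxA'⟩⟩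
  have h8 := h.deg_eq hT hv
  omega

/-- The neighbouring leaves of a vertex `v` occupy triangles with exactly two vertices in `A`; if
they occupy all of these, then `v` is the centre of a star. -/
theorem IsLayer.two_mul_leaves_le (hT : IsTame T) (h : IsLayer T A A') (hv : v ∈ A \ A')
    (hl : (nbrs T v ∩ leaves T A A').Nonempty) :
    2 * #(nbrs T v ∩ leaves T A A') ≤ deg (lay T A 2) v ∧
      (2 * #(nbrs T v ∩ leaves T A A') = deg (lay T A 2) v → v ∈ stars T A A') ∧
      7 ≤ deg T v := by
  set Λ := leaves T A A' with hΛ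
  have hvi := h.mem_inner hv
  have h7 : 7 ≤ deg T v := by
    obtain ⟨x, hx⟩ := hl
    rw [mem_inter, mem_nbrs] at hx
    obtain ⟨hx1, hx4, _⟩ := mem_leaves.1 hx.2
    exact hT.seven_le x (h.mem_inner hx1) v hvi hx.1.symm (by omega)
  have hΛA : ∀ x ∈ Λ, x ∈ A := fun x hx => (mem_sdiff.1 (mem_leaves.1 hx).1).1
  have hvΛ : v ∉ Λ := fun hc => by have := (mem_leaves.1 hc).2.1; omega
  have hvA := (mem_sdiff.1 hv).1
  -- the third vertex of a triangle spanned by `v` and a leaf lies below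
  have hthird : ∀ t ∈ T, v ∈ t → ∀ x ∈ t, x ∈ Λ → t ∩ A = {v, x} := by
    intro t ht hvt x hx hxΛ
    have hvx : x ≠ v := fun hc => hvΛ (hc ▸ hxΛ)
    ext y
    simp only [mem_inter, mem_insert, mem_singleton]
    constructor
    · rintro ⟨hy, hyA⟩
      by_cases hyx : y = x
      · exact Or.inr hyx
      · exact Or.inl (h.leaf_nbr_unique hT hxΛ ⟨Ne.symm hyx, t, ht, hx, hy⟩ hyA
          ⟨hvx, t, ht, hx, hvt⟩ hvA)
    · rintro (rfl | rfl)
      · exact ⟨hvt, hvA⟩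
      · exact ⟨hx, hΛA _ hxΛ⟩
  have h1 := hT.disc.two_mul_card_nbrs_inter hvi hvΛ
  have h2 : deg (lay T Λ 2) v = 0 := by
    rw [deg_lay, card_eq_zero, filter_eq_empty_iff]
    intro t ht h2
    obtain ⟨ht, hvt⟩ := mem_filter.1 ht
    obtain ⟨x, y, hxy, hxyt⟩ := card_eq_two.1 h2
    have hx : x ∈ t ∩ Λ := by rw [hxyt]; simp
    have hy : y ∈ t ∩ Λ := by rw [hxyt]; simp
    rw [mem_inter] at hx hy
    have h3 : y ∈ t ∩ A := mem_inter.2 ⟨hy.1, hΛA y hy.2⟩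
    rw [hthird t ht hvt x hx.1 hx.2, mem_insert, mem_singleton] at h3
    rcases h3 with h3 | h3
    exacts [hvΛ (h3 ▸ hy.2), hxy h3.symm]
  have hsub : (T.filter (v ∈ ·)).filter (fun t => #(t ∩ Λ) = 1) ⊆
      (T.filter (v ∈ ·)).filter fun t => #(t ∩ A) = 2 := by
    intro t ht
    obtain ⟨ht, ht1⟩ := mem_filter.1 ht
    obtain ⟨x, hx⟩ := card_eq_one.1 ht1
    have hx' : x ∈ t ∩ Λ := by rw [hx]; simp
    rw [mem_inter] at hx'
    refine mem_filter.2 ⟨ht, ?_⟩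
    rw [hthird t (mem_filter.1 ht).1 (mem_filter.1 ht).2 x hx'.1 hx'.2, card_pair]
    exact fun hc => hvΛ (hc ▸ hx'.2)
  have hle : deg (lay T Λ 1) v ≤ deg (lay T A 2) v := by
    rw [deg_lay, deg_lay]; exact card_le_card hsub
  refine ⟨by omega, fun heq => ?_, h7⟩
  -- if the leaves occupy all these triangles, no triangle at `v` has exactly one vertex in the set
  -- `B` of the other neighbours in `A`; as the link of `v` is connected and contains a leaf, it does
  -- not meet `B`
  have hfe := eq_of_subset_of_card_le hsub (by rw [← deg_lay, ← deg_lay]; omega)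
  set B := (nbrs T v ∩ A) \ Λ with hB
  have hvB : v ∉ B := fun hc => (mem_nbrs.1 (mem_inter.1 (mem_sdiff.1 hc).1).1).1 rfl
  have h0 : deg (lay T B 1) v = 0 := by
    rw [deg_lay, card_eq_zero, filter_eq_empty_iff]
    intro t ht ht1
    have htT := (mem_filter.1 ht).1
    have hvt := (mem_filter.1 ht).2
    obtain ⟨x, hx⟩ := card_eq_one.1 ht1
    have hx' : x ∈ t ∩ B := by rw [hx]; simp
    obtain ⟨hxt, hxB⟩ := mem_inter.1 hx'
    obtain ⟨hxn, hxΛ⟩ := mem_sdiff.1 hxB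
    obtain ⟨hxn, hxA⟩ := mem_inter.1 hxn
    have hvx := (mem_nbrs.1 hxn).1
    -- a vertex of `t` in `A` other than `v` and `x` would be a leaf
    have hnl : ∀ y ∈ t, y ∉ Λ := by
      intro y hy hyΛ
      have h3 : x ∈ t ∩ A := mem_inter.2 ⟨hxt, hxA⟩
      rw [hthird t htT hvt y hy hyΛ, mem_insert, mem_singleton] at h3
      rcases h3 with h3 | h3
      exacts [hvx h3.symm, hxΛ (h3 ▸ hyΛ)]
    have htA : t ∩ A = {v, x} := by
      ext y
      simp only [mem_inter, mem_insert, mem_singleton]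
      constructor
      · rintro ⟨hy, hyA⟩
        by_contra hne
        push Not at hne
        have : y ∈ t ∩ B := mem_inter.2 ⟨hy, mem_sdiff.2 ⟨mem_inter.2
          ⟨mem_nbrs.2 ⟨hne.1.symm, t, htT, hvt, hy⟩, hyA⟩, hnl y hy⟩⟩
        rw [hx, mem_singleton] at this
        exact hne.2 this
      · rintro (rfl | rfl)
        exacts [⟨hvt, hvA⟩, ⟨hxt, hxA⟩]
    have : t ∈ (T.filter (v ∈ ·)).filter fun t => #(t ∩ A) = 2 :=
      mem_filter.2 ⟨ht, by rw [htA, card_pair hvx]⟩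
    rw [← hfe] at this
    obtain ⟨y, hy⟩ := card_pos.1 (by rw [(mem_filter.1 this).2]; norm_num : 0 < #(t ∩ Λ))
    exact hnl y (mem_inter.1 hy).1 (mem_inter.1 hy).2
  refine mem_filter.2 ⟨hv, hl, fun u hu => ?_⟩
  by_contra huΛ
  obtain ⟨x, hx⟩ := hl
  obtain ⟨hx, hxΛ⟩ := mem_inter.1 hx
  have := hT.disc.nbr_mem_of_deg_lay_eq_zero hvB h0 (mem_nbrs.1 (mem_inter.1 hu).1)
    (mem_sdiff.2 ⟨hu, huΛ⟩) (mem_nbrs.1 hx)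
  exact (mem_sdiff.1 this).2 hxΛ

/-- The local estimate at a vertex of the bottom level of a layer, in quarters. A leaf is given an
allowance of `6`, which is charged to its neighbour in the layer; isolated vertices and centres of
stars get an allowance of `16`, which is paid for by the Euler characteristic of the layer, as they
have components of their own. -/
theorem IsLayer.vertex_estimate (hT : IsTame T) (h : IsLayer T A A') (hv : v ∈ A \ A') :
    8 - 4 * (deg (lay T A 2) v : ℤ) + (if deg T v = 4 then 2 * (#(nbrs T v \ A) : ℤ) else 0) +
      (if deg T v = 5 then (#(nbrs T v \ A) : ℤ) - 1 else 0) + 6 * #(nbrs T v ∩ leaves T A A') ≤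
    (if deg T v = 4 then 4 * (deg (flat T A A') v : ℤ) else 0) +
      (if deg T v = 5 then ((min (deg (lay T A 1) v) 3 : ℕ) : ℤ) else 0) +
      (if v ∈ upFour T A A' then 2 else 0) + (if v ∈ isos T A A' then 16 else 0) +
      (if v ∈ stars T A A' then 16 else 0) + (if v ∈ leaves T A A' then 6 else 0) := by
  have h4 := hT.four_le v (h.mem_inner hv)
  have hL := h.two_mul_below hT hv
  have hd := h.deg_eq hT hv
  have hiso := h.two_le_of_not_iso hT hv
  -- a vertex next to leaves has degree at least `7`; the contribution `6` of a leaf is covered by the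
  -- two triangles it occupies, and a pair of unoccupied triangles pays for the `8`, unless all of the
  -- triangles are occupied and `v` is the centre of a star
  by_cases hl : (nbrs T v ∩ leaves T A A').Nonempty
  · obtain ⟨h1, h2, h7⟩ := h.two_mul_leaves_le hT hv hl
    have hpos := card_pos.2 hl
    rw [if_neg (by omega), if_neg (by omega), if_neg (by omega), if_neg (by omega)]
    have e1 : (0 : ℤ) ≤ if v ∈ upFour T A A' then 2 else 0 := by split_ifs <;> norm_num
    have e2 : (0 : ℤ) ≤ if v ∈ isos T A A' then 16 else 0 := by split_ifs <;> norm_num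
    have e3 : (0 : ℤ) ≤ if v ∈ leaves T A A' then 6 else 0 := by split_ifs <;> norm_num
    by_cases hs : v ∈ stars T A A'
    · rw [if_pos hs]; omega
    · have : 2 * #(nbrs T v ∩ leaves T A A') ≠ deg (lay T A 2) v := fun hc => hs (h2 hc)
      rw [if_neg hs]; omega
  · rw [not_nonempty_iff_eq_empty.1 hl, card_empty]
    have e3 : (0 : ℤ) ≤ if v ∈ stars T A A' then 16 else 0 := by split_ifs <;> norm_num
    have e4 : (0 : ℤ) ≤ if v ∈ leaves T A A' then 6 else 0 := by split_ifs <;> norm_num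
    have e5 : (0 : ℤ) ≤ if v ∈ upFour T A A' then 2 else 0 := by split_ifs <;> norm_num
    by_cases hd4 : deg T v = 4
    · rw [if_pos hd4, if_neg (by omega), if_pos hd4, if_neg (by omega)]
      by_cases hi : v ∈ isos T A A'
      · rw [if_pos hi]; omega
      · rw [if_neg hi]
        have h2 := hiso hi
        by_cases hleaf : v ∈ leaves T A A'
        · rw [if_pos hleaf]
          have := mem_leaves.1 hleaf
          omega
        · have hleaf' : ¬ (deg (lay T A 1) v = 2 ∧ deg (lay T A 2) v = 2) := fun hc =>
            hleaf (mem_leaves.2 ⟨hv, hd4, hc⟩)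
          rw [if_neg hleaf]
          by_cases hu : (nbrs T v ∩ A').Nonempty
          · have := h.two_le_up hT hv hu
            have hup : v ∈ upFour T A A' := mem_filter.2 ⟨hv, hd4, hu⟩
            rw [if_pos hup]
            omega
          · have := h.up_eq_zero hT hv hu
            omega
    · by_cases hd5 : deg T v = 5
      · rw [if_neg hd4, if_pos hd5, if_neg hd4, if_pos hd5]
        by_cases hi : v ∈ isos T A A'
        · rw [if_pos hi]; push_cast; omega
        · have h2 := hiso hi
          rw [if_neg hi]; push_cast; omega
      · rw [if_neg hd4, if_neg hd5, if_neg hd4, if_neg hd5]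
        by_cases hi : v ∈ isos T A A'
        · rw [if_pos hi]; omega
        · have h2 := hiso hi
          rw [if_neg hi]; omega

end Vertex

end

section
/-! ### The recursion for layers -/

variable {W : Type*} {T : Finset (Finset W)} {A A' : Finset W}

/-- `layers T k` consists of the vertices at distance at least `k + 1` from the boundary. -/
def layers (T : Finset (Finset W)) : ℕ → Finset W
  | 0 => inner T
  | k + 1 => (layers T k).filter fun v => ∀ w, Nbr T v w → w ∈ layers T k

theorem layers_subset_inner (T : Finset (Finset W)) (k : ℕ) : layers T k ⊆ inner T := by
  induction k with
  | zero => exact Subset.refl _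
  | succ k ih => exact (filter_subset _ _).trans ih

/-- A chain whose boundary lies in a layer lies in that layer: otherwise it would contain, step by
step, full stars of vertices closer and closer to the boundary of the disc. -/
theorem IsDisc.subset_layers (hT : IsDisc T) {k : ℕ} {S : Finset (Finset W)} (hS : S ⊆ T)
    (hb : ∀ e ∈ bd 2 S, e ⊆ layers T k) {i : ℕ} (hi : i ≤ k) : ∀ t ∈ S, t ⊆ layers T i := by
  have hstar : ∀ v, v ∉ layers T k → ∀ t ∈ S, v ∈ t → ∀ t' ∈ T, v ∈ t' → t' ∈ S := by
    intro v hv t ht hvt t' ht' hvt'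
    refine hT.star_subset hS (fun h => ?_) ht hvt ht' hvt'
    obtain ⟨e, he, hve⟩ := mem_verts.1 h
    exact hv (hb e he hve)
  induction i with
  | zero =>
    intro t ht v hv
    by_contra hvi
    have hvb : v ∈ verts (bd 2 T) := by
      by_contra hc
      exact hvi (mem_sdiff.2 ⟨mem_verts.2 ⟨t, hS ht, hv⟩, hc⟩)
    obtain ⟨e, he, hve⟩ := mem_verts.1 hvb
    have hvk : v ∉ layers T k := fun h => hvi (layers_subset_inner T k h)
    have hfe : S.filter (e ⊆ ·) = T.filter (e ⊆ ·) := by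
      ext t'
      simp only [mem_filter]
      exact ⟨fun h => ⟨hS h.1, h.2⟩, fun h => ⟨hstar v hvk t ht hv t' h.1 (h.2 hve), h.2⟩⟩
    have : e ∈ bd 2 S := by
      rw [mem_bd] at he ⊢
      rw [hfe]
      exact he
    exact hvk (hb e this hve)
  | succ i ih =>
    have ih := ih (by omega)
    intro t ht v hv
    refine mem_filter.2 ⟨ih t ht hv, fun w hw => ?_⟩
    by_contra hwi
    have hvk : v ∉ layers T k := by
      intro h
      have : ∀ j, i + 1 ≤ j → layers T j ⊆ layers T (i + 1) := by
        intro j hj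
        induction j, hj using Nat.le_induction with
        | base => exact Subset.refl _
        | succ j _ ihj => exact (filter_subset _ _).trans ihj
      exact hwi ((mem_filter.1 (this k hi h)).2 w hw)
    obtain ⟨_, t', ht', hvt', hwt'⟩ := hw
    exact hwi (ih t' (hstar v hvk t ht hv t' ht' hvt') hwt')

/-- Consecutive sets of vertices at a given distance from the boundary form a layer. -/
theorem IsDisc.isLayer (hT : IsDisc T) (k : ℕ) : IsLayer T (layers T k) (layers T (k + 1)) where
  subset_inner := layers_subset_inner T k
  subset := filter_subset _ _
  nbr_mem v hv w hw := (mem_filter.1 hv).2 w hw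
  exists_nbr v hv hv' := by
    by_contra hc
    push Not at hc
    exact hv' (mem_filter.2 ⟨hv, hc⟩)
  acyclic z hz hz0 := by
    obtain ⟨S, hS, hSz⟩ := hT.acyclic z (hz.trans (filter_subset _ _)) hz0
    refine ⟨S, fun t ht => mem_filter.2 ⟨hS ht, ?_⟩, hSz⟩
    refine hT.subset_layers hS (fun e he => ?_) le_rfl t ht
    rw [hSz] at he
    exact (mem_filter.1 (hz he)).2

/-- The vertices of degree `5` at the bottom level, weighted by the triangles below, with weights
at most `3`. -/
def weightFive (T : Finset (Finset W)) (A A' : Finset W) : ℕ :=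
  ∑ v ∈ ofDeg T (A \ A') 5, min (deg (lay T A 1) v) 3

theorem sum_ite_mem {V B : Finset W} (hB : B ⊆ V) (c : ℤ) :
    ∑ v ∈ V, (if v ∈ B then c else 0) = c * #B := by
  rw [← sum_filter, filter_mem_eq_inter, inter_eq_right.2 hB, sum_const, nsmul_eq_mul, mul_comm]

/-- Every leaf is a neighbour of some vertex of the bottom level. -/
theorem IsLayer.card_leaves_le (hT : IsTame T) (h : IsLayer T A A') :
    #(leaves T A A') ≤ ∑ v ∈ A \ A', #(nbrs T v ∩ leaves T A A') := by
  rw [sum_card_nbrs_inter, card_eq_sum_ones]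
  exact sum_le_sum fun v hv => card_pos.2 (h.leaf_nbr hT hv)

theorem IsLayer.sum_flat_le (hT : IsTame T) (h : IsLayer T A A') :
    ∑ v ∈ ofDeg T (A \ A') 4, deg (flat T A A') v ≤ #(flat T A A') := by
  refine hT.sum_deg_le (fun v hv => ?_) (filter_subset _ _)
  obtain ⟨hv, hd⟩ := mem_ofDeg.1 hv
  exact ⟨h.mem_inner hv, by omega⟩

/-- The sum of the local estimates over the bottom level of a layer. -/
theorem IsLayer.sum_estimate (hT : IsTame T) (h : IsLayer T A A') :
    8 * (#(A \ A') : ℤ) - 8 * #(lay T A 2) +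
      ∑ v ∈ ofDeg T (A \ A') 4, 2 * (#(nbrs T v \ A) : ℤ) +
      ∑ v ∈ ofDeg T (A \ A') 5, ((#(nbrs T v \ A) : ℤ) - 1) ≤
    4 * #(flat T A A') + weightFive T A A' + 2 * #(upFour T A A') + 16 * #(isos T A A') +
      16 * #(stars T A A') := by
  have h1 := sum_le_sum fun v (hv : v ∈ A \ A') => h.vertex_estimate hT hv
  simp only [sum_add_distrib] at h1
  have e1 : ∑ v ∈ A \ A', (8 - 4 * (deg (lay T A 2) v : ℤ)) =
      8 * #(A \ A') - 8 * #(lay T A 2) := by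
    rw [sum_sub_distrib, sum_const, ← mul_sum, ← Nat.cast_sum,
      h.sum_deg_lay hT.disc (by norm_num)]
    simp only [nsmul_eq_mul]
    push_cast
    ring
  have e2 : ∑ v ∈ ofDeg T (A \ A') 4, 4 * (deg (flat T A A') v : ℤ) ≤ 4 * #(flat T A A') := by
    rw [← mul_sum, ← Nat.cast_sum]
    exact_mod_cast Nat.mul_le_mul_left 4 (h.sum_flat_le hT)
  have e3 : (#(leaves T A A') : ℤ) ≤ ∑ v ∈ A \ A', (#(nbrs T v ∩ leaves T A A') : ℤ) := by
    exact_mod_cast h.card_leaves_le hT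
  have e4 : (weightFive T A A' : ℤ) =
      ∑ v ∈ ofDeg T (A \ A') 5, ((min (deg (lay T A 1) v) 3 : ℕ) : ℤ) := by
    rw [weightFive, Nat.cast_sum]
  rw [sum_ite_mem (V := A \ A') (B := upFour T A A') (filter_subset _ _),
    sum_ite_mem (V := A \ A') (B := isos T A A') (filter_subset _ _),
    sum_ite_mem (V := A \ A') (B := stars T A A') (filter_subset _ _),
    sum_ite_mem (V := A \ A') (B := leaves T A A') (filter_subset _ _),
    ← sum_filter, ← sum_filter, ← sum_filter, ← sum_filter, e1,
    ← mul_sum (A \ A')] at h1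
  simp only [ofDeg] at e2 e4 ⊢
  linarith

/-- The effect of passing to the next layer. The quantity `4 * #(lay T A 1) - 4 * eul T A`,
corrected by the vertices of degree `4` that reach into the next layer, grows only through the
vertices of degree `5`. -/
theorem IsLayer.step (hT : IsTame T) (h : IsLayer T A A') {G : Finset W}
    (hG : ∀ v ∈ G, v ∈ innerFour T ∧ v ∉ A ∧ ∃ w ∈ A, Nbr T v w) :
    4 * ((#(lay T A' 1) : ℤ) - eul T A') - 2 * #(upFour T A A') ≤
      4 * ((#(lay T A 1) : ℤ) - eul T A) - 2 * #G - 12 * eul T A +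
        16 * (#(isos T A A') + #(stars T A A')) + weightFive T A A' - #(ofDeg T A' 5) := by
  have h1 := h.sum_estimate hT
  have h2 := h.curvature_le hT hG
  have h3 := hT.disc.sum_six_sub_deg A
  have h4 := h.card_lay_one_next hT.disc
  rw [h3] at h2
  linarith

/-- Vertices of degree at most `5` share no triangle, so the triangles with one vertex in `A` at
the vertices of `G` and at those of degree `5` of the bottom level are distinct. -/
theorem IsLayer.card_lay_one_ge (hT : IsTame T) (h : IsLayer T A A') {G : Finset W}
    (hG : ∀ v ∈ G, v ∈ innerFour T ∧ v ∉ A ∧ 2 ≤ deg (lay T A 1) v) :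
    2 * #G + ∑ v ∈ ofDeg T (A \ A') 5, deg (lay T A 1) v ≤ #(lay T A 1) := by
  have hd : Disjoint G (ofDeg T (A \ A') 5) := by
    rw [disjoint_left]
    intro v hv hv'
    exact (hG v hv).2.1 (mem_sdiff.1 (mem_ofDeg.1 hv').1).1
  have h1 := hT.sum_deg_le (B := G ∪ ofDeg T (A \ A') 5) (𝒰 := lay T A 1) (fun v hv => by
    rcases mem_union.1 hv with hv | hv
    · have := mem_filter.1 (hG v hv).1
      exact ⟨this.1, by omega⟩
    · obtain ⟨hv, hd⟩ := mem_ofDeg.1 hv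
      exact ⟨h.mem_inner hv, by omega⟩) (filter_subset _ _)
  rw [sum_union hd] at h1
  have h2 := sum_le_sum fun v hv => (hG v hv).2.2
  rw [sum_const, smul_eq_mul] at h2
  omega

theorem weightFive_le_sum :
    weightFive T A A' ≤ ∑ v ∈ ofDeg T (A \ A') 5, deg (lay T A 1) v :=
  sum_le_sum fun _ _ => min_le_left _ _

theorem weightFive_le_card : weightFive T A A' ≤ 3 * #(ofDeg T (A \ A') 5) := by
  rw [weightFive, mul_comm, ← smul_eq_mul, ← sum_const]
  exact sum_le_sum fun _ _ => min_le_right _ _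

theorem IsLayer.two_le_eul (hT : IsDisc T) (h : IsLayer T A A') (hA : A.Nonempty) :
    2 ≤ eul T A := by
  have := h.card_image_le_eul hT (fun _ => ()) (fun _ _ _ _ _ => rfl)
  have h1 : 0 < #(A.image fun _ => ()) := card_pos.2 (hA.image _)
  omega

/-- The vertices of degree `4` just outside a layer, as produced by the preceding layer. -/
theorem IsLayer.upFour_spec (hT : IsTame T) (h : IsLayer T A A') {v : W}
    (hv : v ∈ upFour T A A') : v ∈ innerFour T ∧ v ∉ A' ∧ (∃ w ∈ A', Nbr T v w) ∧
      2 ≤ deg (lay T A' 1) v := by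
  obtain ⟨hv, hd, hu⟩ := mem_filter.1 hv
  refine ⟨mem_filter.2 ⟨h.mem_inner hv, hd⟩, (mem_sdiff.1 hv).2, ?_, h.two_le_up hT hv hu⟩
  obtain ⟨w, hw⟩ := hu
  rw [mem_inter, mem_nbrs] at hw
  exact ⟨w, hw.2, hw.1⟩

theorem mem_stars {v : W} : v ∈ stars T A A' ↔ v ∈ A \ A' ∧
    (nbrs T v ∩ leaves T A A').Nonempty ∧ nbrs T v ∩ A ⊆ leaves T A A' := mem_filter

/-- Every vertex of the bottom level without neighbours in the layer, and every star, is contained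
in a component of the layer of its own, and these components do not meet the next layer. -/
theorem IsLayer.card_components_le (hT : IsTame T) (h : IsLayer T A A') :
    2 * ((#(isos T A A') : ℤ) + #(stars T A A')) ≤ eul T A ∧
      (A'.Nonempty → 2 * ((#(isos T A A') : ℤ) + #(stars T A A')) + 2 ≤ eul T A) := by
  set I := isos T A A' with hI
  set C := stars T A A' with hC
  have hIV : ∀ v ∈ I, v ∈ A \ A' := fun v hv => (mem_filter.1 hv).1
  have hCV : ∀ v ∈ C, v ∈ A \ A' := fun v hv => (mem_stars.1 hv).1
  have hIn : ∀ v ∈ I, ∀ w ∈ A, ¬ Nbr T v w := by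
    intro v hv w hw hvw
    have : w ∈ nbrs T v ∩ A := mem_inter.2 ⟨mem_nbrs.2 hvw, hw⟩
    rw [(mem_filter.1 hv).2] at this
    exact notMem_empty _ this
  have hC7 : ∀ v ∈ C, 7 ≤ deg T v := fun v hv =>
    (h.two_mul_leaves_le hT (hCV v hv) (mem_stars.1 hv).2.1).2.2
  have hLC : ∀ v ∈ leaves T A A', v ∉ C := fun v hv hc => by
    have := (mem_leaves.1 hv).2.1
    have := hC7 v hc
    omega
  have hIC : Disjoint I C := by
    rw [disjoint_left]
    intro v hv hv'
    obtain ⟨x, hx⟩ := (mem_stars.1 hv').2.1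
    rw [mem_inter, mem_nbrs] at hx
    exact hIn v hv x (mem_sdiff.1 (mem_leaves.1 hx.2).1).1 hx.1
  -- the labelling `ℓ` is the identity on `I` and `C`, sends a leaf of a star to its centre, and is
  -- `none` elsewhere; it is constant along the edges of the layer
  set P : W → W → Prop := fun v s => v ∈ leaves T A A' ∧ s ∈ C ∧ Nbr T v s with hP
  set ℓ : W → Option W := fun v =>
    if v ∈ I ∪ C then some v else if hs : ∃ s, P v s then some hs.choose else none with hℓ
  have hone : ∀ v ∈ I ∪ C, ℓ v = some v := fun v hv => if_pos hv
  have hleaf : ∀ v s, P v s → ℓ v = some s := by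
    intro v s hvs
    have hvA := (mem_sdiff.1 (mem_leaves.1 hvs.1).1).1
    have hsA := (mem_sdiff.1 (hCV s hvs.2.1)).1
    have h1 : v ∉ I ∪ C := by
      rw [mem_union, not_or]
      exact ⟨fun hc => hIn v hc s hsA hvs.2.2, hLC v hvs.1⟩
    have h2 : ∃ s, P v s := ⟨s, hvs⟩
    simp only [hℓ, if_neg h1, dif_pos h2]
    congr 1
    exact h.leaf_nbr_unique hT hvs.1 h2.choose_spec.2.2
      (mem_sdiff.1 (hCV _ h2.choose_spec.2.1)).1 hvs.2.2 hsA
  have hnone : ∀ v, v ∉ I ∪ C → (∀ s, ¬ P v s) → ℓ v = none := by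
    intro v hv hn
    simp only [hℓ, if_neg hv]
    rw [dif_neg]
    rintro ⟨s, hs⟩
    exact hn s hs
  have hstar : ∀ x ∈ C, ∀ y ∈ A, Nbr T x y → P y x := fun x hx y hy hxy =>
    ⟨(mem_stars.1 hx).2.2 (mem_inter.2 ⟨mem_nbrs.2 hxy, hy⟩), hx, hxy.symm⟩
  have hconst : ∀ x ∈ A, ∀ y ∈ A, Nbr T x y → ℓ x = ℓ y := by
    intro x hx y hy hxy
    have hxI : x ∉ I := fun hc => hIn x hc y hy hxy
    have hyI : y ∉ I := fun hc => hIn y hc x hx hxy.symm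
    by_cases hxC : x ∈ C
    · rw [hone x (mem_union_right _ hxC), hleaf y x (hstar x hxC y hy hxy)]
    by_cases hyC : y ∈ C
    · rw [hone y (mem_union_right _ hyC), hleaf x y (hstar y hyC x hx hxy.symm)]
    have hn : ∀ x ∈ A, ∀ y ∈ A, Nbr T x y → y ∉ C → ∀ s, ¬ P x s := by
      intro x hx y hy hxy hyC s hs
      have := h.leaf_nbr_unique hT hs.1 hxy hy hs.2.2 (mem_sdiff.1 (hCV s hs.2.1)).1
      exact hyC (this ▸ hs.2.1)
    rw [hnone x (by simp [hxI, hxC]) (hn x hx y hy hxy hyC),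
      hnone y (by simp [hyI, hyC]) (hn y hy x hx hxy.symm hxC)]
  have h1 := h.card_image_le_eul hT.disc ℓ hconst
  have hsub : (I ∪ C).image some ⊆ A.image ℓ := by
    intro a ha
    obtain ⟨v, hv, rfl⟩ := mem_image.1 ha
    refine mem_image.2 ⟨v, ?_, hone v hv⟩
    rcases mem_union.1 hv with hv | hv
    exacts [(mem_sdiff.1 (hIV v hv)).1, (mem_sdiff.1 (hCV v hv)).1]
  have hc : #((I ∪ C).image (some : W → Option W)) = #I + #C := by
    rw [card_image_of_injective _ (Option.some_injective W), card_union_of_disjoint hIC]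
  constructor
  · have := card_le_card hsub
    omega
  · rintro ⟨u, hu⟩
    have hun : ℓ u = none := by
      apply hnone
      · rw [mem_union, not_or]
        exact ⟨fun hc => (mem_sdiff.1 (hIV u hc)).2 hu, fun hc => (mem_sdiff.1 (hCV u hc)).2 hu⟩
      · exact fun s hs => (mem_sdiff.1 (mem_leaves.1 hs.1).1).2 hu
    have h2 : insert none ((I ∪ C).image some) ⊆ A.image ℓ :=
      insert_subset (mem_image.2 ⟨u, h.subset hu, hun⟩) hsub
    have h3 := card_le_card h2
    rw [card_insert_of_notMem (by simp), hc] at h3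
    omega

/-- By discharging, the number of triangles with an edge in `A` and the third vertex below is bounded
by the number of triangles with one vertex in `A`. -/
theorem IsLayer.card_lay_two_le (hT : IsTame T) (h : IsLayer T A A') :
    (#(lay T A 2) : ℤ) + 4 * eul T A ≤ 2 * #(lay T A 1) := by
  have h2 := h.curvature_le hT (G := ∅) (by simp)
  rw [hT.disc.sum_six_sub_deg A] at h2
  have hL : ∀ v ∈ A \ A', 2 * (#(nbrs T v \ A) : ℤ) =
      ((deg (lay T A 2) v + 2 * deg (lay T A 1) v : ℕ) : ℤ) := fun v hv => by
    exact_mod_cast h.two_mul_below hT hv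
  have h4 : ∑ v ∈ ofDeg T (A \ A') 4, 2 * (#(nbrs T v \ A) : ℤ) ≤
      ∑ v ∈ ofDeg T (A \ A') 4, ((deg (lay T A 2) v + 2 * deg (lay T A 1) v : ℕ) : ℤ) :=
    sum_le_sum fun v hv => (hL v (mem_ofDeg.1 hv).1).le
  have h5 : ∑ v ∈ ofDeg T (A \ A') 5, ((#(nbrs T v \ A) : ℤ) - 1) ≤
      ∑ v ∈ ofDeg T (A \ A') 5, ((deg (lay T A 2) v + 2 * deg (lay T A 1) v : ℕ) : ℤ) :=
    sum_le_sum fun v hv => by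
      have := hL v (mem_ofDeg.1 hv).1
      omega
  have hd : Disjoint (ofDeg T (A \ A') 4) (ofDeg T (A \ A') 5) := by
    rw [disjoint_left]
    intro v hv hv'
    have h1 := (mem_ofDeg.1 hv).2
    have h2 := (mem_ofDeg.1 hv').2
    omega
  have hB : ∀ v ∈ ofDeg T (A \ A') 4 ∪ ofDeg T (A \ A') 5, v ∈ inner T ∧ deg T v ≤ 5 := by
    intro v hv
    rcases mem_union.1 hv with hv | hv <;> obtain ⟨hv, hd⟩ := mem_ofDeg.1 hv <;>
      exact ⟨h.mem_inner hv, by omega⟩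
  have h6 := hT.sum_deg_le hB (𝒰 := lay T A 1) (filter_subset _ _)
  have h7 := hT.sum_deg_le hB (𝒰 := lay T A 2) (filter_subset _ _)
  rw [sum_union hd] at h6 h7
  have h8 : ∀ k, ∑ v ∈ ofDeg T (A \ A') k, (deg (lay T A 2) v + 2 * deg (lay T A 1) v) =
      ∑ v ∈ ofDeg T (A \ A') k, deg (lay T A 2) v +
        2 * ∑ v ∈ ofDeg T (A \ A') k, deg (lay T A 1) v := fun k => by
    rw [sum_add_distrib, mul_sum]
  rw [← Nat.cast_sum, h8] at h4 h5
  omega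

/-- A vertex of the bottom level with a neighbour in `A` lies on two triangles with exactly two
vertices in `A`, and such a triangle has both of these at the bottom level. -/
theorem IsLayer.card_level_le (hT : IsTame T) (h : IsLayer T A A') :
    #(A \ A') ≤ #(lay T A 2) + #(isos T A A') := by
  have h1 := h.sum_deg_lay hT.disc (k := 2) (by norm_num)
  have h2 : ∑ v ∈ (A \ A') \ isos T A A', 2 ≤ ∑ v ∈ A \ A', deg (lay T A 2) v :=
    (sum_le_sum fun v hv => h.two_le_of_not_iso hT (mem_sdiff.1 hv).1 (mem_sdiff.1 hv).2).trans
      (sum_le_sum_of_subset sdiff_subset)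
  rw [sum_const, smul_eq_mul] at h2
  have hi : isos T A A' ⊆ A \ A' := filter_subset _ _
  have h3 := card_sdiff_add_card_eq_card hi
  omega

end

section
/-! ### The potential and the final count -/

variable {W : Type*} {T : Finset (Finset W)}

/-- The vertices of degree `4` at distance `k` from the boundary with a neighbour at distance
`k + 1`; there is no such vertex for `k = 0`, as boundary vertices are not counted. -/
def outerFour (T : Finset (Finset W)) : ℕ → Finset W
  | 0 => ∅
  | k + 1 => upFour T (layers T k) (layers T (k + 1))

/-- The potential of a layer, which controls its size and that of the later layers. In
`IsLayer.step`, a vertex of degree `5` lowers the growth by `1` at every level before its own and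
raises it by at most `3` at its own level; so its weight is built up in three steps and spent when
its level is passed. -/
def potential (T : Finset (Finset W)) (k : ℕ) : ℤ :=
  4 * ((#(lay T (layers T k) 1) : ℤ) - eul T (layers T k)) - 2 * #(outerFour T k) +
    (min k 3 : ℕ) * #(ofDeg T (layers T k) 5)

theorem IsTame.outerFour_spec (hT : IsTame T) (k : ℕ) : ∀ v ∈ outerFour T k,
    v ∈ innerFour T ∧ v ∉ layers T k ∧ (∃ w ∈ layers T k, Nbr T v w) ∧
      2 ≤ deg (lay T (layers T k) 1) v := by
  cases k with
  | zero => intro v hv; exact absurd hv (notMem_empty v)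
  | succ k => exact fun v hv => (hT.disc.isLayer k).upFour_spec hT hv

/-- Two thirds of the potential bound the number of vertices at distance exactly `k + 1` from the
boundary, and the potential of a nonempty layer is at least `4`. -/
theorem IsTame.card_layer_le (hT : IsTame T) {k : ℕ} (hk : (layers T k).Nonempty) :
    3 * (#(layers T k) : ℤ) ≤ 3 * #(layers T (k + 1)) + 2 * potential T k ∧
      4 ≤ potential T k := by
  have h := hT.disc.isLayer k
  have h1 := h.card_lay_one_ge hT fun v hv =>
    ⟨(hT.outerFour_spec k v hv).1, (hT.outerFour_spec k v hv).2.1,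
      (hT.outerFour_spec k v hv).2.2.2⟩
  have h2 := h.card_lay_two_le hT
  have h3 := h.card_level_le hT
  have h4 := (h.card_components_le hT).1
  have h5 := h.two_le_eul hT.disc hk
  have h6 := card_sdiff_add_card_eq_card h.subset
  have h7 : (0 : ℤ) ≤ (min k 3 : ℕ) * #(ofDeg T (layers T k) 5) := by positivity
  rw [potential]
  omega

/-- The potential grows at most by the factor `5 / 4` in each of the first three steps, where the
weight of the vertices of degree `5` is still less than `3`, and decreases by at least `24` in each
later step. -/
theorem IsTame.potential_succ_le (hT : IsTame T) {k : ℕ} (hk : (layers T (k + 1)).Nonempty) :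
    (k ≤ 2 → 4 * potential T (k + 1) + 88 ≤ 5 * potential T k) ∧
      (3 ≤ k → potential T (k + 1) + 24 ≤ potential T k) := by
  have h := hT.disc.isLayer k
  have h0 := h.step hT fun v hv =>
    ⟨(hT.outerFour_spec k v hv).1, (hT.outerFour_spec k v hv).2.1,
      (hT.outerFour_spec k v hv).2.2.1⟩
  have h1 := h.card_lay_one_ge hT fun v hv =>
    ⟨(hT.outerFour_spec k v hv).1, (hT.outerFour_spec k v hv).2.1,
      (hT.outerFour_spec k v hv).2.2.2⟩
  have h2 := (h.card_components_le hT).2 hk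
  have h3 := h.two_le_eul hT.disc (hk.mono h.subset)
  have h4 := weightFive_le_sum (T := T) (A := layers T k) (A' := layers T (k + 1))
  have h5 := weightFive_le_card (T := T) (A := layers T k) (A' := layers T (k + 1))
  have h6 : #(ofDeg T (layers T k) 5) =
      #(ofDeg T (layers T k \ layers T (k + 1)) 5) + #(ofDeg T (layers T (k + 1)) 5) := by
    rw [ofDeg, ofDeg, ofDeg, ← card_union_of_disjoint (disjoint_filter_filter sdiff_disjoint),
      ← filter_union, sdiff_union_of_subset h.subset]
  have h7 : outerFour T (k + 1) = upFour T (layers T k) (layers T (k + 1)) := rfl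
  rw [potential, potential, h7, h6]
  constructor
  · intro hk2
    rw [min_eq_left (by omega), min_eq_left (by omega)]
    push_cast
    obtain hk | hk | hk : (k : ℤ) = 0 ∨ (k : ℤ) = 1 ∨ (k : ℤ) = 2 := by omega
    all_goals
      rw [hk]
      omega
  · intro hk3
    rw [min_eq_right hk3, min_eq_right (by omega)]
    push_cast
    omega

/-- Far from the boundary the potential decreases linearly, so that the sizes of the layers sum up
to a quadratic expression. -/
theorem IsTame.card_layers_le_of_three_le (hT : IsTame T) {k : ℕ} (hk : 3 ≤ k) :
    (layers T k).Nonempty → 72 * (#(layers T k) : ℤ) ≤ (potential T k + 12) ^ 2 := by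
  suffices H : ∀ m : ℕ, ∀ k, 3 ≤ k → (layers T k).Nonempty → potential T k ≤ 24 * m →
      72 * (#(layers T k) : ℤ) ≤ (potential T k + 12) ^ 2 from
    fun hne => H (potential T k).toNat k hk hne (by omega)
  intro m
  induction m with
  | zero =>
    intro k _ hne h
    have := (hT.card_layer_le hne).2
    push_cast at h
    omega
  | succ m ih =>
    intro k hk hne h
    obtain ⟨h1, h2⟩ := hT.card_layer_le hne
    rcases (layers T (k + 1)).eq_empty_or_nonempty with he | hne'
    · rw [he, card_empty] at h1
      push_cast at h1
      nlinarith [sq_nonneg (potential T k - 12)]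
    · have h3 := (hT.potential_succ_le hne').2 hk
      have h4 := (hT.card_layer_le hne').2
      have h5 := ih (k + 1) (by omega) hne' (by push_cast at h; omega)
      nlinarith

/-- The quadratic bound for layers far from the boundary is carried through the first three steps
by completing squares. -/
theorem IsTame.card_inner_le (hT : IsTame T) {N : ℤ} (hN : 1 ≤ N)
    (h0 : (inner T).Nonempty → potential T 0 ≤ 4 * N) :
    N + 2 * (#(inner T) : ℤ) < 3 * (N + 2) ^ 2 := by
  rcases (inner T).eq_empty_or_nonempty with he | hne0
  · rw [he, card_empty]; push_cast; nlinarith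
  have h0 := h0 hne0
  obtain ⟨a1, a2⟩ := hT.card_layer_le (k := 0) hne0
  have e0 : layers T 0 = inner T := rfl
  rw [e0, zero_add] at a1
  rcases (layers T 1).eq_empty_or_nonempty with he | hne1
  · rw [he, card_empty] at a1; push_cast at a1; nlinarith
  have s0 : 4 * potential T 1 + 88 ≤ 5 * potential T 0 :=
    (hT.potential_succ_le hne1).1 (by norm_num)
  obtain ⟨b1, b2⟩ := hT.card_layer_le hne1
  rw [one_add_one_eq_two] at b1
  -- the estimate of `layers T 2`
  have key2 : (layers T 2).Nonempty →
      72 * 16 * (#(layers T 2) : ℤ) ≤ (5 * potential T 2 + 40) ^ 2 := by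
    intro hne2
    obtain ⟨c1, c2⟩ := hT.card_layer_le hne2
    rcases (layers T 3).eq_empty_or_nonempty with he | hne3
    · rw [he, card_empty] at c1; push_cast at c1; nlinarith [sq_nonneg (5 * potential T 2 - 40)]
    have s2 : 4 * potential T 3 + 88 ≤ 5 * potential T 2 :=
      (hT.potential_succ_le hne3).1 (by norm_num)
    have d2 := (hT.card_layer_le hne3).2
    have d3 := hT.card_layers_le_of_three_le le_rfl hne3
    have : (4 * (potential T 3 + 12)) ^ 2 ≤ (5 * potential T 2 - 40) ^ 2 :=
      pow_le_pow_left₀ (by omega) (by omega) 2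
    nlinarith
  have key1 : 72 * 256 * (#(layers T 1) : ℤ) ≤ (25 * potential T 1 + 192) ^ 2 := by
    rcases (layers T 2).eq_empty_or_nonempty with he | hne2
    · rw [he, card_empty] at b1; push_cast at b1; nlinarith [sq_nonneg (potential T 1)]
    have s1 : 4 * potential T 2 + 88 ≤ 5 * potential T 1 :=
      (hT.potential_succ_le hne2).1 (by norm_num)
    have c2 := (hT.card_layer_le hne2).2
    have := key2 hne2
    have : (4 * (5 * potential T 2 + 40)) ^ 2 ≤ (25 * potential T 1 - 280) ^ 2 :=
      pow_le_pow_left₀ (by omega) (by omega) 2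
    nlinarith
  -- the final coefficient of `N ^ 2` is `2 * 125 ^ 2 / (72 * 256) < 3`
  have key0 : (25 * potential T 1 + 192) ^ 2 ≤ (125 * N - 358) ^ 2 :=
    pow_le_pow_left₀ (by omega) (by omega) 2
  nlinarith

/-- Every boundary vertex lies on at least two boundary edges. -/
theorem IsDisc.card_verts_bd_le (hT : IsDisc T) : #(verts (bd 2 T)) ≤ #(bd 2 T) := by
  have hc : ∀ e ∈ bd 2 T, #e = 2 := fun e he => (mem_bd.1 he).1
  have h1 := sum_deg (bd 2 T) (verts (bd 2 T))
  rw [sum_congr (s₁ := bd 2 T) rfl (g := fun _ => 2), sum_const, smul_eq_mul] at h1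
  · have h2 : ∑ v ∈ verts (bd 2 T), 2 ≤ ∑ v ∈ verts (bd 2 T), deg (bd 2 T) v := by
      refine sum_le_sum fun v hv => ?_
      obtain ⟨e, he, hve⟩ := mem_verts.1 hv
      have h3 : 0 < deg (bd 2 T) v := card_pos.2 ⟨e, mem_filter.2 ⟨he, hve⟩⟩
      have h4 : {v} ∉ bd 1 (bd 2 T) := by rw [bd_one_bd_two hT.card_eq]; exact notMem_empty _
      rw [mem_bd, card_singleton] at h4
      simp only [singleton_subset_iff, true_and, Nat.not_odd_iff_even] at h4
      obtain ⟨m, hm⟩ := h4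
      rw [deg] at h3 ⊢
      omega
    rw [sum_const, smul_eq_mul] at h2
    omega
  · intro e he
    rw [inter_eq_left.2 fun v hv => mem_verts.2 ⟨e, he, hv⟩, hc e he]

/-- Every edge lies in at most two triangles, and boundary edges lie in one. -/
theorem IsDisc.three_mul_card_add_le (hT : IsDisc T) :
    3 * #T + #(bd 2 T) ≤ 2 * #(edges T) := by
  have h := sum_card_bipartiteAbove_eq_sum_card_bipartiteBelow (s := edges T) (t := T)
    (fun e t => e ⊆ t)
  rw [sum_congr (s₁ := T) rfl (g := fun _ => 3), sum_const, smul_eq_mul] at h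
  · have h2 : ∑ e ∈ edges T, (#(T.filter (e ⊆ ·)) + if e ∈ bd 2 T then 1 else 0) ≤
        ∑ e ∈ edges T, 2 := by
      refine sum_le_sum fun e he => ?_
      split_ifs with hb
      · rw [hT.card_filter_bd hb]
      · exact hT.edge_le e (DiscFilling.mem_edges.1 he).1
    rw [sum_add_distrib, sum_boole, sum_const, filter_mem_eq_inter,
      inter_eq_right.2 (bd_subset_edges T)] at h2
    simp only [bipartiteAbove] at h
    rw [h] at h2
    simp at h2
    omega
  · intro t ht
    have : (edges T).bipartiteBelow (fun e t => e ⊆ t) t = powersetCard 2 t := by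
      ext e
      simp only [mem_bipartiteBelow, mem_powersetCard, DiscFilling.mem_edges]
      exact ⟨fun h => ⟨h.2, h.1.1⟩, fun h => ⟨⟨h.2, t, ht, h.1⟩, h.1⟩⟩
    rw [this, card_powersetCard, hT.card_eq t ht]
    rfl

/-- Euler's formula gives the area in terms of the boundary length and the number of inner
vertices. -/
theorem IsDisc.card_le (hT : IsDisc T) : #T + 2 ≤ #(bd 2 T) + 2 * #(inner T) := by
  have h1 := hT.euler
  have h2 := hT.three_mul_card_add_le
  have h3 := hT.card_verts_bd_le
  have h4 := card_sdiff_add_card_eq_card (verts_bd_subset T)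
  rw [← inner] at h4
  omega

/-- The isoperimetric inequality for discs with restricted degrees of the inner vertices. -/
theorem IsTame.card_lt (hT : IsTame T) : #T < 3 * #(bd 2 T) ^ 2 := by
  have h1 := hT.disc.card_le
  have h3 : 3 ≤ #(bd 2 T) := three_le_card_of_bd_eq hT.disc.bd_nonempty
    (fun e he => (mem_bd.1 he).1) (bd_one_bd_two hT.disc.card_eq)
  -- by Euler's formula the initial potential is at most `4 * (#(bd 2 T) - 2)`
  have h4 := hT.card_inner_le (N := #(bd 2 T) - 2) (by omega) (fun hne => by
    have h5 : #(lay T (layers T 0) 1) + #(lay T (layers T 0) 2) + #(lay T (layers T 0) 3) ≤ #T := by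
      simp only [lay, card_filter, ← sum_add_distrib]
      rw [card_eq_sum_ones]
      refine sum_le_sum fun t _ => ?_
      split_ifs <;> omega
    have e0 : layers T 0 = inner T := rfl
    rw [e0] at h5
    rw [potential, eul, outerFour, e0]
    simp
    omega)
  zify
  rw [sub_add_cancel] at h4
  omega

end

section
/-! ### Complexes generated by triangles -/

variable {W : Type*} {T : Finset (Finset W)}

/-- The simplicial complex generated by a family of finite sets. -/
def complexOf (T : Finset (Finset W)) : PreAbstractSimplicialComplex W where
  faces := {s | s.Nonempty ∧ ∃ t ∈ T, s ⊆ t}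
  isRelLowerSet_faces := fun _ hs =>
    ⟨hs.1, fun _ hts ht => ⟨ht, hs.2.imp fun _ h => ⟨h.1, hts.trans h.2⟩⟩⟩

theorem mem_complexOf {s : Finset W} :
    s ∈ (complexOf T).faces ↔ s.Nonempty ∧ ∃ t ∈ T, s ⊆ t := Iff.rfl

theorem simplices_complexOf {k : ℕ} (hT : ∀ t ∈ T, #t = k + 1) :
    (complexOf T).simplices k = T := by
  ext s
  rw [mem_coe]
  constructor
  · rintro ⟨⟨_, t, ht, hst⟩, hs⟩
    rwa [eq_of_subset_of_card_le hst (by rw [hT t ht, hs])]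
  · intro hs
    exact ⟨⟨card_pos.1 (by rw [hT s hs]; omega), s, hs, Subset.rfl⟩, hT s hs⟩

theorem simplices_one_complexOf : (complexOf T).simplices 1 = edges T := by
  ext s
  rw [mem_coe, mem_edges]
  constructor
  · rintro ⟨⟨_, h⟩, hs⟩; exact ⟨hs, h⟩
  · rintro ⟨hs, h⟩; exact ⟨⟨card_pos.1 (by omega), h⟩, hs⟩

theorem isVertex_complexOf {v : W} : (complexOf T).IsVertex v ↔ v ∈ verts T := by
  rw [PreAbstractSimplicialComplex.IsVertex, mem_complexOf, mem_verts]
  simp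

theorem simplices_zero_complexOf :
    (complexOf T).simplices 0 = ((verts T).image singleton : Finset (Finset W)) := by
  ext s
  rw [mem_coe, mem_image]
  constructor
  · rintro ⟨hs, hs1⟩
    obtain ⟨v, rfl⟩ := card_eq_one.1 hs1
    exact ⟨v, isVertex_complexOf.1 hs, rfl⟩
  · rintro ⟨v, hv, rfl⟩
    exact ⟨isVertex_complexOf.2 hv, card_singleton v⟩

theorem ncard_simplices_zero : ((complexOf T).simplices 0).ncard = #(verts T) := by
  rw [simplices_zero_complexOf, Set.ncard_coe_finset, card_image_of_injective _
    singleton_injective]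

theorem ncard_simplices_one : ((complexOf T).simplices 1).ncard = #(edges T) := by
  rw [simplices_one_complexOf, Set.ncard_coe_finset]

theorem area_complexOf (hT : ∀ t ∈ T, #t = 3) : (complexOf T).area = #T := by
  rw [PreAbstractSimplicialComplex.area, simplices_complexOf hT, Set.ncard_coe_finset]

theorem ncard_cofaces (hT : ∀ t ∈ T, #t = 3) (e : Finset W) :
    {t | t ∈ (complexOf T).simplices 2 ∧ e ⊆ t}.ncard = #(T.filter (e ⊆ ·)) := by
  rw [simplices_complexOf hT, ← Set.ncard_coe_finset]
  congr 1
  ext t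
  simp

theorem adj_complexOf {a b : W} : (complexOf T).oneSkeleton.Adj a b ↔ Nbr T a b := by
  constructor
  · rintro ⟨hab, _, t, ht, h⟩
    exact ⟨hab, t, ht, pair_subset_iff.1 h⟩
  · rintro ⟨hab, t, ht, h⟩
    exact ⟨hab, insert_nonempty _ _, t, ht, pair_subset_iff.2 h⟩

theorem isVertex_link {v w : W} : ((complexOf T).link {v}).IsVertex w ↔ Nbr T v w := by
  constructor
  · rintro ⟨_, hd, _, t, ht, h⟩
    rw [union_subset_iff, singleton_subset_iff, singleton_subset_iff] at h
    rw [disjoint_singleton] at hd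
    exact ⟨hd.symm, t, ht, h.2, h.1⟩
  · rintro ⟨hvw, t, ht, hv, hw⟩
    refine ⟨singleton_nonempty w, disjoint_singleton.2 hvw.symm,
      (singleton_nonempty w).mono subset_union_left, t, ht, ?_⟩
    rw [union_subset_iff, singleton_subset_iff, singleton_subset_iff]
    exact ⟨hw, hv⟩

theorem adj_link {v a b : W} : ((complexOf T).link {v}).oneSkeleton.Adj a b ↔
    a ≠ b ∧ v ≠ a ∧ v ≠ b ∧ ∃ t ∈ T, v ∈ t ∧ a ∈ t ∧ b ∈ t := by
  constructor
  · rintro ⟨hab, _, hd, _, t, ht, h⟩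
    rw [union_subset_iff, singleton_subset_iff, pair_subset_iff] at h
    rw [disjoint_singleton_right, mem_insert, mem_singleton, not_or] at hd
    exact ⟨hab, hd.1, hd.2, t, ht, h.2, h.1⟩
  · rintro ⟨hab, hva, hvb, t, ht, hv, h⟩
    refine ⟨hab, insert_nonempty _ _, ?_, (insert_nonempty _ _).mono subset_union_left, t, ht, ?_⟩
    · rw [disjoint_singleton_right, mem_insert, mem_singleton, not_or]
      exact ⟨hva, hvb⟩
    · rw [union_subset_iff, singleton_subset_iff, pair_subset_iff]
      exact ⟨h, hv⟩

theorem exists_ne_of_mem {t : Finset W} (ht : #t = 3) (v : W) : ∃ x ∈ t, v ≠ x := by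
  obtain ⟨x, hx⟩ := card_pos.1 (by have := pred_card_le_card_erase (s := t) (a := v); omega :
    0 < #(t.erase v))
  exact ⟨x, mem_of_mem_erase hx, (ne_of_mem_erase hx).symm⟩

/-- Connectedness of the link of `v`, in terms of the triangles at `v`. -/
theorem isConnected_link_iff (hT : ∀ t ∈ T, #t = 3) {v : W} (hv : v ∈ verts T) :
    ((complexOf T).link {v}).IsConnected ↔ ∀ S ⊆ T, (∃ t ∈ S, v ∈ t) →
      (∀ t ∈ S, ∀ t' ∈ T, ∀ e : Finset W, e.card = 2 → v ∈ e → e ⊆ t → e ⊆ t' → t' ∈ S) →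
      ∀ t ∈ T, v ∈ t → t ∈ S := by
  constructor
  · rintro ⟨_, hr⟩ S hS ⟨t₀, ht₀, hvt₀⟩ hcl t ht hvt
    have hcl' : ∀ t ∈ S, ∀ x ∈ t, v ∈ t → v ≠ x → ∀ t' ∈ T, v ∈ t' → x ∈ t' → t' ∈ S :=
      fun t ht x hx hv hvx t' ht' hv' hx' => hcl t ht t' ht' {v, x} (card_pair hvx)
        (mem_insert_self _ _) (pair_subset_iff.2 ⟨hv, hx⟩) (pair_subset_iff.2 ⟨hv', hx'⟩)
    obtain ⟨a, ha, hva⟩ := exists_ne_of_mem (hT t₀ (hS ht₀)) v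
    obtain ⟨b, hb, hvb⟩ := exists_ne_of_mem (hT t ht) v
    obtain ⟨p⟩ := hr a b (isVertex_link.2 ⟨hva, t₀, hS ht₀, hvt₀, ha⟩)
      (isVertex_link.2 ⟨hvb, t, ht, hvt, hb⟩)
    have key : ∀ x y, ∀ q : ((complexOf T).link {v}).oneSkeleton.Walk x y,
        (∀ t ∈ T, v ∈ t → x ∈ t → t ∈ S) → ∀ t ∈ T, v ∈ t → y ∈ t → t ∈ S := by
      intro x y q
      induction q with
      | nil => exact id
      | cons h q ih =>
        intro hx
        obtain ⟨_, _, hvy, t', ht', hv', hx', hy'⟩ := adj_link.1 h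
        exact ih fun t ht hvt hyt =>
          hcl' t' (hx t' ht' hv' hx') _ hy' hv' hvy t ht hvt hyt
    exact key a b p (fun t ht hvt hat => hcl' t₀ ht₀ a ha hvt₀ hva t ht hvt hat) t ht hvt hb
  · intro h
    obtain ⟨t₀, ht₀, hvt₀⟩ := mem_verts.1 hv
    obtain ⟨x₀, hx₀, hvx₀⟩ := exists_ne_of_mem (hT t₀ ht₀) v
    refine ⟨⟨x₀, isVertex_link.2 ⟨hvx₀, t₀, ht₀, hvt₀, hx₀⟩⟩, fun a b ha hb => ?_⟩
    set G := ((complexOf T).link {v}).oneSkeleton with hG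
    obtain ⟨hva, t₁, ht₁, hvt₁, hat₁⟩ := isVertex_link.1 ha
    obtain ⟨hvb, t₂, ht₂, hvt₂, hbt₂⟩ := isVertex_link.1 hb
    have hstep : ∀ t ∈ T, v ∈ t → ∀ x ∈ t, v ≠ x → ∀ y ∈ t, v ≠ y → G.Reachable a x →
        G.Reachable a y := by
      intro t ht hvt x hx hvx y hy hvy hr
      by_cases hxy : x = y
      · exact hxy ▸ hr
      · exact hr.trans (adj_link.2 ⟨hxy, hvx, hvy, t, ht, hvt, hx, hy⟩ : G.Adj x y).reachable
    have h2 := h (T.filter fun t => v ∈ t ∧ ∃ x ∈ t, v ≠ x ∧ G.Reachable a x) (filter_subset _ _)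
      ⟨t₁, mem_filter.2 ⟨ht₁, hvt₁, a, hat₁, hva, SimpleGraph.Reachable.refl a⟩, hvt₁⟩ (by
        intro t ht t' ht' e he hve het het'
        obtain ⟨ht, hvt, x, hx, hvx, hr⟩ := mem_filter.1 ht
        obtain ⟨y, hvy, rfl⟩ := exists_pair_of_mem he hve
        rw [pair_subset_iff] at het het'
        exact mem_filter.2 ⟨ht', het'.1, y, het'.2, hvy, hstep t ht hvt x hx hvx y het.2 hvy hr⟩)
      t₂ ht₂ hvt₂
    obtain ⟨_, _, x, hx, hvx, hr⟩ := mem_filter.1 h2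
    exact hstep t₂ ht₂ hvt₂ x hx hvx b hbt₂ hvb hr

theorem isBoundaryEdge_complexOf (hT : ∀ t ∈ T, #t = 3)
    (h2 : ∀ e : Finset W, #e = 2 → #(T.filter (e ⊆ ·)) ≤ 2) {e : Finset W} :
    (complexOf T).IsBoundaryEdge e ↔ e ∈ bd 2 T := by
  rw [PreAbstractSimplicialComplex.IsBoundaryEdge, ncard_cofaces hT, simplices_one_complexOf,
    mem_coe, mem_edges, mem_bd]
  constructor
  · rintro ⟨⟨he, _⟩, h1⟩
    exact ⟨he, by rw [h1]; exact odd_one⟩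
  · rintro ⟨he, h1⟩
    have := h2 e he
    rw [Nat.odd_iff] at h1
    obtain ⟨t, ht⟩ := card_pos.1 (by omega : 0 < #(T.filter (e ⊆ ·)))
    exact ⟨⟨he, t, mem_filter.1 ht⟩, by omega⟩

theorem edge_le_two (hT : ∀ t ∈ T, #t = 3)
    (h : ∀ e ∈ (complexOf T).simplices 1,
      {t | t ∈ (complexOf T).simplices 2 ∧ e ⊆ t}.ncard ≤ 2) (e : Finset W) (he : #e = 2) :
    #(T.filter (e ⊆ ·)) ≤ 2 := by
  by_cases h0 : T.filter (e ⊆ ·) = ∅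
  · rw [h0]; simp
  · obtain ⟨t, ht⟩ := nonempty_iff_ne_empty.2 h0
    rw [← ncard_cofaces hT]
    apply h
    rw [simplices_one_complexOf, mem_coe, mem_edges]
    exact ⟨he, t, mem_filter.1 ht⟩

/-- A triangulated disc satisfies the homological description of discs: acyclicity comes from
the Euler characteristic. -/
theorem isDisc_of_isTriangulatedDisc (hT : ∀ t ∈ T, #t = 3)
    (h : (complexOf T).IsTriangulatedDisc) : IsDisc T := by
  have h2 := edge_le_two hT h.edge
  have hb : (bd 2 T).Nonempty :=
    h.exists_boundary.imp fun e he => (isBoundaryEdge_complexOf hT h2).1 he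
  have hlink : ∀ v ∈ verts T, ∀ S ⊆ T, (∃ t ∈ S, v ∈ t) →
      (∀ t ∈ S, ∀ t' ∈ T, ∀ e : Finset W, e.card = 2 → v ∈ e → e ⊆ t → e ⊆ t' → t' ∈ S) →
      ∀ t ∈ T, v ∈ t → t ∈ S := fun v hv =>
    (isConnected_link_iff hT hv).1 (h.link_connected v (isVertex_complexOf.2 hv))
  -- by connectedness of links, a set closed under crossing edges is closed under passing to triangles
  -- with a common vertex
  have hconn : ∀ S ⊆ T, S.Nonempty →
      (∀ t ∈ S, ∀ t' ∈ T, ∀ e : Finset W, e.card = 2 → e ⊆ t → e ⊆ t' → t' ∈ S) → S = T := by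
    rintro S hS ⟨t₀, ht₀⟩ hcl
    refine Subset.antisymm hS fun t ht => ?_
    have hcl' : ∀ t ∈ S, ∀ x ∈ t, ∀ t' ∈ T, x ∈ t' → t' ∈ S := fun t ht x hx =>
      hlink x (mem_verts.2 ⟨t, hS ht, hx⟩) S hS ⟨t, ht, hx⟩
        fun t ht t' ht' e he _ het het' => hcl t ht t' ht' e he het het'
    obtain ⟨a, ha⟩ := card_pos.1 (by rw [hT t₀ (hS ht₀)]; norm_num : 0 < #t₀)
    obtain ⟨b, hb⟩ := card_pos.1 (by rw [hT t ht]; norm_num : 0 < #t)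
    obtain ⟨p⟩ := h.connected.2 a b (isVertex_complexOf.2 (mem_verts.2 ⟨t₀, hS ht₀, ha⟩))
      (isVertex_complexOf.2 (mem_verts.2 ⟨t, ht, hb⟩))
    have key : ∀ x y, ∀ q : (complexOf T).oneSkeleton.Walk x y,
        (∀ t ∈ T, x ∈ t → t ∈ S) → ∀ t ∈ T, y ∈ t → t ∈ S := by
      intro x y q
      induction q with
      | nil => exact id
      | cons h q ih =>
        intro hx
        obtain ⟨_, t', ht', hx', hy'⟩ := adj_complexOf.1 h
        exact ih (hcl' t' (hx t' ht' hx') _ hy')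
    exact key a b p (hcl' t₀ ht₀ a ha) t ht hb
  refine ⟨hT, h2, fun q hq S hS hne hcl t ht hqt => ?_, hb, ?_⟩
  · rcases card_le_one_cases hq with rfl | ⟨v, rfl⟩
    · obtain ⟨t₀, ht₀, _⟩ := hne
      rw [hconn S hS ⟨t₀, ht₀⟩ fun t ht t' ht' e he het het' =>
        hcl t ht t' ht' e he (empty_subset _) het het']
      exact ht
    · simp only [singleton_subset_iff] at hne hcl hqt
      exact hlink v (mem_verts.2 ⟨t, ht, hqt⟩) S hS hne hcl t ht hqt
  · obtain ⟨r, hr⟩ := h.connected.1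
    have hr := isVertex_complexOf.1 hr
    refine (euler_of_connected (A := verts T)
      (fun e he => ⟨(mem_edges.1 he).1, edges_subset_verts he⟩) Subset.rfl hT
      ⟨r, hr, exists_path_of_conn hconn hr⟩
      (fun S hS h => eq_empty_of_bd_eq_empty h2 hconn hb hS h)).2 ?_
    have he := h.euler
    rw [ncard_simplices_zero, ncard_simplices_one, simplices_complexOf hT,
      Set.ncard_coe_finset] at he
    omega

/-- Conversely, the complex generated by a disc in the homological sense is a triangulated disc. -/
theorem IsDisc.isTriangulatedDisc (hT : IsDisc T) : (complexOf T).IsTriangulatedDisc where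
  finite := by
    refine (T.biUnion powerset).finite_toSet.subset ?_
    rintro s ⟨_, t, ht, hst⟩
    exact mem_coe.2 (mem_biUnion.2 ⟨t, ht, mem_powerset.2 hst⟩)
  connected := by
    refine ⟨hT.verts_nonempty.imp fun v hv => isVertex_complexOf.2 hv, fun a b ha hb => ?_⟩
    obtain ⟨t₀, ht₀, hat₀⟩ := mem_verts.1 (isVertex_complexOf.1 ha)
    obtain ⟨t₁, ht₁, hbt₁⟩ := mem_verts.1 (isVertex_complexOf.1 hb)
    set G := (complexOf T).oneSkeleton with hG
    have hstep : ∀ t ∈ T, ∀ x ∈ t, ∀ y ∈ t, G.Reachable a x → G.Reachable a y := by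
      intro t ht x hx y hy hr
      by_cases hxy : x = y
      · exact hxy ▸ hr
      · exact hr.trans (adj_complexOf.2 ⟨hxy, t, ht, hx, hy⟩ : G.Adj x y).reachable
    have h := hT.eq_of_closed (T.filter fun t => ∃ x ∈ t, G.Reachable a x) (filter_subset _ _)
      ⟨t₀, mem_filter.2 ⟨ht₀, a, hat₀, SimpleGraph.Reachable.refl a⟩⟩ (by
        intro t ht t' ht' e he het het'
        obtain ⟨ht, x, hx, hr⟩ := mem_filter.1 ht
        obtain ⟨y, hy⟩ := card_pos.1 (by omega : 0 < #e)
        exact mem_filter.2 ⟨ht', y, het' hy, hstep t ht x hx y (het hy) hr⟩)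
    rw [← h] at ht₁
    obtain ⟨ht₁, x, hx, hr⟩ := mem_filter.1 ht₁
    exact hstep t₁ ht₁ x hx b hbt₁ hr
  pure s hs := by
    obtain ⟨_, t, ht, hst⟩ := hs
    exact ⟨t, by rw [simplices_complexOf hT.card_eq]; exact ht, hst⟩
  edge e he := by
    rw [ncard_cofaces hT.card_eq]
    exact hT.edge_le e he.2
  link_connected v hv := by
    rw [isConnected_link_iff hT.card_eq (isVertex_complexOf.1 hv)]
    simpa only [singleton_subset_iff] using hT.conn {v} (by simp)
  exists_boundary := hT.bd_nonempty.imp fun e he =>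
    (isBoundaryEdge_complexOf hT.card_eq hT.edge_le).2 he
  euler := by
    have := hT.euler
    rw [ncard_simplices_zero, ncard_simplices_one, simplices_complexOf hT.card_eq,
      Set.ncard_coe_finset]
    omega

theorem IsDisc.boundary_complexOf (hT : IsDisc T) :
    (complexOf T).boundary = complexOf (bd 2 T) := by
  ext s
  simp only [PreAbstractSimplicialComplex.boundary, complexOf,
    ← isBoundaryEdge_complexOf hT.card_eq hT.edge_le]

theorem walkComplex_eq {G : SimpleGraph W} {a b : W} (p : G.Walk a b) :
    PreAbstractSimplicialComplex.walkComplex p = complexOf (walkEdges p) := by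
  ext s
  simp only [PreAbstractSimplicialComplex.walkComplex, complexOf, Set.mem_ofPred_eq]
  refine and_congr_right fun _ => ⟨?_, ?_⟩
  · rintro ⟨x, y, h, hs⟩
    exact ⟨{x, y}, pair_mem_walkEdges.2 h, hs⟩
  · rintro ⟨e, he, hs⟩
    obtain ⟨x, y, rfl, h, _⟩ := exists_of_mem_walkEdges he
    exact ⟨x, y, h, hs⟩

theorem complexOf_injOn {k : ℕ} {S S' : Finset (Finset W)} (hS : ∀ t ∈ S, #t = k + 1)
    (hS' : ∀ t ∈ S', #t = k + 1) (h : complexOf S = complexOf S') : S = S' := by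
  rw [← coe_inj, ← simplices_complexOf hS, ← simplices_complexOf hS', h]

/-- The `2`-simplices of a triangulated disc. -/
def triangles {D : PreAbstractSimplicialComplex W} (hD : D.IsTriangulatedDisc) :
    Finset (Finset W) := hD.finite.toFinset.filter (#· = 3)

theorem mem_triangles {D : PreAbstractSimplicialComplex W} (hD : D.IsTriangulatedDisc)
    {t : Finset W} : t ∈ triangles hD ↔ t ∈ D.faces ∧ #t = 3 := by
  rw [triangles, mem_filter, Set.Finite.mem_toFinset]

theorem complexOf_triangles {D : PreAbstractSimplicialComplex W} (hD : D.IsTriangulatedDisc) :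
    complexOf (triangles hD) = D := by
  ext s
  rw [mem_complexOf]
  constructor
  · rintro ⟨hs, t, ht, hst⟩
    exact (D.isRelLowerSet_faces ((mem_triangles hD).1 ht).1).2 hst hs
  · intro hs
    obtain ⟨t, ht, hst⟩ := hD.pure s hs
    exact ⟨(D.isRelLowerSet_faces hs).1, t, (mem_triangles hD).2 ht, hst⟩

theorem isDisc_triangles {D : PreAbstractSimplicialComplex W} (hD : D.IsTriangulatedDisc) :
    IsDisc (triangles hD) :=
  isDisc_of_isTriangulatedDisc (fun _ ht => ((mem_triangles hD).1 ht).2)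
    ((complexOf_triangles hD).symm ▸ hD)

end

section

/-! ### Transport and the isoperimetric inequality for filling diagrams -/

section Map
variable {W : Type*} {W' : Type*} {ι : W → W'} {T S : Finset (Finset W)}

theorem card_filter_image (hι : Function.Injective ι) (s : Finset W) :
    #((S.image (image ι)).filter (s.image ι ⊆ ·)) = #(S.filter (s ⊆ ·)) := by
  rw [filter_image, card_image_of_injective _ (image_injective hι)]
  simp only [image_subset_image_iff hι]

theorem bd_image (hι : Function.Injective ι) (k : ℕ) :
    bd k (S.image (image ι)) = (bd k S).image (image ι) := by
  ext s'
  rw [mem_image]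
  constructor
  · intro h
    obtain ⟨t', ht', hst⟩ := exists_of_mem_bd h
    obtain ⟨t, ht, rfl⟩ := mem_image.1 ht'
    obtain ⟨s, hs, rfl⟩ := subset_image_iff.1 hst
    rw [mem_bd, card_image_of_injective _ hι, card_filter_image hι] at h
    exact ⟨s, mem_bd.2 h, rfl⟩
  · rintro ⟨s, hs, rfl⟩
    rw [mem_bd, card_image_of_injective _ hι, card_filter_image hι]
    exact mem_bd.1 hs

theorem verts_image : verts (S.image (image ι)) = (verts S).image ι := by
  ext v'
  rw [mem_verts, mem_image]
  constructor
  · rintro ⟨t', ht', hv'⟩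
    obtain ⟨t, ht, rfl⟩ := mem_image.1 ht'
    obtain ⟨v, hv, hvv'⟩ := mem_image.1 hv'
    exact ⟨v, mem_verts.2 ⟨t, ht, hv⟩, hvv'⟩
  · rintro ⟨v, hv, rfl⟩
    obtain ⟨t, ht, hv⟩ := mem_verts.1 hv
    exact ⟨_, mem_image_of_mem _ ht, mem_image_of_mem ι hv⟩

/-- Discs are preserved under injective relabelling of the vertices. -/
theorem IsDisc.image (hT : IsDisc T) (hι : Function.Injective ι) :
    IsDisc (T.image (image ι)) where
  card_eq t' ht' := by
    obtain ⟨t, ht, rfl⟩ := mem_image.1 ht'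
    rw [card_image_of_injective _ hι, hT.card_eq t ht]
  edge_le e' he' := by
    by_cases h0 : (T.image (Finset.image ι)).filter (e' ⊆ ·) = ∅
    · rw [h0]; simp
    · obtain ⟨t', ht'⟩ := nonempty_iff_ne_empty.2 h0
      obtain ⟨ht', het'⟩ := mem_filter.1 ht'
      obtain ⟨t, ht, rfl⟩ := mem_image.1 ht'
      obtain ⟨e, he, rfl⟩ := subset_image_iff.1 het'
      rw [card_filter_image hι]
      exact hT.edge_le e (by rwa [card_image_of_injective _ hι] at he')
  conn q' hq' S' hS' hne hcl t' ht' hqt' := by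
    obtain ⟨S, hS, rfl⟩ := subset_image_iff.1 hS'
    obtain ⟨t₀', ht₀', hqt₀'⟩ := hne
    obtain ⟨t₀, ht₀, rfl⟩ := mem_image.1 ht₀'
    obtain ⟨q, hq, rfl⟩ := subset_image_iff.1 hqt₀'
    obtain ⟨t, ht, rfl⟩ := mem_image.1 ht'
    refine mem_image_of_mem _ (hT.conn q (by rwa [card_image_of_injective _ hι] at hq') S hS
      ⟨t₀, ht₀, hq⟩ (fun t ht t' ht' e he hqe het het' => ?_) t ht ?_)
    · have := hcl _ (mem_image_of_mem _ ht) _ (mem_image_of_mem _ ht') (e.image ι)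
        (by rw [card_image_of_injective _ hι, he]) (image_subset_image hqe)
        (image_subset_image het) (image_subset_image het')
      exact (image_injective hι).mem_finset_image.1 this
    · exact (image_subset_image_iff hι).1 hqt'
  bd_nonempty := by
    rw [bd_image hι 2]
    exact hT.bd_nonempty.image _
  acyclic z' hz' hz0 := by
    obtain ⟨z, rfl⟩ : ∃ z : Finset (Finset W), z' = z.image (Finset.image ι) := by
      refine ⟨(edges T).filter fun e => e.image ι ∈ z', ?_⟩
      ext e'
      rw [mem_image]
      constructor
      · intro he'
        obtain ⟨h2, t', ht', het'⟩ := mem_edges.1 (hz' he')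
        obtain ⟨t, ht, rfl⟩ := mem_image.1 ht'
        obtain ⟨e, he, rfl⟩ := subset_image_iff.1 het'
        rw [card_image_of_injective _ hι] at h2
        exact ⟨e, mem_filter.2 ⟨mem_edges.2 ⟨h2, t, ht, he⟩, he'⟩, rfl⟩
      · rintro ⟨e, he, rfl⟩
        exact (mem_filter.1 he).2
    rw [bd_image hι 1, image_eq_empty] at hz0
    obtain ⟨S, hS, hb⟩ := hT.acyclic z (fun e he => by
      obtain ⟨h2, t', ht', het'⟩ := mem_edges.1 (hz' (mem_image_of_mem _ he))
      obtain ⟨t, ht, rfl⟩ := mem_image.1 ht'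
      rw [card_image_of_injective _ hι] at h2
      exact mem_edges.2 ⟨h2, t, ht, (image_subset_image_iff hι).1 het'⟩) hz0
    exact ⟨S.image (Finset.image ι), image_subset_image hS, by
      rw [bd_image hι 2, hb]⟩

theorem map_complexOf {V : Type*} (f : W → V) :
    (complexOf S).map f = complexOf (S.image (Finset.image f)) := by
  ext s
  simp only [PreAbstractSimplicialComplex.map, mem_complexOf, Set.mem_image]
  constructor
  · rintro ⟨s, ⟨hs, t, ht, hst⟩, rfl⟩
    exact ⟨hs.image f, _, mem_image_of_mem _ ht, image_subset_image hst⟩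
  · rintro ⟨hs, t', ht', hst⟩
    obtain ⟨t, ht, rfl⟩ := mem_image.1 ht'
    obtain ⟨s, hs', rfl⟩ := subset_image_iff.1 hst
    exact ⟨s, ⟨image_nonempty.1 hs, t, ht, hs'⟩, rfl⟩

end Map

section Located
variable {V : Type*} {W : Type*} {X : PreAbstractSimplicialComplex V}

/-- Two points are near if they are equal or adjacent. -/
def Near (X : PreAbstractSimplicialComplex V) (a b : V) : Prop := a = b ∨ X.oneSkeleton.Adj a b

theorem Near.symm {a b : V} (h : Near X a b) : Near X b a := by
  rcases h with rfl | h
  exacts [Or.inl rfl, Or.inr h.symm]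

theorem isVertex_of_mem {s : Finset V} (hs : s ∈ X.faces) {v : V} (hv : v ∈ s) : X.IsVertex v :=
  (X.isRelLowerSet_faces hs).2 (singleton_subset_iff.2 hv) (singleton_nonempty v)

theorem near_of_mem {s : Finset V} (hs : s ∈ X.faces) {a b : V} (ha : a ∈ s) (hb : b ∈ s) :
    Near X a b := by
  by_cases hab : a = b
  · exact Or.inl hab
  · exact Or.inr ⟨hab, (X.isRelLowerSet_faces hs).2 (pair_subset_iff.2 ⟨ha, hb⟩)
      (insert_nonempty _ _)⟩

theorem Near.isVertex {a b : V} (h : Near X a b) (ha : X.IsVertex a) : X.IsVertex b := by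
  rcases h with rfl | h
  exacts [ha, isVertex_of_mem h.2 (by simp)]

/-- A circuit of length at least `4` contains at most two vertices of any set of pairwise adjacent
vertices. -/
theorem IsCircuit.not_triangle {β : Finset (Finset W)} (hβ : IsCircuit β) (h4 : 4 ≤ #β) {x y z : W}
    (hxy : x ≠ y) (hxz : x ≠ z) (hyz : y ≠ z) (h1 : {x, y} ∈ β) (h2 : {x, z} ∈ β)
    (h3 : {y, z} ∈ β) : False := by
  have hc : #({x, y, z} : Finset W) = 3 := card_eq_three.2 ⟨x, y, z, hxy, hxz, hyz, rfl⟩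
  have ht := isCircuit_triangle hc
  have hsub : powersetCard 2 ({x, y, z} : Finset W) ⊆ β := by
    intro e he
    obtain ⟨hes, he2⟩ := mem_powersetCard.1 he
    obtain ⟨a, b, hab, rfl⟩ := card_eq_two.1 he2
    rw [pair_subset_iff] at hes
    simp only [mem_insert, mem_singleton] at hes
    obtain ⟨rfl | rfl | rfl, rfl | rfl | rfl⟩ := hes <;>
      first | exact absurd rfl hab | assumption | (rw [pair_comm]; assumption)
  rcases hβ.minimal _ hsub ht.bd_eq with h | h
  · exact ht.nonempty.ne_empty h
  · have : #(powersetCard 2 ({x, y, z} : Finset W)) = 3 := by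
      rw [card_powersetCard, hc]; decide
    rw [h] at this
    omega

/-- A map of a circuit without near pairs other than its edges is injective. -/
theorem IsCircuit.injOn {β : Finset (Finset W)} (hβ : IsCircuit β) (h4 : 4 ≤ #β) {f : W → V}
    (hf : IsSimp (Near X) f β)
    (hch : ∀ x ∈ verts β, ∀ y ∈ verts β, Near X (f x) (f y) → x = y ∨ {x, y} ∈ β) :
    Set.InjOn f (verts β) := by
  intro x hx y hy hxy
  by_contra hne
  have he : {x, y} ∈ β := (hch x hx y hy (Or.inl hxy)).resolve_left hne
  obtain ⟨e, he', hne'⟩ := exists_mem_ne (by rw [hβ.card_filter hy]; norm_num :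
    1 < #(β.filter (y ∈ ·))) {x, y}
  obtain ⟨heβ, hye⟩ := mem_filter.1 he'
  obtain ⟨z, hyz, rfl⟩ := exists_pair_of_mem (hβ.card_eq e heβ) hye
  have hxz : x ≠ z := by rintro rfl; exact hne' (pair_comm _ _)
  have hz : z ∈ verts β := mem_verts.2 ⟨_, heβ, by simp⟩
  have hn : Near X (f x) (f z) := hxy ▸ hf _ heβ y (by simp) z (by simp)
  exact hβ.not_triangle h4 hne hxz hyz he ((hch x hx z hz hn).resolve_left hxz) heβ

theorem walkEdges_map {G : SimpleGraph W} {H : SimpleGraph V} (g : G →g H) {a b : W}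
    (p : G.Walk a b) : walkEdges (p.map g) = (walkEdges p).image (Finset.image g) := by
  ext e
  constructor
  · intro h
    obtain ⟨x', y', rfl, h, _⟩ := exists_of_mem_walkEdges h
    rw [SimpleGraph.Walk.edges_map, List.mem_map] at h
    obtain ⟨e, he, h⟩ := h
    induction e using Sym2.ind with
    | _ x y =>
      refine mem_image.2 ⟨{x, y}, pair_mem_walkEdges.2 he, ?_⟩
      rw [Sym2.map_mk] at h
      rw [image_insert, image_singleton, ← sym2_toFinset_mk, ← sym2_toFinset_mk, ← h]
  · intro h
    obtain ⟨e, he, rfl⟩ := mem_image.1 h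
    obtain ⟨x, y, rfl, h, _⟩ := exists_of_mem_walkEdges he
    rw [image_insert, image_singleton, pair_mem_walkEdges, SimpleGraph.Walk.edges_map,
      List.mem_map]
    exact ⟨s(x, y), h, rfl⟩

theorem mem_verts_of_mem_support {β : Finset (Finset W)} {a : W} {p : (edgeGraph β).Walk a a}
    (hp : p.IsCycle) {x : W} (hx : x ∈ p.support) : x ∈ verts β := by
  obtain ⟨e, he, hxe⟩ := (SimpleGraph.Walk.mem_support_iff_exists_mem_edges_of_not_nil hp.not_nil).1 hx
  induction e using Sym2.ind with
  | _ y z =>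
    refine mem_verts.2 ⟨{y, z}, (p.adj_of_mem_edges he).2, ?_⟩
    simpa using hxe

/-- In a simply connected `7`-located complex, nearness has the property needed for the
combinatorial argument. -/
theorem isNearLocated (hX : X.IsSimplyConnected) (hX7 : X.IsLocated 7) :
    IsNearLocated W (Near X) where
  refl _ := Or.inl rfl
  symm _ _ h := h.symm
  exists_center β f hβ h4 h7 hf hch := by
    have hinj := hβ.injOn h4 hf hch
    have hadj : ∀ {x y}, (edgeGraph β).Adj x y → X.oneSkeleton.Adj (f x) (f y) := by
      rintro x y ⟨hxy, he⟩
      refine (hf _ he x (by simp) y (by simp)).resolve_left fun h => hxy ?_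
      exact hinj (mem_verts.2 ⟨_, he, by simp⟩) (mem_verts.2 ⟨_, he, by simp⟩) h
    let g : edgeGraph β →g X.oneSkeleton := ⟨f, hadj⟩
    obtain ⟨a, p, hp, hpβ⟩ := hβ.exists_isCycle
    have hsupp : ∀ x ∈ p.support, x ∈ verts β := fun x hx => mem_verts_of_mem_support hp hx
    -- the image of the circuit is a cycle, since `f` is injective on its vertices
    have hcyc : (p.map g).IsCycle := by
      rw [SimpleGraph.Walk.isCycle_def, SimpleGraph.Walk.isTrail_def]
      refine ⟨?_, ?_, ?_⟩
      · rw [SimpleGraph.Walk.edges_map]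
        refine hp.edges_nodup.map_on fun e he e' he' h => ?_
        induction e using Sym2.ind with
        | _ x y =>
          induction e' using Sym2.ind with
          | _ z w =>
            have hx := hsupp x (p.fst_mem_support_of_mem_edges he)
            have hy := hsupp y (p.snd_mem_support_of_mem_edges he)
            have hz := hsupp z (p.fst_mem_support_of_mem_edges he')
            have hw := hsupp w (p.snd_mem_support_of_mem_edges he')
            rw [Sym2.map_mk, Sym2.map_mk, Sym2.eq_iff] at h
            rw [Sym2.eq_iff]
            exact h.imp (fun h => ⟨hinj hx hz h.1, hinj hy hw h.2⟩)
              (fun h => ⟨hinj hx hw h.1, hinj hy hz h.2⟩)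
      · intro h
        have h1 := congrArg SimpleGraph.Walk.length h
        rw [SimpleGraph.Walk.length_map, SimpleGraph.Walk.length_nil] at h1
        have h2 := hp.three_le_length
        omega
      · rw [SimpleGraph.Walk.support_map, ← List.map_tail]
        exact hp.support_nodup.map_on fun x hx y hy h =>
          hinj (hsupp x (List.mem_of_mem_tail hx)) (hsupp y (List.mem_of_mem_tail hy)) h
    have hwc : PreAbstractSimplicialComplex.walkComplex (p.map g) =
        complexOf (β.image (image f)) := by
      rw [walkComplex_eq, walkEdges_map, hpβ]
      rfl
    -- it is full: a simplex on three of its vertices would give a triangle of edges of `β`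
    have hfull : (complexOf (β.image (image f))).IsFullSubcomplex X := by
      constructor
      · rintro s ⟨hs, e', he', hse⟩
        obtain ⟨e, he, rfl⟩ := mem_image.1 he'
        obtain ⟨x, y, hxy, rfl⟩ := card_eq_two.1 (hβ.card_eq e he)
        rw [image_insert, image_singleton] at hse
        exact (X.isRelLowerSet_faces (hadj ⟨hxy, he⟩).2).2 hse hs
      · intro s hs hsv
        have hs' : s ⊆ (verts β).image f := by
          intro v hv
          rw [← verts_image]
          exact isVertex_complexOf.1 (hsv v hv)
        obtain ⟨r, hr, rfl⟩ := subset_image_iff.1 hs'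
        have hpair : ∀ x ∈ r, ∀ y ∈ r, x ≠ y → {x, y} ∈ β := fun x hx y hy hxy =>
          (hch x (hr hx) y (hr hy) (near_of_mem hs (mem_image_of_mem f hx)
            (mem_image_of_mem f hy))).resolve_left hxy
        refine ⟨(X.isRelLowerSet_faces hs).1, ?_⟩
        obtain ⟨x, hx⟩ := image_nonempty.1 (X.isRelLowerSet_faces hs).1
        by_cases h1 : ∃ y ∈ r, x ≠ y
        · obtain ⟨y, hy, hxy⟩ := h1
          refine ⟨_, mem_image_of_mem _ (hpair x hx y hy hxy), image_subset_image fun z hz => ?_⟩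
          by_contra hzxy
          rw [mem_insert, mem_singleton, not_or] at hzxy
          exact hβ.not_triangle h4 hxy (Ne.symm hzxy.1) (Ne.symm hzxy.2) (hpair x hx y hy hxy)
            (hpair x hx z hz (Ne.symm hzxy.1)) (hpair y hy z hz (Ne.symm hzxy.2))
        · push Not at h1
          obtain ⟨e, he, hxe⟩ := mem_verts.1 (hr hx)
          exact ⟨_, mem_image_of_mem _ he, image_subset_image fun z hz => h1 z hz ▸ hxe⟩
    obtain ⟨c, _, hc⟩ := hX7.2 _ (p.map g) hcyc (hwc ▸ hfull) (hX.2 _ _) (by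
      rw [SimpleGraph.Walk.length_map, ← card_walkEdges hp.isTrail, hpβ]
      exact h7)
    refine ⟨c, fun x hx => ?_⟩
    rw [hwc] at hc
    have hfx : {f x} ∈ (complexOf (β.image (image f))).faces :=
      isVertex_complexOf.2 (by rw [verts_image]; exact mem_image_of_mem f hx)
    have h1 := (hc hfx).2 (f x) (mem_singleton_self _)
    rw [Nat.cast_one, SimpleGraph.edist_le_one_iff_adj_or_eq] at h1
    exact h1.symm

/-- A map of a disc with near images of adjacent vertices is simplicial, by flagness, provided that
some vertex is mapped to a vertex. -/
theorem IsDisc.map_le {T : Finset (Finset W)} (hT : IsDisc T) (hX : X.IsFlag) {f : W → V}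
    (hf : IsSimp (Near X) f T) {v : W} (hv : v ∈ verts T) (hfv : X.IsVertex (f v)) :
    PreAbstractSimplicialComplex.IsSimplicialMap (complexOf T) X f := by
  obtain ⟨t₀, ht₀, hvt₀⟩ := mem_verts.1 hv
  have h := hT.eq_of_closed (T.filter fun t => ∃ x ∈ t, X.IsVertex (f x)) (filter_subset _ _)
    ⟨t₀, mem_filter.2 ⟨ht₀, v, hvt₀, hfv⟩⟩ (by
      intro t ht t' ht' e he het het'
      obtain ⟨ht, x, hx, hfx⟩ := mem_filter.1 ht
      obtain ⟨y, hy⟩ := card_pos.1 (by omega : 0 < #e)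
      exact mem_filter.2 ⟨ht', y, het' hy, (hf t ht x hx y (het hy)).isVertex hfx⟩)
  rw [PreAbstractSimplicialComplex.IsSimplicialMap]
  rintro _ ⟨s, ⟨hs, t, ht, hst⟩, rfl⟩
  rw [← h] at ht
  obtain ⟨ht, x, hx, hfx⟩ := mem_filter.1 ht
  refine hX _ (hs.image f) (fun a ha => ?_) fun a ha b hb hab => ?_
  · obtain ⟨y, hy, rfl⟩ := mem_image.1 ha
    exact (hf t ht x hx y (hst hy)).isVertex hfx
  · obtain ⟨y, hy, rfl⟩ := mem_image.1 ha
    obtain ⟨z, hz, rfl⟩ := mem_image.1 hb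
    exact (hf t ht y (hst hy) z (hst hz)).resolve_left hab

/-- A simplicial map sends the vertices of a triangle to pairwise near points. -/
theorem isSimp_of_isSimplicialMap {T : Finset (Finset W)} {f : W → V} (hT : ∀ t ∈ T, #t = 3)
    (h : PreAbstractSimplicialComplex.IsSimplicialMap (complexOf T) X f) :
    IsSimp (Near X) f T := by
  intro t ht x hx y hy
  refine near_of_mem (s := t.image f) (h ⟨t, ⟨?_, t, ht, Subset.rfl⟩, rfl⟩)
    (mem_image_of_mem f hx) (mem_image_of_mem f hy)
  exact card_pos.1 (by rw [hT t ht]; norm_num)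

end Located

section Minimal
variable {V : Type u} {W : Type w} {X : PreAbstractSimplicialComplex V}

/-- A minimal filling diagram, transported to a larger vertex type, has least area among the discs
on that type with the same boundary. -/
theorem isMin_image {W' : Type w} {ι : W → W'} (hι : Function.Injective ι) (hX7 : X.IsFlag)
    {a : V} {γ : X.oneSkeleton.Walk a a} {D : PreAbstractSimplicialComplex W} {f : W → V}
    (hD : X.IsMinimalFillingDiagram γ D f) :
    IsMin (Near X) ((triangles hD.1.disc).image (image ι)) (Function.extend ι f fun _ => a) := by
  have hDe := complexOf_triangles hD.1.disc
  have hT := isDisc_triangles hD.1.disc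
  set T := triangles hD.1.disc with hTdef
  set F := Function.extend ι f fun _ => a with hF
  have hFι : ∀ v, F (ι v) = f v := fun v => hι.extend_apply f _ v
  have hsimp : PreAbstractSimplicialComplex.IsSimplicialMap (complexOf T) X f := by
    rw [hDe]; exact hD.1.simplicial
  have hbd : D.boundary = complexOf (bd 2 T) := by rw [← hDe, hT.boundary_complexOf]
  refine ⟨hT.image hι, ?_, fun T' f' hT' hf' hb hff' => ?_⟩
  · intro t' ht' x' hx' y' hy'
    obtain ⟨t, ht, rfl⟩ := mem_image.1 ht'
    obtain ⟨x, hx, rfl⟩ := mem_image.1 hx'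
    obtain ⟨y, hy, rfl⟩ := mem_image.1 hy'
    rw [hFι, hFι]
    exact isSimp_of_isSimplicialMap hT.card_eq hsimp t ht x hx y hy
  · rw [bd_image hι 2] at hb hff'
    have hf'ι : ∀ v ∈ verts (bd 2 T), f' (ι v) = f v := by
      intro v hv
      rw [hff' _ (by rw [verts_image]; exact mem_image_of_mem ι hv), hFι]
    have hbd' : (complexOf T').boundary = complexOf ((bd 2 T).image (image ι)) := by
      rw [hT'.boundary_complexOf, hb]
    -- the competitor is a filling diagram for `γ`
    have hfill : X.IsFillingDiagram γ (complexOf T') f' := by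
      refine ⟨hT'.isTriangulatedDisc, ?_, ?_, ?_⟩
      · obtain ⟨e, he⟩ := hT.bd_nonempty
        obtain ⟨v, hv⟩ := card_pos.1 (by rw [(mem_bd.1 he).1]; norm_num : 0 < #e)
        have hv : v ∈ verts (bd 2 T) := mem_verts.2 ⟨e, he, hv⟩
        refine hT'.map_le hX7 hf' (v := ι v) ?_ ?_
        · refine verts_bd_subset T' ?_
          rw [hb, verts_image]
          exact mem_image_of_mem ι hv
        · rw [hf'ι v hv]
          obtain ⟨t, ht, hvt⟩ := mem_verts.1 (verts_bd_subset T hv)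
          refine isVertex_of_mem (s := t.image f) (hsimp ⟨t, ⟨⟨v, hvt⟩, t, ht, Subset.rfl⟩, rfl⟩)
            (mem_image_of_mem f hvt)
      · intro x' hx' y' hy' hxy
        rw [Set.mem_ofPred_eq, hbd', isVertex_complexOf, verts_image] at hx' hy'
        obtain ⟨x, hx, rfl⟩ := mem_image.1 hx'
        obtain ⟨y, hy, rfl⟩ := mem_image.1 hy'
        rw [hf'ι x hx, hf'ι y hy] at hxy
        congr 1
        refine hD.1.injOn_boundary ?_ ?_ hxy <;>
          rw [Set.mem_ofPred_eq, hbd, isVertex_complexOf] <;> assumption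
      · rw [hbd', map_complexOf, image_image, ← hD.1.map_boundary, hbd, map_complexOf]
        congr 1
        refine image_congr fun e he => ?_
        rw [Function.comp_apply, image_image]
        exact image_congr fun v hv => hf'ι v (mem_verts.2 ⟨e, he, hv⟩)
    have := hD.2 W' (complexOf T') f' hfill
    rwa [area_complexOf hT'.card_eq, ← hDe, area_complexOf hT.card_eq,
      ← card_image_of_injective T (image_injective hι)] at this

/-- The isoperimetric inequality for a disc inside a minimal filling diagram, with an infinite
supply of vertices for the modifications of the diagram. -/
theorem area_lt_of_isMinimal {W' : Type w} [Infinite W'] {ι : W → W'} (hι : Function.Injective ι)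
    (hX : X.IsSimplyConnected) (hX7 : X.IsLocated 7)
    {a : V} {γ : X.oneSkeleton.Walk a a} {D : PreAbstractSimplicialComplex W} {f : W → V}
    (hD : X.IsMinimalFillingDiagram γ D f) {v₀ : W} {α : D.oneSkeleton.Walk v₀ v₀}
    (hα : α.IsCycle) {D₀ : PreAbstractSimplicialComplex W} (hD₀ : D₀ ≤ D)
    (hdisc : D₀.IsTriangulatedDisc)
    (hbdry : D₀.boundary = PreAbstractSimplicialComplex.walkComplex α) :
    D₀.area < 3 * α.length ^ 2 := by
  have hT₀ := isDisc_triangles hdisc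
  have hsub : triangles hdisc ⊆ triangles hD.1.disc := fun t ht =>
    (mem_triangles _).2 (((mem_triangles _).1 ht).imp_left fun h => hD₀ h)
  have hbd : bd 2 (triangles hdisc) = walkEdges α := by
    refine complexOf_injOn (k := 1) (fun e he => (mem_bd.1 he).1)
      (fun e he => card_of_mem_walkEdges he) ?_
    rw [← hT₀.boundary_complexOf, complexOf_triangles, hbdry, walkComplex_eq]
  have harea : D₀.area = #(triangles hdisc) := by
    rw [← area_complexOf hT₀.card_eq, complexOf_triangles]
  obtain ⟨T', T₀', f', h, hb, hc⟩ := exists_isExtremal (isMin_image hι hX7.1 hD)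
    (image_subset_image hsub) (hT₀.image hι)
  have hlt := (h.isTame (isNearLocated hX hX7)).card_lt
  rw [hb, hc, bd_image hι 2, card_image_of_injective _ (image_injective hι),
    card_image_of_injective _ (image_injective hι), hbd, card_walkEdges hα.isTrail, ← harea] at hlt
  exact hlt

end Minimal

end

end

end DiscFilling

theorem mainTheorem1 {V : Type u} {W : Type w}
    (X : PreAbstractSimplicialComplex V) (hX : X.IsSimplyConnected) (hX7 : X.IsLocated 7)
    {a : V} (γ : X.oneSkeleton.Walk a a) (hγ : γ.IsCycle)
    (D : PreAbstractSimplicialComplex W) (f : W → V) (hD : X.IsMinimalFillingDiagram γ D f)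
    {v₀ : W} (α : D.oneSkeleton.Walk v₀ v₀) (hα : α.IsCycle) (n : ℕ) (hn : α.length = n)
    (D₀ : PreAbstractSimplicialComplex W) (hD₀ : D₀ ≤ D) (hdisc : D₀.IsTriangulatedDisc)
    (hbdry : D₀.boundary = PreAbstractSimplicialComplex.walkComplex α)
    (const : ℕ) (hconst : 2 < const) :
    D₀.area < const * n ^ 2 := by
  have hlt := DiscFilling.area_lt_of_isMinimal (W' := W ⊕ ULift.{w} ℕ) Sum.inl_injective hX hX7
    hD hα hD₀ hdisc hbdry
  rw [hn] at hlt
  exact hlt.trans_le (Nat.mul_le_mul_right _ hconst)
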